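/- Consider $\pm1$ spin configurations $\sigma\in\Omega=\{-1,1\}^{\mathbb Z^2}$, and write $[\sigma]_A=\prod_{x\in A}\sigma_x$ for finite $A\subset\mathbb Z^2$. Fix a fundamental plaquette $B_*$: for the square plaquette model (SPM) $B_*=\{0,1\}^2$, for the triangular plaquette model (TPM) $B_*=\{0,\vec e_2,\vec e_1+\vec e_2\}$. Plaquettes are the translates of $B_*$. For finite $\Lambda\subset\mathbb Z^2$, $\tau\in\Omega$ and $\beta>0$, let $\mu_\Lambda^{\beta,\tau}$ be the probability measure on $\{\sigma\in\Omega:\sigma=\tau \text{ off }\Lambda\}$ with weights proportional to $\exp\bigl(\frac\beta2\sum_{B\cap\Lambda\ne\emptyset}[\sigma]_B\bigr)$, the sum running over plaquettes $B$. For each $\beta>0$ each model has a unique infinite-volume Gibbs measure $\mu^\beta$, i.e. a unique probability measure on $\Omega$ satisfying the DLR equations. Let $d$ be the $\ell_1$ distance on $\mathbb Z^2$; all scales $\ell$ below are positive integers. Mixing scale. Fix $\varepsilon_0>0$ independent of $\beta$. Let $\|H\|=|B_*|/2$, $Q_\ell=\{1,\dots,\ell\}^2$, $h_x(\sigma)=\exp\bigl(\frac\beta2\sum_{B\ni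 x}([\sigma^x]_B-[\sigma]_B)\bigr)$, where $\sigma^x$ is $\sigma$ with the spin at $x$ flipped, and let $\varphi(\ell)$ be the supremum of $|\mathrm{Cov}_{Q_\ell}^{\beta,\tau}(h_x,h_y)|$ (covariance under $\mu_{Q_\ell}^{\beta,\tau}$) over all $\tau\in\Omega$ and all $x,y\notin Q_\ell$ with $d(x,y)\ge\ell/4$. Then $\ell_c^{(\mathrm{mix})}$ is the smallest $\ell$ with $e^{4\beta\|H\|}\,\ell\,\varphi(\ell)\le\varepsilon_0$. Cavity scale. Let $V=[-\frac\ell2,\frac\ell2]^2\cap\mathbb Z^2$ and $\Lambda=[-5\ell,5\ell]^2\cap\mathbb Z^2$, and let $\psi(\ell)$ be the supremum over $\tau,\tau'\in\Omega$ of the total variation distance between the marginals on $\{-1,1\}^V$ of $\mu_\Lambda^{\beta,\tau}$ and $\mu_\Lambda^{\beta,\tau'}$. Then $\ell_c^{(\mathrm{cavity})}=\min\{\ell:\ \psi(\ell')\le 1/10\ \ \forall \ell'\ge\ell\}$. Multispin scale. $\ell_c^{(\mathrm{multispin})}$ is the smallest $\ell$ such that $|\mu^\beta([\sigma]_A)|\le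 1/5$ for every finite non-empty $A\subset\mathbb Z^2$ with $d(x,y)\ge\ell$ for all distinct $x,y\in A$. Theorem. As $\beta\to\infty$: (SPM) $\ell_c^{(\mathrm{cavity})}=O(\beta\,\ell_c^{(\mathrm{mix})})$, $\ \ell_c^{(\mathrm{cavity})}=\Omega(e^{\beta})$, $\ \ell_c^{(\mathrm{multispin})}\asymp e^{\beta/2}$. (TPM) $\ell_c^{(\mathrm{cavity})}=O(\beta\,\ell_c^{(\mathrm{mix})})$, $\ \ell_c^{(\mathrm{cavity})}=\Omega\bigl(e^{\frac{\ln 2}{\ln 3}\beta}\bigr)$, $\ \ell_c^{(\mathrm{multispin})}\asymp e^{\frac{\ln 2}{\ln 3}\beta}$. In particular, for both models $\ell_c^{(\mathrm{cavity})}=O(\beta e^{\beta})$. Here $f=\Omega(g)$ means $g=O(f)$, and $f\asymp g$ means $f=O(g)$ and $g=O(f)$. -/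

import Mathlib

open Filter MeasureTheory
open scoped Asymptotics

noncomputable section

namespace Plaquette

/-- The lattice `ℤ²`. -/
abbrev Site : Type := ℤ × ℤ

/-- Spin configurations `σ ∈ {-1, 1}^{ℤ²}`; `ℤˣ` is the two-element set `{1, -1}`, and
configurations carry the product sigma-algebra. -/
abbrev Config : Type := Site → ℤˣ

/-- The `ℓ₁` distance on `ℤ²`. -/
def dist1 (x y : Site) : ℕ := (x.1 - y.1).natAbs + (x.2 - y.2).natAbs

/-- The multispin `[σ]_A = ∏_{x ∈ A} σ_x`, as a real number. -/
def multispin (A : Finset Site) (σ : Config) : ℝ := ((∏ x ∈ A, σ x : ℤˣ) : ℤ)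

/-- The configuration `σ^x`, obtained by flipping the spin at `x`. -/
def flip (σ : Config) (x : Site) : Config := Function.update σ x (-σ x)

/-- The translate `B + x`. -/
def translate (B : Finset Site) (x : Site) : Finset Site := B.image (fun b => b + x)

/-- The finite family `𝓑(Λ)` of all translates of the fundamental plaquette `B` that meet `Λ`. -/
def plaquettes (B Λ : Finset Site) : Finset (Finset Site) :=
  Λ.biUnion fun z => B.image fun b => translate B (z - b)

theorem mem_plaquettes (B Λ P : Finset Site) :
    P ∈ plaquettes B Λ ↔ (∃ x, P = translate B x) ∧ (P ∩ Λ).Nonempty := by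
  simp only [plaquettes, Finset.mem_biUnion, Finset.mem_image]
  constructor
  · rintro ⟨z, hz, b, hb, rfl⟩
    refine ⟨⟨_, rfl⟩, z, Finset.mem_inter.2 ⟨?_, hz⟩⟩
    exact Finset.mem_image.2 ⟨b, hb, by abel⟩
  · rintro ⟨⟨x, rfl⟩, z, hz⟩
    obtain ⟨hz1, hz2⟩ := Finset.mem_inter.1 hz
    obtain ⟨b, hb, rfl⟩ := Finset.mem_image.1 hz1
    exact ⟨b + x, hz2, b, hb, by congr 1; abel⟩

/-- The configuration equal to `η` in `Λ` and to `τ` outside `Λ`. -/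
def glue (Λ : Finset Site) (η : Λ → ℤˣ) (τ : Config) : Config :=
  fun x => if hx : x ∈ Λ then η ⟨x, hx⟩ else τ x

/-- The Boltzmann weight `exp((β/2) ∑_{P ∈ 𝓑(Λ)} [σ]_P)`. -/
def weight (B : Finset Site) (β : ℝ) (Λ : Finset Site) (σ : Config) : ℝ :=
  Real.exp (β / 2 * ∑ P ∈ plaquettes B Λ, multispin P σ)

/-- The partition function `Z_Λ^{β,τ}`. -/
def partitionFunction (B : Finset Site) (β : ℝ) (Λ : Finset Site) (τ : Config) : ℝ :=
  ∑ η : Λ → ℤˣ, weight B β Λ (glue Λ η τ)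

/-- The expectation `μ_Λ^{β,τ}(f)` in the finite-volume Gibbs measure in `Λ` with boundary
condition `τ`. -/
def gibbsExp (B : Finset Site) (β : ℝ) (Λ : Finset Site) (τ : Config) (f : Config → ℝ) : ℝ :=
  (∑ η : Λ → ℤˣ, f (glue Λ η τ) * weight B β Λ (glue Λ η τ)) / partitionFunction B β Λ τ

/-- The probability `μ_Λ^{β,τ}(E)` of an event. -/
def gibbsProb (B : Finset Site) (β : ℝ) (Λ : Finset Site) (τ : Config) (E : Set Config) : ℝ :=
  gibbsExp B β Λ τ (E.indicator fun _ => 1)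

/-- The covariance of `f` and `g` with respect to `μ_Λ^{β,τ}`. -/
def gibbsCov (B : Finset Site) (β : ℝ) (Λ : Finset Site) (τ : Config) (f g : Config → ℝ) : ℝ :=
  gibbsExp B β Λ τ (fun σ => f σ * g σ) - gibbsExp B β Λ τ f * gibbsExp B β Λ τ g

/-- `μ` is an infinite-volume Gibbs measure: a probability measure on `{-1, 1}^{ℤ²}` that
satisfies the DLR equations `μ(E) = ∫ μ_Λ^{β,τ}(E) dμ(τ)` for every finite `Λ` and every event
`E`. -/
def IsGibbs (B : Finset Site) (β : ℝ) (μ : Measure Config) : Prop :=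
  IsProbabilityMeasure μ ∧
    ∀ (Λ : Finset Site) (E : Set Config), MeasurableSet E →
      μ.real E = ∫ τ, gibbsProb B β Λ τ E ∂μ

/-- `h_x(σ) = exp((β/2) ∑_{P ∋ x} ([σ^x]_P - [σ]_P))`. -/
def flipRatio (B : Finset Site) (β : ℝ) (x : Site) (σ : Config) : ℝ :=
  Real.exp (β / 2 * ∑ P ∈ plaquettes B {x}, (multispin P (flip σ x) - multispin P σ))

/-- The square `Q_ℓ = {1, …, ℓ}²`. -/
def square (ℓ : ℕ) : Finset Site := Finset.Icc 1 (ℓ : ℤ) ×ˢ Finset.Icc 1 (ℓ : ℤ)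

/-- `φ(ℓ)`: the supremum of `|Cov_{Q_ℓ}^{β,τ}(h_x, h_y)|` over all boundary conditions `τ` and
all `x, y ∉ Q_ℓ` at distance at least `ℓ/4`. The set is non-empty, and bounded because
`|h_x| ≤ e^{2|β|‖H‖}`. -/
def phi (B : Finset Site) (β : ℝ) (ℓ : ℕ) : ℝ :=
  sSup {r | ∃ (x y : Site) (τ : Config), x ∉ square ℓ ∧ y ∉ square ℓ ∧
    (ℓ : ℝ) / 4 ≤ (dist1 x y : ℝ) ∧
    r = |gibbsCov B β (square ℓ) τ (flipRatio B β x) (flipRatio B β y)|}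

/-- The norm `‖H‖ = |B_*| / 2` of the interaction. -/
def hNorm (B : Finset Site) : ℝ := (B.card : ℝ) / 2

/-- The strong mixing scale: the smallest positive integer `ℓ` such that
`e^{4β‖H‖} ℓ φ(ℓ) ≤ ε₀`. -/
def mixScale (B : Finset Site) (ε₀ β : ℝ) : ℕ :=
  sInf {ℓ : ℕ | 1 ≤ ℓ ∧ Real.exp (4 * β * hNorm B) * ℓ * phi B β ℓ ≤ ε₀}

/-- The lattice points of the square `[-k/2, k/2]²` of side `k` centred at the origin. -/
def centredSquare (k : ℕ) : Finset Site :=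
  Finset.Icc (-((k / 2 : ℕ) : ℤ)) ((k / 2 : ℕ) : ℤ) ×ˢ
    Finset.Icc (-((k / 2 : ℕ) : ℤ)) ((k / 2 : ℕ) : ℤ)

/-- The total variation distance between the marginals on `V` of `μ_Λ^{β,τ}` and
`μ_Λ^{β,τ'}`: the maximum over all events `A ⊆ {-1, 1}^V` of the difference of their
probabilities. -/
def tvMarginal (B : Finset Site) (β : ℝ) (V Λ : Finset Site) (τ τ' : Config) : ℝ :=
  ⨆ A : Set (V → ℤˣ),
    |gibbsProb B β Λ τ {σ | (fun x : V => σ x) ∈ A} -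
      gibbsProb B β Λ τ' {σ | (fun x : V => σ x) ∈ A}|

/-- `ψ(ℓ)`: the supremum over pairs of boundary conditions of the total variation distance
between the marginals on the square of side `ℓ` of the Gibbs measures on the concentric square
of side `10ℓ`. -/
def psi (B : Finset Site) (β : ℝ) (ℓ : ℕ) : ℝ :=
  ⨆ p : Config × Config, tvMarginal B β (centredSquare ℓ) (centredSquare (10 * ℓ)) p.1 p.2

/-- The cavity scale: the smallest positive integer `ℓ` such that `ψ(ℓ') ≤ 1/10` for all
`ℓ' ≥ ℓ`. -/
def cavityScale (B : Finset Site) (β : ℝ) : ℕ :=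
  sInf {ℓ : ℕ | 1 ≤ ℓ ∧ ∀ ℓ' : ℕ, ℓ ≤ ℓ' → psi B β ℓ' ≤ 1 / 10}

/-- `A` is a finite non-empty set whose distinct points are at mutual distance at least `ℓ`. -/
def Separated (ℓ : ℕ) (A : Finset Site) : Prop :=
  A.Nonempty ∧ ∀ x ∈ A, ∀ y ∈ A, x ≠ y → ℓ ≤ dist1 x y

/-- The multispin scale of a probability measure `μ` on configurations: the smallest positive
integer `ℓ` such that `|μ([σ]_A)| ≤ 1/5` for all finite non-empty `ℓ`-separated sets `A`. -/
def multispinScale (μ : Measure Config) : ℕ :=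
  sInf {ℓ : ℕ | 1 ≤ ℓ ∧ ∀ A : Finset Site, Separated ℓ A → |∫ σ, multispin A σ ∂μ| ≤ 1 / 5}

/-- The fundamental plaquette of the square plaquette model: the unit square `{0, 1}²`. -/
def spm : Finset Site := {(0, 0), (1, 0), (0, 1), (1, 1)}

/-- The fundamental plaquette of the triangular plaquette model: the right triangle with vertices
`0`, `e₂` and `e₁ + e₂`. -/
def tpm : Finset Site := {(0, 0), (0, 1), (1, 1)}

end Plaquette

end

/-! The plaquette variables `[σ]_{B + z}` satisfy few relations at a given scale, and the proof
exploits this through the high-temperature expansion in powers of `t = tanh (β / 2)`, where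
`1 - t` is of order `e^{-β}`.

*Upper bound on the cavity scale.* A set of plaquettes contributes to the expansion of a partition
function only if it is a cycle: it covers each site of the domain an even number of times. A cycle
that misses a spanning set of positions is empty, and squares (SPM) or triangles (TPM) of side
proportional to `M` have `M` disjoint spanning sets (`tight_box`, `spans_tri`). Hence a non-empty
cycle has at least `M` elements, the generating function of the non-empty cycles is at most
`M ((1 + t^M)^N - 1)` (`Tight.cycleSum_le`), and the partition function of such a domain hardly
depends on the boundary condition (`partitionFunction_le`). If the domain separates a boundary spin
from a window, then this spin has little influence on the window (`gibbsSum_flip_le`); changing the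
boundary spins one at a time gives spatial mixing (`Insulated.gibbsExp_le`). It entails uniqueness
of the infinite-volume measure (`IsGibbs.unique`), and `ψ(ℓ) ≤ 1/10` as soon as `ℓ ≥ 480 β e^β`
(`HasInsulation.psi_le`).

*Multispin scale.* In infinite volume `μ([σ]_A) = t^{|F|}` if `A` is the boundary of the finite set
`F` of plaquettes (`IsGibbs.integral_multispin_of_isBoundary`), and `μ([σ]_A) = 0` if `A` is not a
boundary (`IsGibbs.integral_multispin_eq_zero`). Over `ZMod 2`, the plaquette `P` viewed as a
polynomial satisfies `P · P^{2^n - 1} = P^{2^n}`: the Sierpinski set `P^{2^n - 1}`, which has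
`|B|^n` points, has the dilated plaquette `2^n B` as its boundary (`conv_sum_sierpinski`,
`isBoundary_sierpinski`). Multiplication by the Sierpinski set also shows that `|F| ≥ |B|^{n - 1}` if
the boundary of `F` is non-empty and `2^{n + 1}`-separated (`card_pow_le_of_separated`). The
transition at `|F| ≈ e^β` thus takes place at the scale `2^n` with `|B|^n ≈ e^β`, that is
`2^n ≈ e^{β ln 2 / ln |B|}` (`multispinScale_isTheta`).

*Lower bound on the cavity scale.* By Griffiths' inequality, under plus boundary conditions the
expectation of the multispin of `∂F ∩ Λ` is at least `t^{|F|}` (`tanh_pow_le_gibbsExp`), and flipping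
spins along a configuration without negative plaquettes changes its sign (`tanh_pow_le_psi`). The
set `F` is a half column of plaquettes for the SPM, and a Sierpinski set that leaves the square for
the TPM.

*Mixing scale.* The bound `ℓ_c^(cavity) = O(β ℓ_c^(mix))` follows from `ℓ_c^(cavity) = O(β e^β)` and
`e^β ≤ ℓ_c^(mix)` (`eventually_exp_le_mixScale`). For the latter, a quantitative form of the second
Griffiths inequality (`le_covariance`) bounds from below the covariance of two plaquette variables
in the row at the bottom of `Q_ℓ`: this row is a cycle, and a droplet of minus spins exists whose
only negative plaquettes in the row are the given two (`HasDroplets`). Through `h_x` and `h_y` this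
gives `e^{4β‖H‖} φ(ℓ) ≥ c e^β` for `ℓ ≤ e^β` (`HasDroplets.lt_mul_phi`). That the mixing
criterion holds for some `ℓ`, so that the infimum which defines the scale is attained, is again
spatial mixing (`HasCollars.exists_mul_phi_le`). -/

noncomputable section

namespace Plaquette

/-! ### Plaquettes and their positions -/

theorem mem_translate {B : Finset Site} {x z : Site} : x ∈ translate B z ↔ x - z ∈ B := by
  simp only [translate, Finset.mem_image]
  constructor
  · rintro ⟨b, hb, rfl⟩
    simpa using hb
  · intro h
    exact ⟨x - z, h, by abel⟩

theorem card_translate (B : Finset Site) (z : Site) : (translate B z).card = B.card :=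
  Finset.card_image_of_injective _ (add_left_injective z)

/-- The positions `z` of the plaquettes `B + z` that meet `Λ`. -/
def positions (B Λ : Finset Site) : Finset Site :=
  Λ.biUnion fun x => B.image fun b => x - b

theorem mem_positions {B Λ : Finset Site} {z : Site} :
    z ∈ positions B Λ ↔ ∃ x ∈ Λ, x ∈ translate B z := by
  simp only [positions, Finset.mem_biUnion, Finset.mem_image, mem_translate]
  constructor
  · rintro ⟨x, hx, b, hb, rfl⟩
    exact ⟨x, hx, by simpa using hb⟩
  · rintro ⟨x, hx, h⟩
    exact ⟨x, hx, x - z, h, by abel⟩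

theorem positions_mono {B Λ Λ' : Finset Site} (h : Λ ⊆ Λ') : positions B Λ ⊆ positions B Λ' := by
  intro z hz
  obtain ⟨x, hx, hxz⟩ := mem_positions.1 hz
  exact mem_positions.2 ⟨x, h hx, hxz⟩

theorem card_positions_le (B Λ : Finset Site) : (positions B Λ).card ≤ B.card * Λ.card := by
  refine Finset.card_biUnion_le.trans ?_
  refine (Finset.sum_le_card_nsmul _ _ B.card fun x _ => Finset.card_image_le).trans ?_
  simp [mul_comm]

/-- Translates of a non-empty finite set by different vectors differ: the sum of the points of
the translate determines the vector. -/
theorem translate_injective {B : Finset Site} (hB : B.Nonempty) :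
    Function.Injective (translate B) := by
  intro z z' h
  have hsum : ∀ w : Site, ∑ x ∈ translate B w, x = ∑ b ∈ B, b + B.card • w := by
    intro w
    rw [translate, Finset.sum_image fun a _ b _ hab => add_left_injective w hab,
      Finset.sum_add_distrib, Finset.sum_const]
  have h2 := hsum z
  rw [h, hsum z', add_right_inj] at h2
  have hc : B.card ≠ 0 := Finset.card_ne_zero.2 hB
  exact (smul_right_injective Site hc h2).symm

theorem plaquettes_eq_image (B Λ : Finset Site) :
    plaquettes B Λ = (positions B Λ).image (translate B) := by
  ext P
  rw [mem_plaquettes, Finset.mem_image]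
  constructor
  · rintro ⟨⟨z, rfl⟩, x, hx⟩
    obtain ⟨h1, h2⟩ := Finset.mem_inter.1 hx
    exact ⟨z, mem_positions.2 ⟨x, h2, h1⟩, rfl⟩
  · rintro ⟨z, hz, rfl⟩
    obtain ⟨x, hx, hxz⟩ := mem_positions.1 hz
    exact ⟨⟨z, rfl⟩, x, Finset.mem_inter.2 ⟨hxz, hx⟩⟩

theorem sum_plaquettes {B : Finset Site} (hB : B.Nonempty) (Λ : Finset Site)
    (f : Finset Site → ℝ) :
    ∑ P ∈ plaquettes B Λ, f P = ∑ z ∈ positions B Λ, f (translate B z) := by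
  rw [plaquettes_eq_image, Finset.sum_image fun a _ b _ h => translate_injective hB h]

/-! ### Multispins -/

theorem multispin_eq_or (A : Finset Site) (σ : Config) :
    multispin A σ = 1 ∨ multispin A σ = -1 := by
  unfold multispin
  rcases Int.units_eq_one_or (∏ x ∈ A, σ x) with h | h <;> simp [h]

theorem multispin_mul_self (A : Finset Site) (σ : Config) :
    multispin A σ * multispin A σ = 1 := by
  rcases multispin_eq_or A σ with h | h <;> simp [h]

theorem abs_multispin (A : Finset Site) (σ : Config) : |multispin A σ| = 1 := by
  rcases multispin_eq_or A σ with h | h <;> simp [h]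

theorem multispin_congr {A : Finset Site} {σ σ' : Config} (h : ∀ x ∈ A, σ x = σ' x) :
    multispin A σ = multispin A σ' := by
  unfold multispin
  rw [Finset.prod_congr rfl h]

theorem multispin_mul (A : Finset Site) (σ σ' : Config) :
    multispin A (σ * σ') = multispin A σ * multispin A σ' := by
  simp [multispin, Finset.prod_mul_distrib]

@[simp] theorem multispin_one (A : Finset Site) : multispin A 1 = 1 := by simp [multispin]

theorem flip_apply_of_ne {σ : Config} {x y : Site} (h : y ≠ x) : flip σ x y = σ y := by
  simp [flip, h]

theorem flip_flip (σ : Config) (x : Site) : flip (flip σ x) x = σ := by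
  simp [flip]

theorem multispin_flip_of_notMem {A : Finset Site} {x : Site} (h : x ∉ A) (σ : Config) :
    multispin A (flip σ x) = multispin A σ :=
  multispin_congr fun y hy => flip_apply_of_ne (by rintro rfl; exact h hy)

theorem multispin_flip_of_mem {A : Finset Site} {x : Site} (h : x ∈ A) (σ : Config) :
    multispin A (flip σ x) = -multispin A σ := by
  unfold multispin
  rw [← Finset.mul_prod_erase _ _ h, ← Finset.mul_prod_erase _ (fun y => σ y) h]
  have : ∏ y ∈ A.erase x, flip σ x y = ∏ y ∈ A.erase x, σ y :=
    Finset.prod_congr rfl fun y hy => flip_apply_of_ne (Finset.ne_of_mem_erase hy)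
  rw [this]
  simp [flip]

/-- The product of the plaquette variables at the positions in `F`. -/
def plaqProd (B F : Finset Site) (σ : Config) : ℝ := ∏ z ∈ F, multispin (translate B z) σ

theorem abs_plaqProd (B F : Finset Site) (σ : Config) : |plaqProd B F σ| = 1 := by
  simp [plaqProd, Finset.abs_prod, abs_multispin]

@[simp] theorem plaqProd_empty (B : Finset Site) (σ : Config) : plaqProd B ∅ σ = 1 := rfl

theorem plaqProd_mul_plaqProd (B F G : Finset Site) (σ : Config) :
    plaqProd B F σ * plaqProd B G σ = plaqProd B (symmDiff F G) σ := by
  have h1 : plaqProd B F σ = plaqProd B (F \ G) σ * plaqProd B (F ∩ G) σ := by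
    unfold plaqProd
    rw [← Finset.prod_union (Finset.disjoint_sdiff_inter F G), Finset.sdiff_union_inter]
  have h2 : plaqProd B G σ = plaqProd B (G \ F) σ * plaqProd B (F ∩ G) σ := by
    unfold plaqProd
    rw [Finset.inter_comm, ← Finset.prod_union (Finset.disjoint_sdiff_inter G F),
      Finset.sdiff_union_inter]
  have h3 : plaqProd B (symmDiff F G) σ = plaqProd B (F \ G) σ * plaqProd B (G \ F) σ := by
    unfold plaqProd
    rw [← Finset.prod_union]
    · rfl
    · exact disjoint_sdiff_sdiff
  have h4 : plaqProd B (F ∩ G) σ * plaqProd B (F ∩ G) σ = 1 := by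
    unfold plaqProd
    rw [← Finset.prod_mul_distrib]
    exact Finset.prod_eq_one fun z _ => multispin_mul_self _ _
  rw [h1, h2, h3]
  linear_combination (plaqProd B (F \ G) σ * plaqProd B (G \ F) σ) * h4

/-- The number of plaquettes with position in `F` that contain `x`. -/
def incidence (B F : Finset Site) (x : Site) : ℕ := (F.filter fun z => x ∈ translate B z).card

theorem plaqProd_flip (B F : Finset Site) (σ : Config) (x : Site) :
    plaqProd B F (flip σ x) = (-1) ^ incidence B F x * plaqProd B F σ := by
  unfold plaqProd incidence
  rw [← Finset.prod_const, Finset.prod_filter, ← Finset.prod_mul_distrib]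
  refine Finset.prod_congr rfl fun z _ => ?_
  split_ifs with h
  · rw [multispin_flip_of_mem h]; ring
  · rw [multispin_flip_of_notMem h]; ring

/-! ### Gluing configurations -/

theorem glue_of_mem {Λ : Finset Site} {x : Site} (hx : x ∈ Λ) (η : Λ → ℤˣ) (τ : Config) :
    glue Λ η τ x = η ⟨x, hx⟩ := by simp [glue, hx]

theorem glue_of_notMem {Λ : Finset Site} {x : Site} (hx : x ∉ Λ) (η : Λ → ℤˣ) (τ : Config) :
    glue Λ η τ x = τ x := by simp [glue, hx]

theorem glue_update {Λ : Finset Site} {x : Site} (hx : x ∈ Λ) (η : Λ → ℤˣ) (τ : Config) :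
    glue Λ (Function.update η ⟨x, hx⟩ (-η ⟨x, hx⟩)) τ = flip (glue Λ η τ) x := by
  funext y
  by_cases hy : y = x
  · subst hy
    simp [glue, hx, flip]
  · rw [flip_apply_of_ne hy]
    by_cases hyΛ : y ∈ Λ
    · rw [glue_of_mem hyΛ, glue_of_mem hyΛ, Function.update_of_ne]
      simpa using hy
    · rw [glue_of_notMem hyΛ, glue_of_notMem hyΛ]

theorem glue_flip {Λ : Finset Site} {x : Site} (hx : x ∉ Λ) (η : Λ → ℤˣ) (τ : Config) :
    glue Λ η (flip τ x) = flip (glue Λ η τ) x := by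
  funext y
  by_cases hy : y ∈ Λ
  · have : y ≠ x := by rintro rfl; exact hx hy
    rw [flip_apply_of_ne this, glue_of_mem hy, glue_of_mem hy]
  · by_cases hyx : y = x
    · subst hyx
      simp [glue, hx, flip]
    · rw [flip_apply_of_ne hyx, glue_of_notMem hy, glue_of_notMem hy, flip_apply_of_ne hyx]

theorem sum_glue_flip {Λ : Finset Site} {x : Site} (hx : x ∈ Λ) (τ : Config) (f : Config → ℝ) :
    ∑ η : Λ → ℤˣ, f (flip (glue Λ η τ) x) = ∑ η : Λ → ℤˣ, f (glue Λ η τ) := by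
  have hinv : Function.Involutive
      (fun η : Λ → ℤˣ => Function.update η ⟨x, hx⟩ (-η ⟨x, hx⟩)) := by
    intro η
    simp
  rw [← Equiv.sum_comp hinv.toPerm fun η => f (glue Λ η τ)]
  refine Finset.sum_congr rfl fun η _ => ?_
  rw [Function.Involutive.coe_toPerm, glue_update hx]

theorem card_spins (Λ : Finset Site) : Fintype.card (Λ → ℤˣ) = 2 ^ Λ.card := by
  simp [Fintype.card_pi]

/-! ### The high-temperature expansion -/

theorem exp_mul_sign (J : ℝ) {s : ℝ} (hs : s = 1 ∨ s = -1) :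
    Real.exp (J * s) = Real.cosh J * (1 + Real.tanh J * s) := by
  have hc : Real.cosh J ≠ 0 := (Real.cosh_pos J).ne'
  have : Real.cosh J * (1 + Real.tanh J * s) = Real.cosh J + Real.sinh J * s := by
    rw [Real.tanh_eq_sinh_div_cosh]; field_simp
  rw [this]
  rcases hs with rfl | rfl
  · rw [mul_one, mul_one, Real.cosh_add_sinh]
  · rw [mul_neg_one, mul_neg_one, ← sub_eq_add_neg, Real.cosh_sub_sinh]

theorem weight_eq_exp {B : Finset Site} (hB : B.Nonempty) (β : ℝ) (Λ : Finset Site) (σ : Config) :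
    weight B β Λ σ = Real.exp (∑ z ∈ positions B Λ, β / 2 * multispin (translate B z) σ) := by
  rw [weight, sum_plaquettes hB, Finset.mul_sum]

theorem weight_pos (B : Finset Site) (β : ℝ) (Λ : Finset Site) (σ : Config) :
    0 < weight B β Λ σ := Real.exp_pos _

theorem partitionFunction_pos (B : Finset Site) (β : ℝ) (Λ : Finset Site) (τ : Config) :
    0 < partitionFunction B β Λ τ :=
  Finset.sum_pos (fun _ _ => weight_pos _ _ _ _) Finset.univ_nonempty

theorem weight_expansion {B : Finset Site} (hB : B.Nonempty) (β : ℝ) (Λ : Finset Site)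
    (σ : Config) :
    weight B β Λ σ = Real.cosh (β / 2) ^ (positions B Λ).card *
      ∑ F ∈ (positions B Λ).powerset, Real.tanh (β / 2) ^ F.card * plaqProd B F σ := by
  rw [weight_eq_exp hB, Real.exp_sum,
    Finset.prod_congr rfl fun z _ => exp_mul_sign (β / 2) (multispin_eq_or (translate B z) σ),
    Finset.prod_mul_distrib, Finset.prod_const]
  congr 1
  simp_rw [add_comm (1 : ℝ)]
  rw [Finset.prod_add]
  refine Finset.sum_congr rfl fun F _ => ?_
  simp [plaqProd, Finset.prod_mul_distrib]

/-- The cycles of `Λ`: the sets of positions whose plaquettes cover each site of `Λ` an even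
number of times. Exactly these sets contribute to the high-temperature expansion. -/
def cycles (B Λ : Finset Site) : Finset (Finset Site) :=
  (positions B Λ).powerset.filter fun F => ∀ x ∈ Λ, Even (incidence B F x)

theorem mem_cycles {B Λ F : Finset Site} :
    F ∈ cycles B Λ ↔ F ⊆ positions B Λ ∧ ∀ x ∈ Λ, Even (incidence B F x) := by
  simp [cycles]

/-- The generating function `∑ t^{|F|}` of the non-empty cycles. -/
def cycleSum (B Λ : Finset Site) (t : ℝ) : ℝ := ∑ F ∈ (cycles B Λ).erase ∅, t ^ F.card

theorem cycleSum_nonneg (B Λ : Finset Site) {t : ℝ} (ht : 0 ≤ t) : 0 ≤ cycleSum B Λ t :=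
  Finset.sum_nonneg fun _ _ => pow_nonneg ht _

theorem sum_plaqProd_eq_zero {B Λ F : Finset Site} (hF : F ⊆ positions B Λ)
    (h : F ∉ cycles B Λ) (τ : Config) :
    ∑ η : Λ → ℤˣ, plaqProd B F (glue Λ η τ) = 0 := by
  have : ∃ x ∈ Λ, ¬ Even (incidence B F x) := by
    by_contra hcon
    push Not at hcon
    exact h (mem_cycles.2 ⟨hF, hcon⟩)
  obtain ⟨x, hx, hodd⟩ := this
  have h1 := sum_glue_flip hx τ (plaqProd B F)
  simp_rw [plaqProd_flip, (Nat.not_even_iff_odd.1 hodd).neg_one_pow] at h1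
  rw [← Finset.mul_sum] at h1
  linarith

theorem abs_sum_plaqProd_le (B Λ F : Finset Site) (τ : Config) :
    |∑ η : Λ → ℤˣ, plaqProd B F (glue Λ η τ)| ≤ 2 ^ Λ.card := by
  refine (Finset.abs_sum_le_sum_abs _ _).trans ?_
  simp [abs_plaqProd, Fintype.card_pi]

/-- In the high-temperature expansion of `∏_{z ∈ F₀} [σ]_{B + z}` the set `F₀` contributes
`t^{|F₀|}`, and the other terms are indexed by the sets `F₀ ∆ G` with `G` a non-empty cycle. -/
theorem abs_sum_plaqProd_weight_sub_le {B : Finset Site} (hB : B.Nonempty) {β : ℝ} (hβ : 0 < β)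
    {Λ F₀ : Finset Site} (hF₀ : F₀ ⊆ positions B Λ) (τ : Config) :
    |(∑ η : Λ → ℤˣ, plaqProd B F₀ (glue Λ η τ) * weight B β Λ (glue Λ η τ)) /
        (Real.cosh (β / 2) ^ (positions B Λ).card * 2 ^ Λ.card) -
      Real.tanh (β / 2) ^ F₀.card| ≤
      (Real.tanh (β / 2) ^ F₀.card)⁻¹ * cycleSum B Λ (Real.tanh (β / 2)) := by
  set t := Real.tanh (β / 2) with ht_def
  have ht : 0 < t := by
    rw [ht_def, Real.tanh_eq_sinh_div_cosh]
    exact div_pos (Real.sinh_pos_iff.2 (by linarith)) (Real.cosh_pos _)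
  have ht1 : t ≤ 1 := (Real.tanh_lt_one _).le
  set C := Real.cosh (β / 2) ^ (positions B Λ).card with hC_def
  have hC : 0 < C := pow_pos (Real.cosh_pos _) _
  set a : Finset Site → ℝ := fun F => ∑ η : Λ → ℤˣ, plaqProd B F (glue Λ η τ) with ha_def
  have hexp : ∑ η : Λ → ℤˣ, plaqProd B F₀ (glue Λ η τ) * weight B β Λ (glue Λ η τ) =
      C * ∑ F ∈ (positions B Λ).powerset, t ^ F.card * a (symmDiff F₀ F) := by
    simp_rw [weight_expansion hB, ha_def, ← plaqProd_mul_plaqProd, Finset.mul_sum]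
    rw [Finset.sum_comm]
    refine Finset.sum_congr rfl fun F _ => Finset.sum_congr rfl fun η _ => ?_
    ring
  have hre : ∑ F ∈ (positions B Λ).powerset, t ^ F.card * a (symmDiff F₀ F) =
      ∑ G ∈ (positions B Λ).powerset, t ^ (symmDiff F₀ G).card * a G := by
    refine Finset.sum_bij' (fun F _ => symmDiff F₀ F) (fun G _ => symmDiff F₀ G) ?_ ?_ ?_ ?_ ?_
    · intro F hF
      rw [Finset.mem_powerset] at hF ⊢
      exact (Finset.symmDiff_subset_union).trans (Finset.union_subset hF₀ hF)
    · intro F hF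
      rw [Finset.mem_powerset] at hF ⊢
      exact (Finset.symmDiff_subset_union).trans (Finset.union_subset hF₀ hF)
    · intro F _; simp
    · intro F _; simp
    · intro F _; simp
  have hcyc : ∑ G ∈ (positions B Λ).powerset, t ^ (symmDiff F₀ G).card * a G =
      ∑ G ∈ cycles B Λ, t ^ (symmDiff F₀ G).card * a G := by
    symm
    refine Finset.sum_subset (Finset.filter_subset _ _) fun G hG hG' => ?_
    rw [ha_def]
    simp only
    rw [sum_plaqProd_eq_zero (Finset.mem_powerset.1 hG) hG', mul_zero]
  have hempty : (∅ : Finset Site) ∈ cycles B Λ := by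
    refine mem_cycles.2 ⟨Finset.empty_subset _, fun x _ => ?_⟩
    simp [incidence]
  have ha0 : a ∅ = 2 ^ Λ.card := by simp [ha_def, Fintype.card_pi]
  have h2 : (0 : ℝ) < 2 ^ Λ.card := by positivity
  rw [hexp, hre, hcyc, ← Finset.add_sum_erase _ _ hempty, ha0]
  have hbot : symmDiff F₀ (∅ : Finset Site) = F₀ := symmDiff_bot F₀
  rw [hbot]
  have : C * (t ^ F₀.card * 2 ^ Λ.card +
      ∑ G ∈ (cycles B Λ).erase ∅, t ^ (symmDiff F₀ G).card * a G) / (C * 2 ^ Λ.card) -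
      t ^ F₀.card =
      (∑ G ∈ (cycles B Λ).erase ∅, t ^ (symmDiff F₀ G).card * a G) / 2 ^ Λ.card := by
    field_simp
    ring
  rw [this, abs_div, abs_of_pos h2, div_le_iff₀ h2, cycleSum, Finset.mul_sum, Finset.sum_mul]
  refine (Finset.abs_sum_le_sum_abs _ _).trans (Finset.sum_le_sum fun G _ => ?_)
  rw [abs_mul, abs_of_pos (pow_pos ht _)]
  refine mul_le_mul ?_ (abs_sum_plaqProd_le B Λ G τ) (abs_nonneg _) (by positivity)
  -- `|F₀ ∆ G| ≥ |G| - |F₀|`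
  have hcard : G.card ≤ F₀.card + (symmDiff F₀ G).card := by
    have : G ⊆ F₀ ∪ symmDiff F₀ G := by
      intro z hz
      by_cases hz0 : z ∈ F₀
      · exact Finset.mem_union_left _ hz0
      · exact Finset.mem_union_right _ (Finset.mem_symmDiff.2 (Or.inr ⟨hz, hz0⟩))
    exact (Finset.card_le_card this).trans (Finset.card_union_le _ _)
  rw [inv_mul_eq_div, le_div_iff₀ (pow_pos ht _), ← pow_add]
  exact pow_le_pow_of_le_one ht.le ht1 (by omega)

/-- Up to a factor that does not depend on the boundary condition, the partition function differs
from `1` by at most the cycle sum. -/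
theorem abs_partitionFunction_sub_le {B : Finset Site} (hB : B.Nonempty) {β : ℝ} (hβ : 0 < β)
    (Λ : Finset Site) (τ : Config) :
    |partitionFunction B β Λ τ / (Real.cosh (β / 2) ^ (positions B Λ).card * 2 ^ Λ.card) - 1| ≤
      cycleSum B Λ (Real.tanh (β / 2)) := by
  simpa [partitionFunction] using
    abs_sum_plaqProd_weight_sub_le hB hβ (Finset.empty_subset (positions B Λ)) τ

/-! ### Spanning sets of positions and the size of cycles -/

/-- The set `S` of positions is spanning for `R`: a function on positions whose sum over the
plaquettes containing any given site of `R` vanishes modulo `2`, and which vanishes on `S`, vanishes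
at the positions of all plaquettes that meet `R`. -/
def Spans (B R : Finset Site) (S : Set Site) : Prop :=
  ∀ f : Site → ZMod 2, (∀ x ∈ R, ∑ b ∈ B, f (x - b) = 0) → (∀ z ∈ S, f z = 0) →
    ∀ x ∈ R, ∀ b ∈ B, f (x - b) = 0

/-- `R` has `M` pairwise disjoint spanning sets: the classes of the colours `k < M` in a colouring
`c` of all positions. -/
def Tight (B R : Finset Site) (M : ℕ) : Prop :=
  ∃ c : Site → ℕ, ∀ k < M, Spans B R {z | c z = k}

theorem Spans.of_cover {B R : Finset Site} {S : Set Site}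
    (h : ∀ x ∈ R, ∃ R' ⊆ R, x ∈ R' ∧ Spans B R' S) : Spans B R S := by
  intro f hf hS x hx b hb
  obtain ⟨R', hR', hxR', hs⟩ := h x hx
  exact hs f (fun y hy => hf y (hR' hy)) hS x hxR' b hb

theorem tight_empty (B : Finset Site) (M : ℕ) : Tight B ∅ M :=
  ⟨fun _ => 0, fun _ _ _ _ _ x hx => by simp at hx⟩

theorem incidence_cast {B F : Finset Site} {x : Site} :
    (incidence B F x : ZMod 2) = ∑ b ∈ B, if x - b ∈ F then (1 : ZMod 2) else 0 := by
  rw [← Finset.sum_filter, Finset.sum_const, nsmul_one, incidence]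
  congr 1
  refine Finset.card_bij' (fun z _ => x - z) (fun b _ => x - b) ?_ ?_ ?_ ?_
  · intro z hz
    simp only [Finset.mem_filter, mem_translate] at hz ⊢
    exact ⟨hz.2, by simpa using hz.1⟩
  · intro b hb
    simp only [Finset.mem_filter, mem_translate] at hb ⊢
    exact ⟨hb.2, by simpa using hb.1⟩
  · intro z _; simp
  · intro b _; simp

theorem mem_cycles_symmDiff {B Λ F G : Finset Site} (hF : F ∈ cycles B Λ) (hG : G ∈ cycles B Λ) :
    symmDiff F G ∈ cycles B Λ := by
  rw [mem_cycles] at hF hG ⊢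
  refine ⟨Finset.symmDiff_subset_union.trans (Finset.union_subset hF.1 hG.1), fun x hx => ?_⟩
  have h1 := (ZMod.natCast_eq_zero_iff_even).2 (hF.2 x hx)
  have h2 := (ZMod.natCast_eq_zero_iff_even).2 (hG.2 x hx)
  rw [← ZMod.natCast_eq_zero_iff_even]
  rw [incidence_cast] at h1 h2 ⊢
  have : ∀ b ∈ B, (if x - b ∈ symmDiff F G then (1 : ZMod 2) else 0) =
      (if x - b ∈ F then (1 : ZMod 2) else 0) + (if x - b ∈ G then (1 : ZMod 2) else 0) := by
    intro b _
    by_cases h1 : x - b ∈ F <;> by_cases h2 : x - b ∈ G <;>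
      simp [Finset.mem_symmDiff, h1, h2]
    decide
  rw [Finset.sum_congr rfl this, Finset.sum_add_distrib, h1, h2, add_zero]

/-- A cycle that misses a spanning set is empty. -/
theorem Spans.eq_empty {B R F : Finset Site} {S : Set Site} (hS : Spans B R S)
    (hF : F ∈ cycles B R) (h : ∀ z ∈ F, z ∉ S) : F = ∅ := by
  rw [mem_cycles] at hF
  by_contra hne
  obtain ⟨z, hz⟩ := Finset.nonempty_iff_ne_empty.2 hne
  obtain ⟨x, hx, hxz⟩ := mem_positions.1 (hF.1 hz)
  have := hS (fun z => if z ∈ F then 1 else 0) (fun x hx => by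
    rw [← incidence_cast]
    exact (ZMod.natCast_eq_zero_iff_even).2 (hF.2 x hx)) (fun z hz => by
    have : z ∉ F := fun hzF => h z hzF hz
    simp [this]) x hx (x - z) (mem_translate.1 hxz)
  simp [hz] at this

/-- With `M` disjoint spanning sets, a non-empty cycle `F` meets one of them, `S` say, in at most
`|F|/M` and at least one point, and it is determined by this intersection. -/
theorem Tight.cycleSum_le {B R : Finset Site} {M : ℕ} (hM : 0 < M) (h : Tight B R M) {t : ℝ}
    (ht : 0 ≤ t) (ht1 : t ≤ 1) {N : ℕ} (hN : (positions B R).card ≤ N) :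
    cycleSum B R t ≤ M * ((1 + t ^ M) ^ N - 1) := by
  obtain ⟨c, hc⟩ := h
  set S : ℕ → Finset Site → Finset Site := fun k F => F.filter fun z => c z = k with hS
  have hterm : ∀ F ∈ (cycles B R).erase ∅,
      t ^ F.card ≤ ∑ k ∈ Finset.range M, t ^ (M * (S k F).card) := by
    intro F _
    have hsum : ∑ k ∈ Finset.range M, (S k F).card ≤ F.card := by
      rw [← Finset.card_biUnion]
      · refine Finset.card_le_card ?_
        intro z hz
        obtain ⟨k, _, hk⟩ := Finset.mem_biUnion.1 hz
        exact (Finset.mem_filter.1 hk).1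
      · intro i _ j _ hij
        rw [Function.onFun, Finset.disjoint_left]
        intro z hz hz'
        exact hij ((Finset.mem_filter.1 hz).2.symm.trans (Finset.mem_filter.1 hz').2)
    obtain ⟨k, hk, hle⟩ : ∃ k ∈ Finset.range M, M * (S k F).card ≤ F.card := by
      by_contra hcon
      push Not at hcon
      have h1 : ∑ k ∈ Finset.range M, F.card < ∑ k ∈ Finset.range M, M * (S k F).card :=
        Finset.sum_lt_sum_of_nonempty ⟨0, Finset.mem_range.2 hM⟩ hcon
      rw [Finset.sum_const, Finset.card_range, smul_eq_mul, ← Finset.mul_sum] at h1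
      exact absurd (Nat.mul_le_mul_left M hsum) (not_le.2 h1)
    calc t ^ F.card ≤ t ^ (M * (S k F).card) := pow_le_pow_of_le_one ht ht1 hle
      _ ≤ _ := Finset.single_le_sum (f := fun k => t ^ (M * (S k F).card))
          (fun i _ => pow_nonneg ht _) hk
  have hpow : ∀ (U : Finset Site), ∑ T ∈ U.powerset, t ^ (M * T.card) = (1 + t ^ M) ^ U.card := by
    intro U
    rw [add_comm, ← Finset.sum_pow_mul_eq_add_pow]
    simp [pow_mul]
  calc cycleSum B R t
      ≤ ∑ F ∈ (cycles B R).erase ∅, ∑ k ∈ Finset.range M, t ^ (M * (S k F).card) :=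
        Finset.sum_le_sum hterm
    _ = ∑ k ∈ Finset.range M, ∑ F ∈ (cycles B R).erase ∅, t ^ (M * (S k F).card) :=
        Finset.sum_comm
    _ ≤ ∑ k ∈ Finset.range M, ((1 + t ^ M) ^ N - 1) := by
        refine Finset.sum_le_sum fun k hk => ?_
        have hinj : Set.InjOn (S k) ((cycles B R).erase ∅ : Finset (Finset Site)) := by
          intro F hF G hG hFG
          have hF' := Finset.mem_of_mem_erase (Finset.mem_coe.1 hF)
          have hG' := Finset.mem_of_mem_erase (Finset.mem_coe.1 hG)
          have hd := (hc k (Finset.mem_range.1 hk)).eq_empty (mem_cycles_symmDiff hF' hG') (by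
            intro z hz hzk
            have hmem : ∀ z, z ∈ S k F ↔ z ∈ S k G := fun z => by rw [hFG]
            have h2 := hmem z
            simp only [hS, Finset.mem_filter] at h2
            have hzk' : c z = k := hzk
            rw [Finset.mem_symmDiff] at hz
            tauto)
          exact symmDiff_eq_bot.1 hd
        rw [← Finset.sum_image (f := fun T : Finset Site => t ^ (M * T.card)) hinj]
        have hsub : ((cycles B R).erase ∅).image (S k) ⊆ (positions B R).powerset.erase ∅ := by
          intro T hT
          obtain ⟨F, hF, rfl⟩ := Finset.mem_image.1 hT
          have hF' := Finset.mem_of_mem_erase hF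
          refine Finset.mem_erase.2 ⟨fun h0 => ?_, Finset.mem_powerset.2
            ((Finset.filter_subset _ _).trans (mem_cycles.1 hF').1)⟩
          refine Finset.ne_of_mem_erase hF ((hc k (Finset.mem_range.1 hk)).eq_empty hF' ?_)
          intro z hz hzk
          have : z ∈ S k F := Finset.mem_filter.2 ⟨hz, hzk⟩
          rw [h0] at this
          simp at this
        refine (Finset.sum_le_sum_of_subset_of_nonneg hsub fun _ _ _ => pow_nonneg ht _).trans ?_
        have := hpow (positions B R)
        rw [← Finset.add_sum_erase _ _ (Finset.empty_mem_powerset _)] at this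
        simp only [Finset.card_empty, mul_zero, pow_zero] at this
        have h3 : (1 + t ^ M) ^ (positions B R).card ≤ (1 + t ^ M) ^ N :=
          pow_le_pow_right₀ (by linarith [pow_nonneg ht M]) hN
        linarith
    _ = M * ((1 + t ^ M) ^ N - 1) := by
        rw [Finset.sum_const, Finset.card_range, nsmul_eq_mul]

/-! ### Squares and triangles are tight -/

/-- The square with lower left corner `(a, b)` and `m²` sites. -/
def box (a b : ℤ) (m : ℕ) : Finset Site :=
  Finset.Icc a (a + m - 1) ×ˢ Finset.Icc b (b + m - 1)

theorem mem_box {a b : ℤ} {m : ℕ} {x : Site} :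
    x ∈ box a b m ↔ (a ≤ x.1 ∧ x.1 ≤ a + m - 1) ∧ b ≤ x.2 ∧ x.2 ≤ b + m - 1 := by
  simp [box]

/-- The triangle with vertices `(a, b)`, `(a + m, b)` and `(a + m, b + m)`. -/
def tri (a b : ℤ) (m : ℕ) : Finset Site :=
  (Finset.Icc a (a + m) ×ˢ Finset.Icc b (b + m)).filter fun x => x.2 - b ≤ x.1 - a

theorem mem_tri {a b : ℤ} {m : ℕ} {x : Site} :
    x ∈ tri a b m ↔ b ≤ x.2 ∧ x.1 ≤ a + m ∧ x.2 - b ≤ x.1 - a := by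
  simp only [tri, Finset.mem_filter, Finset.mem_product, Finset.mem_Icc]
  omega

theorem sum_spm (f : Site → ZMod 2) : ∑ b ∈ spm, f b = f (0, 0) + f (1, 0) + f (0, 1) + f (1, 1) := by
  have h : spm = {(0, 0), (1, 0), (0, 1), (1, 1)} := rfl
  rw [h, Finset.sum_insert (by decide), Finset.sum_insert (by decide),
    Finset.sum_insert (by decide), Finset.sum_singleton]
  ring

theorem sum_tpm (f : Site → ZMod 2) : ∑ b ∈ tpm, f b = f (0, 0) + f (0, 1) + f (1, 1) := by
  have h : tpm = {(0, 0), (0, 1), (1, 1)} := rfl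
  rw [h, Finset.sum_insert (by decide), Finset.sum_insert (by decide), Finset.sum_singleton]
  ring

theorem eq_of_add_eq_zero {u v : ZMod 2} (h : u + v = 0) : u = v := by
  revert u v; decide

/-- An integer in a prescribed residue class, in a given interval of length `n`. -/
theorem exists_emod_eq (a r : ℤ) {n : ℤ} (hr : 0 ≤ r) (hrn : r < n) :
    ∃ x, a ≤ x ∧ x < a + n ∧ x % n = r := by
  have hn : 0 < n := by omega
  refine ⟨a + (r - a) % n, ?_, ?_, ?_⟩
  · have := Int.emod_nonneg (r - a) hn.ne'; omega
  · have := Int.emod_lt_of_pos (r - a) hn; omega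
  · rw [Int.add_emod_emod, add_sub_cancel, Int.emod_eq_of_lt hr hrn]

/-- The colour classes are diagonal staircases that repeat with period `2M`. For `f` in the kernel,
the difference of `f` between two neighbouring rows does not depend on the column, and a staircase
passes through two vertically adjacent positions in some column, where the difference is zero;
likewise for neighbouring columns. So `f` is constant, and it vanishes on the staircase. -/
theorem tight_box (a b : ℤ) {m M : ℕ} (hm : 2 * M ≤ m) : Tight spm (box a b m) M := by
  refine ⟨fun z => ((z.2 - z.1) % (2 * M) / 2).toNat, fun k hk f hf hS => ?_⟩
  have hrel : ∀ x y : ℤ, a ≤ x → x ≤ a + m - 1 → b ≤ y → y ≤ b + m - 1 →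
      f (x, y) + f (x - 1, y) + f (x, y - 1) + f (x - 1, y - 1) = 0 := by
    intro x y h1 h2 h3 h4
    have := hf (x, y) (mem_box.2 ⟨⟨h1, h2⟩, h3, h4⟩)
    rw [sum_spm fun b => f ((x, y) - b)] at this
    simpa using this
  have hcol : ∀ x y : ℤ, (y - x) % (2 * M) = 2 * k ∨ (y - x) % (2 * M) = 2 * k + 1 →
      f (x, y) = 0 := by
    intro x y h
    apply hS
    simp only [Set.mem_ofPred_eq]
    omega
  have hM : (0 : ℤ) < 2 * M := by omega
  -- neighbouring rows agree
  have hvert : ∀ y, b ≤ y → y ≤ b + m - 1 → ∀ x, a - 1 ≤ x → x ≤ a + m - 1 →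
      f (x, y) = f (x, y - 1) := by
    intro y hy1 hy2
    have hconst : ∀ n : ℕ, (n : ℤ) ≤ m → f (a - 1 + n, y) + f (a - 1 + n, y - 1) =
        f (a - 1, y) + f (a - 1, y - 1) := by
      intro n
      induction n with
      | zero => simp
      | succ n ih =>
        intro hn
        rw [← ih (by push_cast at hn; omega)]
        have := hrel (a - 1 + (n + 1)) y (by omega) (by push_cast at hn; omega) hy1 hy2
        have e : a - 1 + ((n : ℤ) + 1) - 1 = a - 1 + n := by ring
        rw [e] at this
        push_cast
        refine eq_of_add_eq_zero ?_
        linear_combination this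
    -- a column where the positions in both rows have colour `k`
    obtain ⟨x₀, hx1, hx2, hx3⟩ := exists_emod_eq (y - 1 - (a - 1) - (2 * M - 1)) (2 * k)
      (n := 2 * M) (by omega) (by omega)
    have h0 : f (y - 1 - x₀, y) = 0 := by
      apply hcol; right
      have : y - (y - 1 - x₀) = x₀ + 1 := by ring
      rw [this, Int.add_emod, hx3, Int.emod_eq_of_lt (a := 1) (by omega) (by omega)]
      exact Int.emod_eq_of_lt (by omega) (by omega)
    have h0' : f (y - 1 - x₀, y - 1) = 0 := by
      apply hcol; left
      have : y - 1 - (y - 1 - x₀) = x₀ := by ring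
      rw [this, hx3]
    intro x hx1' hx2'
    have e1 := hconst (x - (a - 1)).toNat (by omega)
    have e2 := hconst (y - 1 - x₀ - (a - 1)).toNat (by omega)
    rw [Int.toNat_of_nonneg (by omega)] at e1 e2
    have s1 : a - 1 + (x - (a - 1)) = x := by ring
    have s2 : a - 1 + (y - 1 - x₀ - (a - 1)) = y - 1 - x₀ := by ring
    rw [s1] at e1
    rw [s2, h0, h0', ← e1] at e2
    exact eq_of_add_eq_zero (by rw [← e2, add_zero])
  -- neighbouring columns agree
  have hhor : ∀ x, a ≤ x → x ≤ a + m - 1 → ∀ y, b - 1 ≤ y → y ≤ b + m - 1 →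
      f (x, y) = f (x - 1, y) := by
    intro x hx1 hx2
    have hconst : ∀ n : ℕ, (n : ℤ) ≤ m → f (x, b - 1 + n) + f (x - 1, b - 1 + n) =
        f (x, b - 1) + f (x - 1, b - 1) := by
      intro n
      induction n with
      | zero => simp
      | succ n ih =>
        intro hn
        rw [← ih (by push_cast at hn; omega)]
        have := hrel x (b - 1 + (n + 1)) hx1 hx2 (by omega) (by push_cast at hn; omega)
        have e : b - 1 + ((n : ℤ) + 1) - 1 = b - 1 + n := by ring
        rw [e] at this
        push_cast
        refine eq_of_add_eq_zero ?_
        linear_combination this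
    obtain ⟨y₀, hy1, hy2, hy3⟩ := exists_emod_eq (b - 1 - x) (2 * k)
      (n := 2 * M) (by omega) (by omega)
    have h0 : f (x, x + y₀) = 0 := by
      apply hcol; left
      rw [add_sub_cancel_left, hy3]
    have h0' : f (x - 1, x + y₀) = 0 := by
      apply hcol; right
      have : x + y₀ - (x - 1) = y₀ + 1 := by ring
      rw [this, Int.add_emod, hy3, Int.emod_eq_of_lt (a := 1) (by omega) (by omega)]
      exact Int.emod_eq_of_lt (by omega) (by omega)
    intro y hy1' hy2'
    have e1 := hconst (y - (b - 1)).toNat (by omega)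
    have e2 := hconst (x + y₀ - (b - 1)).toNat (by omega)
    rw [Int.toNat_of_nonneg (by omega)] at e1 e2
    have s1 : b - 1 + (y - (b - 1)) = y := by ring
    have s2 : b - 1 + (x + y₀ - (b - 1)) = x + y₀ := by ring
    rw [s1] at e1
    rw [s2, h0, h0', ← e1] at e2
    exact eq_of_add_eq_zero (by rw [← e2, add_zero])
  have hrow : ∀ j : ℕ, (j : ℤ) ≤ m → f (a - 1, b - 1 + j) = f (a - 1, b - 1) := by
    intro j
    induction j with
    | zero => simp
    | succ j ih =>
      intro hj
      push_cast at hj ⊢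
      rw [← ih (by omega), hvert (b - 1 + (j + 1)) (by omega) (by omega) _ (by omega) (by omega)]
      congr 2; ring
  have hall : ∀ i : ℕ, (i : ℤ) ≤ m → ∀ y, b - 1 ≤ y → y ≤ b + m - 1 →
      f (a - 1 + i, y) = f (a - 1, b - 1) := by
    intro i
    induction i with
    | zero =>
      intro _ y h1 h2
      have := hrow (y - (b - 1)).toNat (by omega)
      rw [Int.toNat_of_nonneg (by omega), add_sub_cancel] at this
      simpa using this
    | succ i ih =>
      intro hi y h1 h2
      push_cast at hi ⊢
      rw [← ih (by omega) y h1 h2, hhor (a - 1 + (i + 1)) (by omega) (by omega) y h1 h2]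
      congr 2; ring
  -- a position of colour `k` in the first column
  have hzero : f (a - 1, b - 1) = 0 := by
    obtain ⟨y₀, hy1, hy2, hy3⟩ := exists_emod_eq (b - 1 - (a - 1)) (2 * k)
      (n := 2 * M) (by omega) (by omega)
    have h0 : f (a - 1, a - 1 + y₀) = 0 := by
      apply hcol; left
      rw [add_sub_cancel_left, hy3]
    have := hall 0 (by omega) (a - 1 + y₀) (by omega) (by omega)
    rw [← this, ← h0]; simp
  intro x hx d hd
  rw [mem_box] at hx
  have hd' : (d.1 = 0 ∨ d.1 = 1) ∧ (d.2 = 0 ∨ d.2 = 1) := by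
    have : d ∈ ({(0, 0), (1, 0), (0, 1), (1, 1)} : Finset Site) := hd
    simp only [Finset.mem_insert, Finset.mem_singleton] at this
    rcases this with rfl | rfl | rfl | rfl <;> simp
  have := hall (x.1 - d.1 - (a - 1)).toNat (by omega) (x.2 - d.2) (by omega) (by omega)
  rw [Int.toNat_of_nonneg (by omega), add_sub_cancel, hzero] at this
  exact this

/-- The colouring of the positions of a triangle: by height modulo `M`, except in the lower right
corner, where it is by abscissa modulo `M`. -/
def triColour (x₀ y₀ : ℤ) (M : ℕ) (z : Site) : ℕ :=
  (if 3 * (M : ℤ) < z.1 - x₀ ∧ z.2 - y₀ < 2 * M then (z.1 - x₀) % M else (z.2 - y₀) % M).toNat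

/-- A row of zeros forces zeros above it, and constant values in the row below it. The lowest row
of a given colour, to the left of the corner, gives zeros above it and to the left of the corner,
so the rows under the first row that is entirely of this colour are constant and contain a zero,
by the latter zeros or by those in the corner. -/
theorem spans_tri {x₀ y₀ a b : ℤ} {m M k : ℕ} (hk : k < M) (ha : x₀ ≤ a) (ha' : a ≤ x₀ + 1)
    (hb : y₀ + 1 ≤ b) (hb' : b ≤ y₀ + 2) (hm : 4 * M ≤ m) :
    Spans tpm (tri a b m) {z | triColour x₀ y₀ M z = k} := by
  intro f hf hS
  have hrel : ∀ x y : ℤ, b ≤ y → x ≤ a + m → y - b ≤ x - a →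
      f (x, y) + f (x, y - 1) + f (x - 1, y - 1) = 0 := by
    intro x y h1 h2 h3
    have := hf (x, y) (mem_tri.2 ⟨h1, h2, h3⟩)
    rw [sum_tpm fun b => f ((x, y) - b)] at this
    simpa using this
  have hrowc : ∀ x y : ℤ, (x - x₀ ≤ 3 * M ∨ 2 * M ≤ y - y₀) → (y - y₀) % M = k →
      f (x, y) = 0 := by
    intro x y h h'
    apply hS
    simp only [Set.mem_ofPred_eq, triColour]
    rw [if_neg (by omega), h']
    simp
  have hcolc : ∀ x y : ℤ, 3 * M < x - x₀ → y - y₀ < 2 * M → (x - x₀) % M = k →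
      f (x, y) = 0 := by
    intro x y h1 h2 h'
    apply hS
    simp only [Set.mem_ofPred_eq, triColour]
    rw [if_pos ⟨h1, h2⟩, h']
    simp
  -- `y₁` is the lowest row of colour `k` to the left of the corner, `x₁` the first column of colour
  -- `k` in the corner, and `y₂` the first row above the corner of colour `k`
  obtain ⟨y₁', h11, h12, h13⟩ := exists_emod_eq (b - 1 - y₀) (k : ℤ) (n := M) (by omega) (by omega)
  obtain ⟨x₁', g11, g12, g13⟩ := exists_emod_eq (3 * M + 1) (k : ℤ) (n := M) (by omega) (by omega)
  obtain ⟨y₂', h21, h22, h23⟩ := exists_emod_eq (2 * M) (k : ℤ) (n := M) (by omega) (by omega)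
  obtain ⟨y₁, rfl⟩ : ∃ y, y₁' = y - y₀ := ⟨y₁' + y₀, by ring⟩
  obtain ⟨y₂, rfl⟩ : ∃ y, y₂' = y - y₀ := ⟨y₂' + y₀, by ring⟩
  obtain ⟨x₁, rfl⟩ : ∃ x, x₁' = x - x₀ := ⟨x₁' + x₀, by ring⟩
  -- zeros above the row `y₁`, to the left of the corner
  have hleft : ∀ n : ℕ, ∀ x, x - x₀ ≤ 3 * M → y₁ + n - b ≤ x - a → f (x, y₁ + n) = 0 := by
    intro n
    induction n with
    | zero =>
      intro x hx _
      simpa using hrowc x y₁ (Or.inl hx) h13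
    | succ n ih =>
      intro x hx hx'
      push_cast at hx' ⊢
      have := hrel x (y₁ + (n + 1)) (by omega) (by omega) (by omega)
      have e : y₁ + ((n : ℤ) + 1) - 1 = y₁ + n := by ring
      rw [e, ih x hx (by omega), ih (x - 1) (by omega) (by omega)] at this
      simpa using this
  -- zeros in the row `y₂` and above it
  have hup : ∀ n : ℕ, ∀ x, x ≤ a + m → y₂ + n - b ≤ x - a → f (x, y₂ + n) = 0 := by
    intro n
    induction n with
    | zero =>
      intro x hx _
      simpa using hrowc x y₂ (Or.inr h21) h23
    | succ n ih =>
      intro x hx hx'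
      push_cast at hx' ⊢
      have := hrel x (y₂ + (n + 1)) (by omega) (by omega) (by omega)
      have e : y₂ + ((n : ℤ) + 1) - 1 = y₂ + n := by ring
      rw [e, ih x hx (by omega), ih (x - 1) (by omega) (by omega)] at this
      simpa using this
  -- zeros in the rows below `y₂`, by descent
  have hdown : ∀ n : ℕ, b - 1 ≤ y₂ - n → ∀ x, x ≤ a + m → y₂ - n - b ≤ x - a →
      f (x, y₂ - n) = 0 := by
    intro n
    induction n with
    | zero =>
      intro _ x hx hx'
      simpa using hup 0 x hx (by simpa using hx')
    | succ n ih =>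
      intro hn
      push_cast at hn ⊢
      set y := y₂ - ((n : ℤ) + 1) with hy
      have e : y₂ - (n : ℤ) = y + 1 := by omega
      rw [e] at ih
      have ih' := ih (by omega)
      have hstep : ∀ x, x ≤ a + m → y - b ≤ x - 1 - a → f (x, y) = f (x - 1, y) := by
        intro x hx hx'
        have := hrel x (y + 1) (by omega) hx (by omega)
        rw [ih' x hx (by omega), add_sub_cancel_right, zero_add] at this
        exact eq_of_add_eq_zero this
      have hconst : ∀ i : ℕ, a + (y - b) + i ≤ a + m →
          f (a + (y - b) + i, y) = f (a + (y - b), y) := by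
        intro i
        induction i with
        | zero => simp
        | succ i ihi =>
          intro hi
          push_cast at hi ⊢
          rw [← ihi (by omega), hstep _ hi (by omega)]
          congr 2; ring
      have hz : ∃ x, y - b ≤ x - a ∧ x ≤ a + m ∧ f (x, y) = 0 := by
        by_cases hyy : y₁ ≤ y
        · refine ⟨x₀ + 3 * M, by omega, by omega, ?_⟩
          have := hleft (y - y₁).toNat (x₀ + 3 * M) (by omega) (by omega)
          rwa [Int.toNat_of_nonneg (by omega), add_sub_cancel] at this
        · exact ⟨x₁, by omega, by omega, hcolc x₁ y (by omega) (by omega) g13⟩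
      obtain ⟨x₂, hx1, hx2, hx3⟩ := hz
      intro x hx hx'
      have e1 := hconst (x₂ - (a + (y - b))).toNat (by omega)
      have e2 := hconst (x - (a + (y - b))).toNat (by omega)
      rw [Int.toNat_of_nonneg (by omega), add_sub_cancel] at e1 e2
      rw [e2, ← e1, hx3]
  have hall : ∀ x y, b - 1 ≤ y → x ≤ a + m → y - b ≤ x - a → f (x, y) = 0 := by
    intro x y h1 h2 h3
    by_cases hy : y ≤ y₂
    · have := hdown (y₂ - y).toNat (by omega) x h2 (by omega)
      rwa [Int.toNat_of_nonneg (by omega), sub_sub_cancel] at this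
    · have := hup (y - y₂).toNat x h2 (by omega)
      rwa [Int.toNat_of_nonneg (by omega), add_sub_cancel] at this
  intro x hx d hd
  rw [mem_tri] at hx
  have hd' : d.1 = 0 ∧ (d.2 = 0 ∨ d.2 = 1) ∨ d.1 = 1 ∧ d.2 = 1 := by
    have : d ∈ ({(0, 0), (0, 1), (1, 1)} : Finset Site) := hd
    simp only [Finset.mem_insert, Finset.mem_singleton] at this
    rcases this with rfl | rfl | rfl <;> simp
  exact hall (x.1 - d.1) (x.2 - d.2) (by omega) (by omega) (by omega)

/-- Two triangles that are equal or neighbours are tight with a common colouring. -/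
theorem tight_tri_union {a b a' b' : ℤ} {m M : ℕ} (ha : a ≤ a') (ha' : a' ≤ a + 1) (hb : b ≤ b')
    (hb' : b' ≤ b + 1) (hm : 4 * M ≤ m) : Tight tpm (tri a b m ∪ tri a' b' m) M := by
  refine ⟨triColour a (b - 1) M, fun k hk => Spans.of_cover fun x hx => ?_⟩
  rcases Finset.mem_union.1 hx with hx | hx
  · exact ⟨_, Finset.subset_union_left, hx,
      spans_tri hk le_rfl (by omega) (by omega) (by omega) hm⟩
  · exact ⟨_, Finset.subset_union_right, hx,
      spans_tri hk ha ha' (by omega) (by omega) hm⟩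

/-! ### Resampling and the influence of a boundary spin -/

/-- Summing over the spins in `Λ` includes summing over the spins in `R ⊆ Λ`. -/
theorem sum_glue_resample {Λ R : Finset Site} (hR : R ⊆ Λ) (τ : Config) (f : Config → ℝ) :
    ∑ η : Λ → ℤˣ, ∑ ξ : R → ℤˣ, f (glue R ξ (glue Λ η τ)) =
      2 ^ R.card * ∑ η : Λ → ℤˣ, f (glue Λ η τ) := by
  have h1 : ∀ σ : Config, ∑ ξ : R → ℤˣ, f (glue R ξ σ) =
      ∑ m : R → ℤˣ, f (σ * glue R m 1) := by
    intro σ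
    rw [← Equiv.sum_comp (Equiv.mulLeft (fun x : R => σ x))]
    refine Finset.sum_congr rfl fun m _ => ?_
    congr 1
    funext x
    by_cases hx : x ∈ R
    · rw [Pi.mul_apply, glue_of_mem hx, glue_of_mem hx]
      rfl
    · rw [Pi.mul_apply, glue_of_notMem hx, glue_of_notMem hx]
      simp
  have h2 : ∀ (m : R → ℤˣ) (η : Λ → ℤˣ),
      glue Λ η τ * glue R m 1 = glue Λ (η * fun x : Λ => glue R m 1 x) τ := by
    intro m η
    funext x
    by_cases hx : x ∈ Λ
    · rw [Pi.mul_apply, glue_of_mem hx, glue_of_mem hx]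
      rfl
    · rw [Pi.mul_apply, glue_of_notMem hx, glue_of_notMem hx,
        glue_of_notMem fun h => hx (hR h)]
      simp
  simp_rw [h1, h2]
  rw [Finset.sum_comm]
  have h3 : ∀ m : R → ℤˣ, ∑ η : Λ → ℤˣ, f (glue Λ (η * fun x : Λ => glue R m 1 x) τ) =
      ∑ η : Λ → ℤˣ, f (glue Λ η τ) := fun m =>
    Equiv.sum_comp (Equiv.mulRight (fun x : Λ => glue R m 1 x)) fun η => f (glue Λ η τ)
  simp_rw [h3]
  rw [Finset.sum_const, Finset.card_univ, card_spins, nsmul_eq_mul]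
  push_cast
  ring

theorem glue_congr {Λ : Finset Site} {σ σ' : Config} (h : ∀ x ∉ Λ, σ x = σ' x) (η : Λ → ℤˣ) :
    glue Λ η σ = glue Λ η σ' := by
  funext x
  by_cases hx : x ∈ Λ
  · rw [glue_of_mem hx, glue_of_mem hx]
  · rw [glue_of_notMem hx, glue_of_notMem hx, h x hx]

/-- The part of the Boltzmann weight in `Λ` that does not involve the spins in `R`. -/
def outerWeight (B : Finset Site) (β : ℝ) (Λ R : Finset Site) (σ : Config) : ℝ :=
  Real.exp (∑ z ∈ positions B Λ \ positions B R, β / 2 * multispin (translate B z) σ)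

theorem weight_eq_mul {B : Finset Site} (hB : B.Nonempty) (β : ℝ) {Λ R : Finset Site}
    (hR : R ⊆ Λ) (σ : Config) :
    weight B β Λ σ = outerWeight B β Λ R σ * weight B β R σ := by
  rw [weight_eq_exp hB, weight_eq_exp hB, outerWeight, ← Real.exp_add,
    Finset.sum_sdiff (positions_mono hR)]

theorem outerWeight_glue (B : Finset Site) (β : ℝ) (Λ R : Finset Site) (ξ : R → ℤˣ)
    (σ : Config) : outerWeight B β Λ R (glue R ξ σ) = outerWeight B β Λ R σ := by
  unfold outerWeight
  congr 1
  refine Finset.sum_congr rfl fun z hz => ?_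
  rw [multispin_congr]
  intro x hx
  refine glue_of_notMem (fun hxR => ?_) _ _
  exact (Finset.mem_sdiff.1 hz).2 (mem_positions.2 ⟨x, hxR, hx⟩)

/-- The unnormalized expectation `∑ f(σ) exp(…)`. -/
def gibbsSum (B : Finset Site) (β : ℝ) (Λ : Finset Site) (τ : Config) (f : Config → ℝ) : ℝ :=
  ∑ η : Λ → ℤˣ, f (glue Λ η τ) * weight B β Λ (glue Λ η τ)

theorem gibbsExp_eq (B : Finset Site) (β : ℝ) (Λ : Finset Site) (τ : Config) (f : Config → ℝ) :
    gibbsExp B β Λ τ f = gibbsSum B β Λ τ f / partitionFunction B β Λ τ := rfl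

theorem gibbsSum_one (B : Finset Site) (β : ℝ) (Λ : Finset Site) (τ : Config) :
    gibbsSum B β Λ τ (fun _ => 1) = partitionFunction B β Λ τ := by
  simp [gibbsSum, partitionFunction]

theorem gibbsSum_nonneg (B : Finset Site) (β : ℝ) (Λ : Finset Site) (τ : Config)
    {f : Config → ℝ} (hf : ∀ σ, 0 ≤ f σ) : 0 ≤ gibbsSum B β Λ τ f :=
  Finset.sum_nonneg fun _ _ => mul_nonneg (hf _) (weight_pos _ _ _ _).le

theorem gibbsSum_resample {B : Finset Site} (hB : B.Nonempty) (β : ℝ) {Λ R : Finset Site}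
    (hR : R ⊆ Λ) (τ : Config) (f : Config → ℝ) :
    2 ^ R.card * gibbsSum B β Λ τ f =
      ∑ η : Λ → ℤˣ, outerWeight B β Λ R (glue Λ η τ) * gibbsSum B β R (glue Λ η τ) f := by
  rw [gibbsSum, ← sum_glue_resample hR τ fun σ => f σ * weight B β Λ σ]
  refine Finset.sum_congr rfl fun η _ => ?_
  rw [gibbsSum, Finset.mul_sum]
  refine Finset.sum_congr rfl fun ξ _ => ?_
  rw [weight_eq_mul hB β hR, outerWeight_glue]
  ring

theorem gibbsSum_congr_boundary (B : Finset Site) (β : ℝ) (Λ : Finset Site) {σ σ' : Config}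
    (h : ∀ x ∉ Λ, σ x = σ' x) (f : Config → ℝ) :
    gibbsSum B β Λ σ f = gibbsSum B β Λ σ' f := by
  unfold gibbsSum
  exact Finset.sum_congr rfl fun η _ => by rw [glue_congr h]

theorem partitionFunction_congr_boundary (B : Finset Site) (β : ℝ) (Λ : Finset Site)
    {σ σ' : Config} (h : ∀ x ∉ Λ, σ x = σ' x) :
    partitionFunction B β Λ σ = partitionFunction B β Λ σ' := by
  rw [← gibbsSum_one, ← gibbsSum_one, gibbsSum_congr_boundary B β Λ h]

theorem gibbsExp_congr_boundary (B : Finset Site) (β : ℝ) (Λ : Finset Site) {σ σ' : Config}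
    (h : ∀ x ∉ Λ, σ x = σ' x) (f : Config → ℝ) :
    gibbsExp B β Λ σ f = gibbsExp B β Λ σ' f := by
  rw [gibbsExp_eq, gibbsExp_eq, gibbsSum_congr_boundary B β Λ h,
    partitionFunction_congr_boundary B β Λ h]

theorem gibbsSum_of_dependsOn {B : Finset Site} {β : ℝ} {R : Finset Site} {f : Config → ℝ}
    {V : Set Site} (hf : DependsOn f V) (hV : ∀ x ∈ V, x ∉ R) (σ : Config) :
    gibbsSum B β R σ f = f σ * partitionFunction B β R σ := by
  rw [gibbsSum, partitionFunction, Finset.mul_sum]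
  refine Finset.sum_congr rfl fun η _ => ?_
  rw [hf fun x hx => glue_of_notMem (hV x hx) η σ]

/-- Consistency of the finite-volume Gibbs measures. -/
theorem gibbsExp_gibbsExp {B : Finset Site} (hB : B.Nonempty) (β : ℝ) {Λ R : Finset Site}
    (hR : R ⊆ Λ) (τ : Config) (f : Config → ℝ) :
    gibbsExp B β Λ τ (fun σ => gibbsExp B β R σ f) = gibbsExp B β Λ τ f := by
  rw [gibbsExp_eq, gibbsExp_eq]
  congr 1
  have h2 : (2 : ℝ) ^ R.card ≠ 0 := by positivity
  apply mul_left_cancel₀ h2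
  rw [gibbsSum_resample hB β hR, gibbsSum_resample hB β hR]
  refine Finset.sum_congr rfl fun η _ => ?_
  congr 1
  have hdep : DependsOn (fun σ => gibbsExp B β R σ f) ((R : Set Site)ᶜ) := by
    intro σ σ' h
    exact gibbsExp_congr_boundary B β R (fun x hx => h x (by simpa using hx)) f
  rw [gibbsSum_of_dependsOn hdep (by simp), gibbsExp_eq,
    div_mul_cancel₀ _ (partitionFunction_pos _ _ _ _).ne']

theorem tanh_half_pos {β : ℝ} (hβ : 0 < β) : 0 < Real.tanh (β / 2) := by
  rw [Real.tanh_eq_sinh_div_cosh]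
  exact div_pos (Real.sinh_pos_iff.2 (by linarith)) (Real.cosh_pos _)

/-- If the cycle sum is small, then the partition function hardly depends on the boundary
condition. -/
theorem partitionFunction_le {B : Finset Site} (hB : B.Nonempty) {β : ℝ} (hβ : 0 < β)
    {R : Finset Site} {δ : ℝ} (hδ : cycleSum B R (Real.tanh (β / 2)) ≤ δ) (hδ' : δ ≤ 1 / 2)
    (σ σ' : Config) :
    partitionFunction B β R σ ≤ Real.exp (3 * δ) * partitionFunction B β R σ' := by
  have h0 : 0 ≤ δ := (cycleSum_nonneg B R (tanh_half_pos hβ).le).trans hδ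
  set C := Real.cosh (β / 2) ^ (positions B R).card * 2 ^ R.card
  have hC : 0 < C := mul_pos (pow_pos (Real.cosh_pos _) _) (by positivity)
  have h1 := (abs_le.1 ((abs_partitionFunction_sub_le hB hβ R σ).trans hδ)).2
  have h2 := (abs_le.1 ((abs_partitionFunction_sub_le hB hβ R σ').trans hδ)).1
  have h1' : partitionFunction B β R σ ≤ (1 + δ) * C := by
    rw [← div_le_iff₀ hC]; linarith
  have h2' : (1 - δ) * C ≤ partitionFunction B β R σ' := by
    rw [← le_div_iff₀ hC]; linarith
  have h3 : 1 + δ ≤ Real.exp (3 * δ) * (1 - δ) := by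
    have e1 : 1 + δ ≤ Real.exp δ := by linarith [Real.add_one_le_exp δ]
    have e2 : 1 + 2 * δ ≤ Real.exp (2 * δ) := by linarith [Real.add_one_le_exp (2 * δ)]
    have e3 : Real.exp (3 * δ) = Real.exp δ * Real.exp (2 * δ) := by
      rw [← Real.exp_add]; ring_nf
    rw [e3, mul_assoc]
    have e4 : 1 ≤ Real.exp (2 * δ) * (1 - δ) := by nlinarith
    calc 1 + δ ≤ Real.exp δ := e1
      _ ≤ Real.exp δ * (Real.exp (2 * δ) * (1 - δ)) :=
        le_mul_of_one_le_right (Real.exp_pos _).le e4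
  calc partitionFunction B β R σ ≤ (1 + δ) * C := h1'
    _ ≤ Real.exp (3 * δ) * (1 - δ) * C := mul_le_mul_of_nonneg_right h3 hC.le
    _ = Real.exp (3 * δ) * ((1 - δ) * C) := by ring
    _ ≤ _ := mul_le_mul_of_nonneg_left h2' (Real.exp_pos _).le

/-- Flipping a boundary spin at `x` hardly changes the sums of functions that do not depend on the
spins of a region `R` that separates `x` from the rest of `Λ`. -/
theorem gibbsSum_flip_le {B : Finset Site} (hB : B.Nonempty) {β : ℝ} (hβ : 0 < β)
    {Λ R : Finset Site} (hR : R ⊆ Λ) {x : Site} (hx : x ∉ Λ)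
    (hsep : ∀ z, x ∈ translate B z → ∀ y ∈ Λ, y ∈ translate B z → y ∈ R)
    {δ : ℝ} (hδ : cycleSum B R (Real.tanh (β / 2)) ≤ δ) (hδ' : δ ≤ 1 / 2)
    {f : Config → ℝ} (hf0 : ∀ σ, 0 ≤ f σ) {V : Set Site} (hf : DependsOn f V)
    (hV : ∀ y ∈ V, y ∉ R) (hxV : x ∉ V) (τ : Config) :
    gibbsSum B β Λ (flip τ x) f ≤ Real.exp (3 * δ) * gibbsSum B β Λ τ f := by
  have h2 : (0 : ℝ) < 2 ^ R.card := by positivity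
  refine le_of_mul_le_mul_left ?_ h2
  rw [mul_left_comm, gibbsSum_resample hB β hR, gibbsSum_resample hB β hR, Finset.mul_sum]
  refine Finset.sum_le_sum fun η _ => ?_
  rw [glue_flip hx, gibbsSum_of_dependsOn hf hV, gibbsSum_of_dependsOn hf hV]
  have e1 : f (flip (glue Λ η τ) x) = f (glue Λ η τ) :=
    hf fun y hy => flip_apply_of_ne (by rintro rfl; exact hxV hy)
  have e2 : outerWeight B β Λ R (flip (glue Λ η τ) x) = outerWeight B β Λ R (glue Λ η τ) := by
    unfold outerWeight
    congr 1
    refine Finset.sum_congr rfl fun z hz => ?_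
    rw [multispin_flip_of_notMem]
    intro hxz
    obtain ⟨hz1, hz2⟩ := Finset.mem_sdiff.1 hz
    obtain ⟨y, hy, hyz⟩ := mem_positions.1 hz1
    exact hz2 (mem_positions.2 ⟨y, hsep z hxz y hy hyz, hyz⟩)
  rw [e1, e2]
  have h3 := partitionFunction_le hB hβ hδ hδ' (flip (glue Λ η τ) x) (glue Λ η τ)
  have h4 : 0 ≤ outerWeight B β Λ R (glue Λ η τ) * f (glue Λ η τ) :=
    mul_nonneg (Real.exp_pos _).le (hf0 _)
  calc _ = outerWeight B β Λ R (glue Λ η τ) * f (glue Λ η τ) *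
        partitionFunction B β R (flip (glue Λ η τ) x) := by ring
    _ ≤ outerWeight B β Λ R (glue Λ η τ) * f (glue Λ η τ) *
        (Real.exp (3 * δ) * partitionFunction B β R (glue Λ η τ)) :=
        mul_le_mul_of_nonneg_left h3 h4
    _ = _ := by ring

/-- Every site `x` outside `Λ` is separated from `V ⊆ Λ` by a region with `M` disjoint spanning
sets of positions. -/
def Insulated (B Λ V : Finset Site) (M : ℕ) : Prop :=
  ∀ x ∉ Λ, ∃ R ⊆ Λ, Disjoint R V ∧
    (∀ z, x ∈ translate B z → ∀ y ∈ Λ, y ∈ translate B z → y ∈ R) ∧ Tight B R M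

/-- The sites outside `Λ` that belong to a plaquette meeting `Λ`. -/
def outerBoundary (B Λ : Finset Site) : Finset Site :=
  ((positions B Λ).biUnion (translate B)) \ Λ

theorem card_outerBoundary_le (B Λ : Finset Site) :
    (outerBoundary B Λ).card ≤ B.card ^ 2 * Λ.card := by
  refine (Finset.card_le_card Finset.sdiff_subset).trans ?_
  refine Finset.card_biUnion_le.trans ?_
  rw [Finset.sum_congr rfl fun z _ => card_translate B z, Finset.sum_const, smul_eq_mul]
  nlinarith [card_positions_le B Λ]

theorem gibbsSum_congr_outerBoundary {B : Finset Site} (hB : B.Nonempty) (β : ℝ)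
    {Λ V : Finset Site} (hVΛ : V ⊆ Λ) {f : Config → ℝ} (hf : DependsOn f V) {τ τ' : Config}
    (h : ∀ x ∈ outerBoundary B Λ, τ x = τ' x) :
    gibbsSum B β Λ τ f = gibbsSum B β Λ τ' f := by
  unfold gibbsSum
  refine Finset.sum_congr rfl fun η _ => ?_
  congr 1
  · exact hf fun x hx => by rw [glue_of_mem (hVΛ hx), glue_of_mem (hVΛ hx)]
  · rw [weight_eq_exp hB, weight_eq_exp hB]
    congr 1
    refine Finset.sum_congr rfl fun z hz => ?_
    rw [multispin_congr]
    intro x hx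
    by_cases hxΛ : x ∈ Λ
    · rw [glue_of_mem hxΛ, glue_of_mem hxΛ]
    · rw [glue_of_notMem hxΛ, glue_of_notMem hxΛ]
      exact h x (Finset.mem_sdiff.2 ⟨Finset.mem_biUnion.2 ⟨z, hz, hx⟩, hxΛ⟩)

/-- The spins of the outer boundary are changed one at a time, each at the cost of a factor
`e^{3δ}`. -/
theorem Insulated.gibbsSum_le {B Λ V : Finset Site} {M : ℕ} (h : Insulated B Λ V M)
    (hB : B.Nonempty) (hVΛ : V ⊆ Λ) {β : ℝ} (hβ : 0 < β) {δ : ℝ}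
    (hδ : ∀ R ⊆ Λ, Tight B R M → cycleSum B R (Real.tanh (β / 2)) ≤ δ) (hδ' : δ ≤ 1 / 2)
    {f : Config → ℝ} (hf0 : ∀ σ, 0 ≤ f σ) (hf : DependsOn f V) (τ τ' : Config) :
    gibbsSum B β Λ τ' f ≤
      Real.exp (3 * δ) ^ (outerBoundary B Λ).card * gibbsSum B β Λ τ f := by
  have hδ0 : 0 ≤ δ :=
    (cycleSum_nonneg B ∅ (tanh_half_pos hβ).le).trans (hδ ∅ (Finset.empty_subset _) (tight_empty B M))
  have key : ∀ s : Finset Site, Disjoint s Λ →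
      gibbsSum B β Λ (fun x => if x ∈ s then τ' x else τ x) f ≤
        Real.exp (3 * δ) ^ s.card * gibbsSum B β Λ τ f := by
    intro s
    induction s using Finset.induction_on with
    | empty => intro _; simp
    | insert x s hxs ih =>
      intro hdis
      rw [Finset.disjoint_insert_left] at hdis
      have ih' := ih hdis.2
      rw [Finset.card_insert_of_notMem hxs, pow_succ', mul_assoc]
      refine le_trans ?_ (mul_le_mul_of_nonneg_left ih' (Real.exp_pos _).le)
      set ρ : Config := fun x => if x ∈ s then τ' x else τ x
      by_cases hxx : τ' x = τ x
      · have : (fun y => if y ∈ insert x s then τ' y else τ y) = ρ := by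
          funext y
          by_cases hy : y = x
          · subst hy; simp [ρ, hxx]
          · simp [ρ, hy]
        rw [this]
        exact le_mul_of_one_le_left (gibbsSum_nonneg _ _ _ _ hf0)
          (Real.one_le_exp (by positivity))
      · have : (fun y => if y ∈ insert x s then τ' y else τ y) = flip ρ x := by
          funext y
          by_cases hy : y = x
          · subst hy
            simp only [Finset.mem_insert, true_or, if_true, flip, Function.update_self, ρ,
              if_neg hxs]
            rcases Int.units_eq_one_or (τ' y) with h1 | h1 <;>
              rcases Int.units_eq_one_or (τ y) with h2 | h2 <;> simp_all
          · rw [flip_apply_of_ne hy]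
            simp [ρ, hy]
        rw [this]
        obtain ⟨R, hRΛ, hRV, hsep, htight⟩ := h x hdis.1
        exact gibbsSum_flip_le hB hβ hRΛ hdis.1 hsep (hδ R hRΛ htight) hδ' hf0 hf
          (fun y hy hyR => Finset.disjoint_left.1 hRV hyR hy) (fun hxV => hdis.1 (hVΛ hxV)) ρ
  refine le_of_eq_of_le ?_ (key (outerBoundary B Λ) Finset.sdiff_disjoint)
  exact gibbsSum_congr_outerBoundary hB β hVΛ hf fun x hx => by simp [hx]

theorem one_add_pow_sub_one_le {u : ℝ} (hu : 0 ≤ u) {N : ℕ} (h : N * u ≤ 1) :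
    (1 + u) ^ N - 1 ≤ 2 * (N * u) := by
  have h1 : (1 + u) ^ N ≤ Real.exp (N * u) := by
    rw [Real.exp_nat_mul]
    exact pow_le_pow_left₀ (by linarith) (by linarith [Real.add_one_le_exp u]) N
  have h0 : 0 ≤ N * u := by positivity
  have h2 := Real.abs_exp_sub_one_le (x := N * u) (by rwa [abs_of_nonneg h0])
  rw [abs_of_nonneg h0] at h2
  linarith [le_abs_self (Real.exp (N * u) - 1)]

/-- The quantity that controls the influence of the boundary condition in an insulated domain with
`N` sites: up to a constant it is `|B|² N`, a bound on the number of boundary spins, times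
`M |B| N t^M`, a bound on the influence of one of them. -/
def mixBound (B : Finset Site) (M N : ℕ) (t : ℝ) : ℝ := (B.card : ℝ) ^ 3 * N ^ 2 * M * t ^ M

theorem tight_cycleSum_le {B R Λ : Finset Site} {M : ℕ} (hM : 0 < M) (hR : R ⊆ Λ)
    (h : Tight B R M) {t : ℝ} (ht : 0 ≤ t) (ht1 : t ≤ 1)
    (hq : B.card * Λ.card * t ^ M ≤ 1) :
    cycleSum B R t ≤ 2 * (M * (B.card * Λ.card * t ^ M)) := by
  have h1 := h.cycleSum_le hM ht ht1 (N := B.card * Λ.card)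
    ((card_positions_le B R).trans (Nat.mul_le_mul_left _ (Finset.card_le_card hR)))
  have h2 := one_add_pow_sub_one_le (pow_nonneg ht M) (N := B.card * Λ.card)
    (by push_cast; exact hq)
  push_cast at h2
  have : (M : ℝ) * ((1 + t ^ M) ^ (B.card * Λ.card) - 1) ≤
    M * (2 * (B.card * Λ.card * t ^ M)) := mul_le_mul_of_nonneg_left h2 (by positivity)
  linarith

/-- Spatial mixing in insulated domains. A bound for unnormalized sums is used twice, for the
numerator and for the partition function. -/
theorem Insulated.gibbsExp_le {B Λ V : Finset Site} {M : ℕ} (h : Insulated B Λ V M) (hM : 0 < M)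
    (hB : B.Nonempty) (hVΛ : V ⊆ Λ) {β : ℝ} (hβ : 0 < β)
    (hq : mixBound B M Λ.card (Real.tanh (β / 2)) ≤ 1 / 4)
    {f : Config → ℝ} (hf0 : ∀ σ, 0 ≤ f σ) (hf : DependsOn f V) (τ τ' : Config) :
    gibbsExp B β Λ τ' f ≤
      Real.exp (12 * mixBound B M Λ.card (Real.tanh (β / 2))) * gibbsExp B β Λ τ f := by
  set t := Real.tanh (β / 2)
  have ht : 0 < t := tanh_half_pos hβ
  have ht1 : t ≤ 1 := (Real.tanh_lt_one _).le
  rcases Finset.eq_empty_or_nonempty Λ with rfl | hne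
  · have hV : V = ∅ := Finset.subset_empty.1 hVΛ
    subst hV
    have hfc : ∀ σ, f σ = f 1 := fun σ => hf fun x hx => by simp at hx
    have : ∀ τ, gibbsExp B β ∅ τ f = f 1 := by
      intro τ
      rw [gibbsExp_eq, gibbsSum_of_dependsOn hf (by simp), hfc,
        mul_div_cancel_right₀ _ (partitionFunction_pos _ _ _ _).ne']
    rw [this, this]
    refine le_mul_of_one_le_left (hf0 _) (Real.one_le_exp ?_)
    unfold mixBound; positivity
  have hN : (1 : ℝ) ≤ Λ.card := by exact_mod_cast hne.card_pos
  have hb : (1 : ℝ) ≤ B.card := by exact_mod_cast hB.card_pos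
  have hM1 : (1 : ℝ) ≤ M := by exact_mod_cast hM
  have hu : 0 ≤ t ^ M := pow_nonneg ht.le M
  set δ := 2 * (M * (B.card * Λ.card * t ^ M)) with hδ_def
  have hδq : (B.card : ℝ) ^ 2 * Λ.card * δ = 2 * mixBound B M Λ.card t := by
    rw [hδ_def, mixBound]; ring
  have hδ0 : 0 ≤ δ := by positivity
  have hbN : (1 : ℝ) ≤ (B.card : ℝ) ^ 2 * Λ.card := by nlinarith
  have hδ' : δ ≤ 1 / 2 := by nlinarith
  have hq1 : B.card * Λ.card * t ^ M ≤ 1 := by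
    have : 0 ≤ B.card * Λ.card * t ^ M := by positivity
    nlinarith
  have hδ : ∀ R ⊆ Λ, Tight B R M → cycleSum B R t ≤ δ := fun R hR hT =>
    tight_cycleSum_le hM hR hT ht.le ht1 hq1
  have h1 := h.gibbsSum_le hB hVΛ hβ hδ hδ' hf0 hf τ τ'
  have h2 := h.gibbsSum_le hB hVΛ hβ hδ hδ' (f := fun _ => 1) (fun _ => zero_le_one)
    (fun _ _ _ => rfl) τ' τ
  rw [gibbsSum_one, gibbsSum_one] at h2
  set E := Real.exp (3 * δ) ^ (outerBoundary B Λ).card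
  have hE0 : 0 < E := pow_pos (Real.exp_pos _) _
  have hEeq : E = Real.exp ((outerBoundary B Λ).card * (3 * δ)) := (Real.exp_nat_mul _ _).symm
  have hE : E * E ≤ Real.exp (12 * mixBound B M Λ.card t) := by
    have hK : ((outerBoundary B Λ).card : ℝ) ≤ (B.card : ℝ) ^ 2 * Λ.card := by
      exact_mod_cast card_outerBoundary_le B Λ
    rw [hEeq, ← Real.exp_add]
    refine Real.exp_le_exp.2 ?_
    nlinarith [mul_le_mul_of_nonneg_right hK hδ0]
  have hZ := partitionFunction_pos B β Λ τ
  have hZ' := partitionFunction_pos B β Λ τ'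
  have hS := gibbsSum_nonneg B β Λ τ hf0
  rw [gibbsExp_eq, gibbsExp_eq, div_le_iff₀ hZ']
  calc gibbsSum B β Λ τ' f ≤ E * gibbsSum B β Λ τ f := h1
    _ = E * (gibbsSum B β Λ τ f / partitionFunction B β Λ τ) * partitionFunction B β Λ τ := by
      field_simp
    _ ≤ E * (gibbsSum B β Λ τ f / partitionFunction B β Λ τ) *
        (E * partitionFunction B β Λ τ') := by gcongr
    _ = E * E * (gibbsSum B β Λ τ f / partitionFunction B β Λ τ) *
        partitionFunction B β Λ τ' := by ring
    _ ≤ _ := by gcongr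

/-! ### Insulated domains for the two models -/

theorem mem_spm {d : Site} : d ∈ spm ↔ (d.1 = 0 ∨ d.1 = 1) ∧ (d.2 = 0 ∨ d.2 = 1) := by
  have h : spm = {(0, 0), (1, 0), (0, 1), (1, 1)} := rfl
  rw [h]
  obtain ⟨d1, d2⟩ := d
  simp only [Finset.mem_insert, Finset.mem_singleton, Prod.mk.injEq]
  omega

theorem mem_tpm {d : Site} :
    d ∈ tpm ↔ (d.1 = 0 ∧ (d.2 = 0 ∨ d.2 = 1)) ∨ (d.1 = 1 ∧ d.2 = 1) := by
  have h : tpm = {(0, 0), (0, 1), (1, 1)} := rfl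
  rw [h]
  obtain ⟨d1, d2⟩ := d
  simp only [Finset.mem_insert, Finset.mem_singleton, Prod.mk.injEq]
  omega

theorem mem_translate_spm {x z : Site} :
    x ∈ translate spm z ↔ (x.1 = z.1 ∨ x.1 = z.1 + 1) ∧ (x.2 = z.2 ∨ x.2 = z.2 + 1) := by
  rw [mem_translate, mem_spm, Prod.fst_sub, Prod.snd_sub]
  omega

theorem mem_translate_tpm {x z : Site} :
    x ∈ translate tpm z ↔
      (x.1 = z.1 ∧ (x.2 = z.2 ∨ x.2 = z.2 + 1)) ∨ (x.1 = z.1 + 1 ∧ x.2 = z.2 + 1) := by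
  rw [mem_translate, mem_tpm, Prod.fst_sub, Prod.snd_sub]
  omega

theorem spm_nonempty : spm.Nonempty := ⟨(0, 0), mem_spm.2 (by simp)⟩

theorem tpm_nonempty : tpm.Nonempty := ⟨(0, 0), mem_tpm.2 (by simp)⟩

theorem card_spm : spm.card = 4 := rfl

theorem card_tpm : tpm.card = 3 := rfl

theorem mem_square {ℓ : ℕ} {x : Site} :
    x ∈ square ℓ ↔ (1 ≤ x.1 ∧ x.1 ≤ ℓ) ∧ 1 ≤ x.2 ∧ x.2 ≤ ℓ := by
  simp [square]

theorem mem_centredSquare {k : ℕ} {x : Site} :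
    x ∈ centredSquare k ↔
      (-((k / 2 : ℕ) : ℤ) ≤ x.1 ∧ x.1 ≤ (k / 2 : ℕ)) ∧
        -((k / 2 : ℕ) : ℤ) ≤ x.2 ∧ x.2 ≤ (k / 2 : ℕ) := by
  simp only [centredSquare, Finset.mem_product, Finset.mem_Icc]

theorem card_centredSquare (k : ℕ) : (centredSquare k).card ≤ (k + 1) ^ 2 := by
  rw [centredSquare, Finset.card_product, Int.card_Icc, sq]
  have : (((k / 2 : ℕ) : ℤ) + 1 - -((k / 2 : ℕ) : ℤ)).toNat ≤ k + 1 := by omega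
  exact Nat.mul_le_mul this this

/-- Each centred square of side `ℓ` is insulated within a domain of comparable size, by regions with
a number of disjoint spanning sets that may be as large as a multiple of `ℓ`. -/
def HasInsulation (B : Finset Site) : Prop :=
  ∀ ℓ M : ℕ, 2 ≤ M → 40 * M ≤ ℓ →
    ∃ Λ ⊆ centredSquare (10 * ℓ), centredSquare ℓ ⊆ Λ ∧ Insulated B Λ (centredSquare ℓ) M

/-- The whole square of side `10 ℓ` is insulated: a boundary site is separated from the centre by the
nearest subsquare of side `2M`. -/
theorem hasInsulation_spm : HasInsulation spm := by
  intro ℓ M hM hℓ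
  refine ⟨centredSquare (10 * ℓ), subset_rfl, fun x hx => ?_, fun x hx => ?_⟩
  · rw [mem_centredSquare] at hx ⊢
    omega
  · refine ⟨box (max (-5 * ℓ) (min (x.1 - 1) (5 * ℓ + 1 - 2 * M)))
      (max (-5 * ℓ) (min (x.2 - 1) (5 * ℓ + 1 - 2 * M))) (2 * M), fun y hy => ?_, ?_, ?_,
      tight_box _ _ le_rfl⟩
    · rw [mem_box] at hy
      rw [mem_centredSquare]
      push_cast at hy
      omega
    · rw [Finset.disjoint_left]
      intro y hy hyV
      rw [mem_box] at hy
      rw [mem_centredSquare] at hx hyV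
      push_cast at hy
      omega
    · intro z hxz y hy hyz
      rw [mem_translate_spm] at hxz hyz
      rw [mem_centredSquare] at hy hx
      rw [mem_box]
      push_cast
      omega

/-- The insulated domain is a triangle between the two centred squares. -/
theorem hasInsulation_tpm : HasInsulation tpm := by
  intro ℓ M hM hℓ
  refine ⟨tri (-5 * ℓ) (-3 * ℓ) (8 * ℓ), fun x hx => ?_, fun x hx => ?_, fun x hx => ?_⟩
  · rw [mem_tri] at hx
    rw [mem_centredSquare]
    push_cast at hx
    omega
  · rw [mem_centredSquare] at hx
    rw [mem_tri]
    push_cast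
    omega
  · -- a subtriangle of side `4M` on the side of the large triangle that is next to `x`
    obtain ⟨a, b, hsub, hdis, hsep⟩ : ∃ a b : ℤ, tri a b (4 * M) ⊆ tri (-5 * ℓ) (-3 * ℓ) (8 * ℓ) ∧
        Disjoint (tri a b (4 * M)) (centredSquare ℓ) ∧
        (∀ z, x ∈ translate tpm z → ∀ y ∈ tri (-5 * ℓ) (-3 * ℓ) (8 * ℓ),
          y ∈ translate tpm z → y ∈ tri a b (4 * M)) := by
      have hxx : x.2 < -3 * ℓ ∨ 3 * (ℓ : ℤ) < x.1 ∨ 2 * (ℓ : ℤ) < x.2 - x.1 := by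
        rw [mem_tri] at hx
        push_cast at hx
        omega
      rcases hxx with h | h | h
      · refine ⟨max (-5 * ℓ) (min x.1 (3 * ℓ - 4 * M)), -3 * ℓ, fun y hy => ?_, ?_, ?_⟩
        · rw [mem_tri] at hy ⊢; push_cast at hy ⊢; omega
        · rw [Finset.disjoint_left]
          intro y hy hyV
          rw [mem_tri] at hy; rw [mem_centredSquare] at hyV; push_cast at hy; omega
        · intro z hxz y hy hyz
          rw [mem_translate_tpm] at hxz hyz
          rw [mem_tri] at hy ⊢; push_cast at hy ⊢; omega
      · refine ⟨3 * ℓ - 4 * M, max (-3 * ℓ) (min (x.2 - 1) (5 * ℓ - 4 * M)), fun y hy => ?_, ?_, ?_⟩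
        · rw [mem_tri] at hy ⊢; push_cast at hy ⊢; omega
        · rw [Finset.disjoint_left]
          intro y hy hyV
          rw [mem_tri] at hy; rw [mem_centredSquare] at hyV; push_cast at hy; omega
        · intro z hxz y hy hyz
          rw [mem_translate_tpm] at hxz hyz
          rw [mem_tri] at hy ⊢; push_cast at hy ⊢; omega
      · refine ⟨max (-5 * (ℓ : ℤ)) (min x.1 (3 * ℓ - 4 * M)),
          max (-5 * (ℓ : ℤ)) (min x.1 (3 * ℓ - 4 * M)) + 2 * ℓ, fun y hy => ?_, ?_, ?_⟩
        · rw [mem_tri] at hy ⊢; push_cast at hy ⊢; omega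
        · rw [Finset.disjoint_left]
          intro y hy hyV
          rw [mem_tri] at hy; rw [mem_centredSquare] at hyV; push_cast at hy; omega
        · intro z hxz y hy hyz
          rw [mem_translate_tpm] at hxz hyz
          rw [mem_tri] at hy ⊢; push_cast at hy ⊢; omega
    refine ⟨tri a b (4 * M), hsub, hdis, hsep, ?_⟩
    simpa using tight_tri_union (a := a) (b := b) (a' := a) (b' := b) le_rfl (by omega) le_rfl
      (by omega) (le_refl (4 * M))

/-- There is a tight region of `Q_ℓ` near `y` that separates `y` from the rest of `Q_ℓ`. It is empty
if no plaquette contains `y` and meets `Q_ℓ`. -/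
def HasCollar (B : Finset Site) (ℓ M : ℕ) (y : Site) : Prop :=
  ∃ R ⊆ square ℓ, Tight B R M ∧
    (∀ z, y ∈ translate B z → ∀ v ∈ square ℓ, v ∈ translate B z → v ∈ R) ∧
    ∀ v ∈ R, dist1 v y ≤ 12 * M

/-- Of two distant sites outside `Q_ℓ` at least one has a collar. One collar suffices to bound a
covariance, which matters for the TPM, where collars are missing near the corner `(0, ℓ)`. -/
def HasCollars (B : Finset Site) : Prop :=
  ∀ ℓ M : ℕ, 2 ≤ M → 100 * M ≤ ℓ → ∀ x y : Site, x ∉ square ℓ → y ∉ square ℓ →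
    ℓ ≤ 4 * dist1 x y → HasCollar B ℓ M x ∨ HasCollar B ℓ M y

theorem hasCollars_spm : HasCollars spm := by
  intro ℓ M hM hℓ x y hx hy _
  left
  by_cases hfar : -1 < x.1 ∧ x.1 < ℓ + 2 ∧ -1 < x.2 ∧ x.2 < ℓ + 2
  · refine ⟨box (max 1 (min (x.1 - 1) (ℓ + 1 - 2 * M))) (max 1 (min (x.2 - 1) (ℓ + 1 - 2 * M)))
      (2 * M), fun v hv => ?_, tight_box _ _ le_rfl, ?_, ?_⟩
    · rw [mem_box] at hv
      rw [mem_square]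
      push_cast at hv
      omega
    · intro z hxz v hv hvz
      rw [mem_translate_spm] at hxz hvz
      rw [mem_square] at hv hx
      rw [mem_box]
      push_cast
      omega
    · intro v hv
      rw [mem_box] at hv
      unfold dist1
      push_cast at hv
      omega
  · refine ⟨∅, Finset.empty_subset _, tight_empty _ _, ?_, by simp⟩
    intro z hxz v hv hvz
    rw [mem_translate_spm] at hxz hvz
    rw [mem_square] at hv
    omega

/-- Away from the corner `(0, ℓ)` there are collars: one triangle at the bottom and on the right, a
union of two neighbouring triangles on the left and at the top. -/
theorem hasCollar_tpm {ℓ M : ℕ} (hM : 2 ≤ M) (hℓ : 100 * M ≤ ℓ) {y : Site} (hy : y ∉ square ℓ)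
    (hfar : ℓ ≤ 8 * dist1 y (0, ℓ)) : HasCollar tpm ℓ M y := by
  have hm : 4 * M ≤ 4 * M := le_rfl
  have tight1 : ∀ a b : ℤ, Tight tpm (tri a b (4 * M)) M := fun a b => by
    simpa using tight_tri_union (a := a) (b := b) (a' := a) (b' := b) le_rfl (by omega) le_rfl
      (by omega) hm
  unfold dist1 at hfar
  simp only at hfar
  rw [mem_square] at hy
  by_cases hnear : -1 < y.1 ∧ y.1 < ℓ + 2 ∧ -1 < y.2 ∧ y.2 < ℓ + 2
  swap
  · refine ⟨∅, Finset.empty_subset _, tight_empty _ _, ?_, by simp⟩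
    intro z hxz v hv hvz
    rw [mem_translate_tpm] at hxz hvz
    rw [mem_square] at hv
    omega
  -- the bottom, the right, the left and the top of the square, in this order
  by_cases h1 : y.2 = 0
  · refine ⟨tri (max 1 (min y.1 (ℓ - 4 * M))) 1 (4 * M), fun v hv => ?_, tight1 _ _, ?_, ?_⟩
    · rw [mem_tri] at hv; rw [mem_square]; push_cast at hv; omega
    · intro z hxz v hv hvz
      rw [mem_translate_tpm] at hxz hvz
      rw [mem_square] at hv; rw [mem_tri]; push_cast; omega
    · intro v hv
      rw [mem_tri] at hv; unfold dist1; push_cast at hv; omega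
  by_cases h2 : y.1 = ℓ + 1
  · refine ⟨tri (ℓ - 4 * M) (max 1 (min (y.2 - 1) (ℓ - 4 * M))) (4 * M), fun v hv => ?_,
      tight1 _ _, ?_, ?_⟩
    · rw [mem_tri] at hv; rw [mem_square]; push_cast at hv; omega
    · intro z hxz v hv hvz
      rw [mem_translate_tpm] at hxz hvz
      rw [mem_square] at hv; rw [mem_tri]; push_cast; omega
    · intro v hv
      rw [mem_tri] at hv; unfold dist1; push_cast at hv; omega
  by_cases h3 : y.1 = 0
  · refine ⟨tri 1 y.2 (4 * M) ∪ tri 1 (y.2 + 1) (4 * M), fun v hv => ?_,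
      tight_tri_union le_rfl (by omega) (by omega) le_rfl hm, ?_, ?_⟩
    · rw [Finset.mem_union, mem_tri, mem_tri] at hv; rw [mem_square]; push_cast at hv; omega
    · intro z hxz v hv hvz
      rw [mem_translate_tpm] at hxz hvz
      rw [mem_square] at hv; rw [Finset.mem_union, mem_tri, mem_tri]; push_cast; omega
    · intro v hv
      rw [Finset.mem_union, mem_tri, mem_tri] at hv; unfold dist1; push_cast at hv; omega
  · refine ⟨tri (y.1 - 4 * M - 1) (ℓ - 4 * M) (4 * M) ∪ tri (y.1 - 4 * M) (ℓ - 4 * M) (4 * M),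
      fun v hv => ?_, tight_tri_union (by omega) (by omega) le_rfl (by omega) hm, ?_, ?_⟩
    · rw [Finset.mem_union, mem_tri, mem_tri] at hv; rw [mem_square]; push_cast at hv; omega
    · intro z hxz v hv hvz
      rw [mem_translate_tpm] at hxz hvz
      rw [mem_square] at hv; rw [Finset.mem_union, mem_tri, mem_tri]; push_cast; omega
    · intro v hv
      rw [Finset.mem_union, mem_tri, mem_tri] at hv; unfold dist1; push_cast at hv; omega

theorem hasCollars_tpm : HasCollars tpm := by
  intro ℓ M hM hℓ x y hx hy hxy
  by_cases h : ℓ ≤ 8 * dist1 x (0, ℓ)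
  · exact Or.inl (hasCollar_tpm hM hℓ hx h)
  · refine Or.inr (hasCollar_tpm hM hℓ hy ?_)
    unfold dist1 at h hxy ⊢
    simp only at h ⊢
    omega

/-! ### Local functions and finite-volume Gibbs measures -/

instance discreteMeasurableSpace_units : DiscreteMeasurableSpace ℤˣ :=
  ⟨fun s => ⟨Units.val '' s, MeasurableSet.of_discrete,
    Set.preimage_image_eq _ Units.val_injective⟩⟩

theorem dependsOn_eq_comp {V : Finset Site} {β : Type*} {f : Config → β} (hf : DependsOn f V) :
    f = (fun η : V → ℤˣ => f (glue V η 1)) ∘ fun σ x => σ x := by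
  funext σ
  refine hf fun x hx => ?_
  rw [glue_of_mem (by simpa using hx)]

theorem continuous_of_dependsOn {V : Finset Site} {f : Config → ℝ} (hf : DependsOn f V) :
    Continuous f := by
  rw [dependsOn_eq_comp hf]
  exact continuous_of_discreteTopology.comp (by fun_prop)

theorem continuous_glue (Λ : Finset Site) (η : Λ → ℤˣ) : Continuous (glue Λ η) := by
  refine continuous_pi fun x => ?_
  by_cases hx : x ∈ Λ
  · simp only [glue, hx, dif_pos]; exact continuous_const
  · simp only [glue, hx, dif_neg, not_false_eq_true]; exact continuous_apply x

theorem continuous_multispin (A : Finset Site) : Continuous (multispin A) :=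
  continuous_of_dependsOn (V := A) fun _ _ h => multispin_congr h

theorem continuous_weight (B : Finset Site) (β : ℝ) (Λ : Finset Site) :
    Continuous (weight B β Λ) := by
  unfold weight
  exact Real.continuous_exp.comp (continuous_const.mul
    (continuous_finsetSum _ fun P _ => continuous_multispin P))

theorem continuous_gibbsSum (B : Finset Site) (β : ℝ) (Λ : Finset Site) {f : Config → ℝ}
    (hf : Continuous f) : Continuous fun τ => gibbsSum B β Λ τ f :=
  continuous_finsetSum _ fun η _ => (hf.comp (continuous_glue Λ η)).mul
    ((continuous_weight B β Λ).comp (continuous_glue Λ η))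

theorem continuous_partitionFunction (B : Finset Site) (β : ℝ) (Λ : Finset Site) :
    Continuous fun τ => partitionFunction B β Λ τ := by
  simp_rw [← gibbsSum_one]
  exact continuous_gibbsSum B β Λ continuous_const

theorem continuous_gibbsExp (B : Finset Site) (β : ℝ) (Λ : Finset Site) {f : Config → ℝ}
    (hf : Continuous f) : Continuous fun τ => gibbsExp B β Λ τ f := by
  simp_rw [gibbsExp_eq]
  exact (continuous_gibbsSum B β Λ hf).div (continuous_partitionFunction B β Λ) fun τ =>
    (partitionFunction_pos B β Λ τ).ne'

theorem gibbsExp_const (B : Finset Site) (β : ℝ) (Λ : Finset Site) (τ : Config) (c : ℝ) :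
    gibbsExp B β Λ τ (fun _ => c) = c := by
  have : gibbsSum B β Λ τ (fun _ => c) = c * partitionFunction B β Λ τ := by
    simp [gibbsSum, partitionFunction, Finset.mul_sum]
  rw [gibbsExp_eq, this, mul_div_cancel_right₀ _ (partitionFunction_pos _ _ _ _).ne']

theorem gibbsExp_add (B : Finset Site) (β : ℝ) (Λ : Finset Site) (τ : Config)
    (f g : Config → ℝ) :
    gibbsExp B β Λ τ (fun σ => f σ + g σ) = gibbsExp B β Λ τ f + gibbsExp B β Λ τ g := by
  rw [gibbsExp_eq, gibbsExp_eq, gibbsExp_eq, ← add_div]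
  simp [gibbsSum, add_mul, Finset.sum_add_distrib]

theorem gibbsExp_const_mul (B : Finset Site) (β : ℝ) (Λ : Finset Site) (τ : Config)
    (c : ℝ) (f : Config → ℝ) :
    gibbsExp B β Λ τ (fun σ => c * f σ) = c * gibbsExp B β Λ τ f := by
  rw [gibbsExp_eq, gibbsExp_eq, ← mul_div_assoc]
  simp [gibbsSum, Finset.mul_sum, mul_assoc]

theorem gibbsExp_mono (B : Finset Site) (β : ℝ) (Λ : Finset Site) (τ : Config)
    {f g : Config → ℝ} (h : ∀ σ, f σ ≤ g σ) : gibbsExp B β Λ τ f ≤ gibbsExp B β Λ τ g := by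
  rw [gibbsExp_eq, gibbsExp_eq]
  refine div_le_div_of_nonneg_right ?_ (partitionFunction_pos B β Λ τ).le
  exact Finset.sum_le_sum fun η _ => mul_le_mul_of_nonneg_right (h _) (weight_pos _ _ _ _).le

theorem gibbsProb_nonneg (B : Finset Site) (β : ℝ) (Λ : Finset Site) (τ : Config)
    (E : Set Config) : 0 ≤ gibbsProb B β Λ τ E := by
  rw [← gibbsExp_const B β Λ τ 0]
  exact gibbsExp_mono B β Λ τ fun σ => Set.indicator_nonneg (fun _ _ => zero_le_one) σ

theorem gibbsProb_le_one (B : Finset Site) (β : ℝ) (Λ : Finset Site) (τ : Config)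
    (E : Set Config) : gibbsProb B β Λ τ E ≤ 1 := by
  rw [← gibbsExp_const B β Λ τ 1]
  exact gibbsExp_mono B β Λ τ fun σ => Set.indicator_le_self' (fun _ _ => zero_le_one) σ

theorem gibbsProb_compl (B : Finset Site) (β : ℝ) (Λ : Finset Site) (τ : Config)
    (E : Set Config) : gibbsProb B β Λ τ Eᶜ = 1 - gibbsProb B β Λ τ E := by
  have h := gibbsExp_add B β Λ τ (E.indicator fun _ => 1) (Eᶜ.indicator fun _ => 1)
  have h1 : (fun σ => E.indicator (fun _ => (1 : ℝ)) σ + Eᶜ.indicator (fun _ => 1) σ) =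
      fun _ => 1 := Set.indicator_self_add_compl E fun _ => (1 : ℝ)
  rw [h1, gibbsExp_const] at h
  unfold gibbsProb
  linarith

/-- The finite-volume Gibbs measure `μ_Λ^{β,τ}` as a measure on configurations. -/
def gibbsMeasure (B : Finset Site) (β : ℝ) (Λ : Finset Site) (τ : Config) : Measure Config :=
  ∑ η : Λ → ℤˣ, ENNReal.ofReal (weight B β Λ (glue Λ η τ) / partitionFunction B β Λ τ) •
    Measure.dirac (glue Λ η τ)

theorem gibbsMeasure_apply (B : Finset Site) (β : ℝ) (Λ : Finset Site) (τ : Config)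
    {E : Set Config} (hE : MeasurableSet E) :
    gibbsMeasure B β Λ τ E = ENNReal.ofReal (gibbsProb B β Λ τ E) := by
  rw [gibbsMeasure, Measure.finsetSum_apply, gibbsProb, gibbsExp, Finset.sum_div,
    ENNReal.ofReal_sum_of_nonneg]
  · refine Finset.sum_congr rfl fun η _ => ?_
    rw [Measure.smul_apply, Measure.dirac_apply' _ hE, smul_eq_mul]
    by_cases h : glue Λ η τ ∈ E <;> simp [h]
  · intro η _
    exact div_nonneg (mul_nonneg (Set.indicator_nonneg (fun _ _ => zero_le_one) _)
      (weight_pos _ _ _ _).le) (partitionFunction_pos _ _ _ _).le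

instance isProbabilityMeasure_gibbsMeasure (B : Finset Site) (β : ℝ) (Λ : Finset Site)
    (τ : Config) : IsProbabilityMeasure (gibbsMeasure B β Λ τ) := by
  refine ⟨?_⟩
  rw [gibbsMeasure_apply _ _ _ _ MeasurableSet.univ, gibbsProb]
  simp [gibbsExp_const]

theorem integral_gibbsMeasure (B : Finset Site) (β : ℝ) (Λ : Finset Site) (τ : Config)
    {f : Config → ℝ} (hf : Continuous f) :
    ∫ σ, f σ ∂gibbsMeasure B β Λ τ = gibbsExp B β Λ τ f := by
  have hsm : StronglyMeasurable f := hf.stronglyMeasurable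
  have hint : ∀ η : Λ → ℤˣ, Integrable f
      (ENNReal.ofReal (weight B β Λ (glue Λ η τ) / partitionFunction B β Λ τ) •
        Measure.dirac (glue Λ η τ)) := fun η =>
    (integrable_dirac' hsm (by simp)).smul_measure ENNReal.ofReal_ne_top
  rw [gibbsMeasure, integral_finsetSum_measure fun η _ => hint η, gibbsExp, Finset.sum_div]
  refine Finset.sum_congr rfl fun η _ => ?_
  rw [integral_smul_measure, integral_dirac' _ _ hsm, ENNReal.toReal_ofReal
    (div_nonneg (weight_pos _ _ _ _).le (partitionFunction_pos _ _ _ _).le), smul_eq_mul]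
  ring

theorem measurable_gibbsProb (B : Finset Site) (β : ℝ) (Λ : Finset Site)
    {E : Set Config} (hE : MeasurableSet E) : Measurable fun τ => gibbsProb B β Λ τ E := by
  unfold gibbsProb gibbsExp
  refine Measurable.div (Finset.measurable_fun_sum _ fun η _ => ?_)
    (continuous_partitionFunction B β Λ).measurable
  exact ((measurable_one.indicator hE).comp (continuous_glue Λ η).measurable).mul
    ((continuous_weight B β Λ).comp (continuous_glue Λ η)).measurable

theorem measurable_gibbsMeasure (B : Finset Site) (β : ℝ) (Λ : Finset Site) :
    Measurable (gibbsMeasure B β Λ) := by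
  refine Measure.measurable_of_measurable_coe _ fun E hE => ?_
  simp_rw [gibbsMeasure_apply B β Λ _ hE]
  exact (measurable_gibbsProb B β Λ hE).ennreal_ofReal

/-! ### Infinite-volume Gibbs measures -/

theorem exists_subset_centredSquare (V : Finset Site) :
    ∃ k₀, ∀ k ≥ k₀, V ⊆ centredSquare k := by
  refine ⟨∑ x ∈ V, 2 * (x.1.natAbs + x.2.natAbs), fun k hk x hx => ?_⟩
  have := Finset.single_le_sum (f := fun x : Site => 2 * (x.1.natAbs + x.2.natAbs))
    (fun _ _ => Nat.zero_le _) hx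
  rw [mem_centredSquare]
  omega

theorem dependsOn_indicator_cylinder (V : Finset Site) (S : Set (V → ℤˣ)) :
    DependsOn ((cylinder (α := fun _ => ℤˣ) V S).indicator fun _ => (1 : ℝ)) (V : Set Site) :=
  dependsOn_cylinder_indicator_const (α := fun _ => ℤˣ) (I := V) S 1

/-- A limit point of finite-volume Gibbs measures is an infinite-volume Gibbs measure. -/
theorem exists_isGibbs {B : Finset Site} (hB : B.Nonempty) (β : ℝ) :
    ∃ μ : Measure Config, IsGibbs B β μ := by
  let u : ℕ → ProbabilityMeasure Config := fun n => ⟨gibbsMeasure B β (centredSquare n) 1,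
    isProbabilityMeasure_gibbsMeasure B β (centredSquare n) 1⟩
  set U : Ultrafilter ℕ := hyperfilter ℕ
  obtain ⟨μ, hμ⟩ : ∃ μ, Tendsto u U (nhds μ) :=
    ⟨(U.map u).lim, (U.map u).le_nhds_lim⟩
  rw [ProbabilityMeasure.tendsto_iff_forall_integral_tendsto] at hμ
  have hU : (U : Filter ℕ) ≤ atTop := by
    rw [← Nat.cofinite_eq_atTop]; exact hyperfilter_le_cofinite
  have hlim : ∀ f : Config → ℝ, Continuous f →
      Tendsto (fun n => gibbsExp B β (centredSquare n) 1 f) U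
        (nhds (∫ σ, f σ ∂(μ : Measure Config))) := by
    intro f hf
    have := hμ (BoundedContinuousFunction.mkOfCompact ⟨f, hf⟩)
    refine this.congr fun n => ?_
    exact integral_gibbsMeasure B β (centredSquare n) 1 hf
  -- finite-volume expectations are continuous in the boundary condition, so that consistency passes
  -- to the limit; measurable events are reached from cylinders by a π-λ argument
  refine ⟨μ, inferInstance, fun Λ E hE => ?_⟩
  have hcons : ∀ f : Config → ℝ, Continuous f →
      ∫ τ, gibbsExp B β Λ τ f ∂(μ : Measure Config) = ∫ σ, f σ ∂(μ : Measure Config) := by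
    intro f hf
    refine tendsto_nhds_unique (hlim _ (continuous_gibbsExp B β Λ hf)) ((hlim f hf).congr' ?_)
    obtain ⟨k₀, hk₀⟩ := exists_subset_centredSquare Λ
    filter_upwards [hU (eventually_ge_atTop k₀)] with n hn
    rw [gibbsExp_gibbsExp hB β (hk₀ n hn)]
  have hmeas := (measurable_gibbsMeasure B β Λ).aemeasurable (μ := (μ : Measure Config))
  have hreal : ∀ E : Set Config, MeasurableSet E →
      (μ : Measure Config).bind (gibbsMeasure B β Λ) E =
        ENNReal.ofReal (∫ τ, gibbsProb B β Λ τ E ∂(μ : Measure Config)) := by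
    intro E hE
    rw [Measure.bind_apply hE hmeas, ofReal_integral_eq_lintegral_ofReal]
    · simp_rw [gibbsMeasure_apply B β Λ _ hE]
    · refine Integrable.of_bound (measurable_gibbsProb B β Λ hE).aestronglyMeasurable 1 ?_
      refine Eventually.of_forall fun τ => ?_
      rw [Real.norm_of_nonneg (gibbsProb_nonneg _ _ _ _ _)]
      exact gibbsProb_le_one _ _ _ _ _
    · exact Eventually.of_forall fun τ => gibbsProb_nonneg _ _ _ _ _
  have hcyl : ∀ E ∈ measurableCylinders fun _ : Site => ℤˣ,
      (μ : Measure Config) E = (μ : Measure Config).bind (gibbsMeasure B β Λ) E := by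
    intro E hE
    have hEm := MeasurableSet.of_mem_measurableCylinders hE
    obtain ⟨V, S, _, rfl⟩ := (mem_measurableCylinders _).1 hE
    rw [hreal _ hEm]
    unfold gibbsProb
    rw [hcons _ (continuous_of_dependsOn (dependsOn_indicator_cylinder V S))]
    have : ∫ σ, (cylinder V S).indicator (fun _ => (1 : ℝ)) σ ∂(μ : Measure Config) =
        (μ : Measure Config).real (cylinder V S) := integral_indicator_one hEm
    rw [this, ofReal_measureReal]
  have heq : (μ : Measure Config) = (μ : Measure Config).bind (gibbsMeasure B β Λ) := by
    refine ext_of_generate_finite _ generateFrom_measurableCylinders.symm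
      isPiSystem_measurableCylinders hcyl ?_
    exact hcyl _ (univ_mem_measurableCylinders _)
  rw [Measure.real, heq, hreal E hE, ENNReal.toReal_ofReal]
  · rw [← heq]
  · exact integral_nonneg fun τ => gibbsProb_nonneg _ _ _ _ _

/-- An event whose probability hardly depends on the boundary condition of `Λ` has about the same
probability in infinite volume. -/
theorem IsGibbs.abs_real_sub_le {B : Finset Site} {β : ℝ} {μ : Measure Config}
    (hμ : IsGibbs B β μ) (Λ : Finset Site) {E : Set Config} (hE : MeasurableSet E) {r : ℝ}
    (h : ∀ τ τ', gibbsProb B β Λ τ' E ≤ r * gibbsProb B β Λ τ E)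
    (h' : ∀ τ τ', gibbsProb B β Λ τ' Eᶜ ≤ r * gibbsProb B β Λ τ Eᶜ) (τ : Config) (hr : 1 ≤ r) :
    |μ.real E - gibbsProb B β Λ τ E| ≤ r - 1 := by
  have := hμ.1
  have key : ∀ E : Set Config, MeasurableSet E →
      (∀ τ τ', gibbsProb B β Λ τ' E ≤ r * gibbsProb B β Λ τ E) →
      μ.real E ≤ r * gibbsProb B β Λ τ E := by
    intro E hE h
    rw [hμ.2 Λ E hE]
    refine (integral_mono_of_nonneg (Eventually.of_forall fun τ => gibbsProb_nonneg _ _ _ _ _)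
      (integrable_const (r * gibbsProb B β Λ τ E)) (Eventually.of_forall fun τ' => h τ τ')).trans ?_
    simp
  have h1 := key E hE h
  have h2 := key Eᶜ hE.compl h'
  rw [probReal_compl_eq_one_sub hE, gibbsProb_compl] at h2
  have h3 := gibbsProb_nonneg B β Λ τ E
  have h4 := gibbsProb_le_one B β Λ τ E
  rw [abs_le]
  constructor <;> nlinarith

/-- The sequence that bounds the influence of the boundary condition of a square of side `400 M`
tends to zero. -/
theorem tendsto_mixBound (B : Finset Site) {t : ℝ} (ht : 0 ≤ t) (ht1 : t < 1) :
    Tendsto (fun M : ℕ => mixBound B M ((10 * (40 * M) + 1) ^ 2) t) atTop (nhds 0) := by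
  have h := (tendsto_pow_const_mul_const_pow_of_abs_lt_one 5 (r := t)
    (by rwa [abs_of_nonneg ht])).const_mul ((B.card : ℝ) ^ 3 * 401 ^ 4)
  rw [mul_zero] at h
  refine squeeze_zero' (Eventually.of_forall fun M => ?_) ?_ h
  · unfold mixBound; positivity
  · filter_upwards [eventually_ge_atTop 1] with M hM
    have hM' : (1 : ℝ) ≤ M := by exact_mod_cast hM
    unfold mixBound
    push_cast
    have : (((10 * (40 * (M : ℝ)) + 1) ^ 2) ^ 2) ≤ 401 ^ 4 * M ^ 4 := by
      rw [← pow_mul, ← mul_pow]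
      exact pow_le_pow_left₀ (by positivity) (by linarith) 4
    calc (B.card : ℝ) ^ 3 * ((10 * (40 * (M : ℝ)) + 1) ^ 2) ^ 2 * M * t ^ M
        ≤ (B.card : ℝ) ^ 3 * (401 ^ 4 * M ^ 4) * M * t ^ M := by gcongr
      _ = _ := by ring

theorem mixBound_mono (B : Finset Site) (M : ℕ) {N N' : ℕ} (h : N ≤ N') {t : ℝ} (ht : 0 ≤ t) :
    mixBound B M N t ≤ mixBound B M N' t := by
  unfold mixBound
  gcongr

/-- Spatial mixing for squares, with the constant of an insulated domain of `N` sites. -/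
theorem HasInsulation.gibbsExp_le {B : Finset Site} (h : HasInsulation B) (hB : B.Nonempty)
    {β : ℝ} (hβ : 0 < β) {ℓ M : ℕ} (hM : 2 ≤ M) (hℓ : 40 * M ≤ ℓ)
    (hq : mixBound B M ((10 * ℓ + 1) ^ 2) (Real.tanh (β / 2)) ≤ 1 / 4)
    {f : Config → ℝ} (hf0 : ∀ σ, 0 ≤ f σ)
    (hf : DependsOn f (centredSquare ℓ : Set Site)) (τ τ' : Config) :
    gibbsExp B β (centredSquare (10 * ℓ)) τ' f ≤
      Real.exp (12 * mixBound B M ((10 * ℓ + 1) ^ 2) (Real.tanh (β / 2))) *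
        gibbsExp B β (centredSquare (10 * ℓ)) τ f := by
  obtain ⟨Λ, hΛ, hV, hins⟩ := h ℓ M hM hℓ
  have hcard : Λ.card ≤ (10 * ℓ + 1) ^ 2 :=
    (Finset.card_le_card hΛ).trans (card_centredSquare _)
  have hmono := mixBound_mono B M hcard (tanh_half_pos hβ).le
  have key : ∀ τ τ', gibbsExp B β Λ τ' f ≤
      Real.exp (12 * mixBound B M ((10 * ℓ + 1) ^ 2) (Real.tanh (β / 2))) *
        gibbsExp B β Λ τ f := by
    intro τ τ'
    refine (hins.gibbsExp_le (by omega) hB hV hβ (hmono.trans hq) hf0 hf τ τ').trans ?_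
    have h0 : 0 ≤ gibbsExp B β Λ τ f := by
      rw [← gibbsExp_const B β Λ τ 0]
      exact gibbsExp_mono B β Λ τ hf0
    gcongr
  -- compare both sides with the boundary condition `1` of the insulated domain
  rw [← gibbsExp_gibbsExp hB β hΛ τ', ← gibbsExp_gibbsExp hB β hΛ τ]
  set E := Real.exp (12 * mixBound B M ((10 * ℓ + 1) ^ 2) (Real.tanh (β / 2)))
  have hE : 0 < E := Real.exp_pos _
  obtain ⟨ξ, -, hξ⟩ := Finset.exists_min_image Finset.univ
    (fun η : centredSquare (10 * ℓ) → ℤˣ =>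
      gibbsExp B β Λ (glue (centredSquare (10 * ℓ)) η τ) f) Finset.univ_nonempty
  set c := gibbsExp B β Λ (glue (centredSquare (10 * ℓ)) ξ τ) f
  have h1 : gibbsExp B β (centredSquare (10 * ℓ)) τ' (fun σ => gibbsExp B β Λ σ f) ≤ E * c := by
    rw [← gibbsExp_const B β (centredSquare (10 * ℓ)) τ' (E * c)]
    exact gibbsExp_mono _ _ _ _ fun σ => key _ σ
  have h2 : c ≤ gibbsExp B β (centredSquare (10 * ℓ)) τ (fun σ => gibbsExp B β Λ σ f) := by
    rw [gibbsExp_eq, le_div_iff₀ (partitionFunction_pos _ _ _ _), partitionFunction,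
      Finset.mul_sum]
    exact Finset.sum_le_sum fun η hη =>
      mul_le_mul_of_nonneg_right (hξ η hη) (weight_pos _ _ _ _).le
  exact h1.trans (mul_le_mul_of_nonneg_left h2 hE.le)

/-- The infinite-volume probability of a local event is the limit of its finite-volume
probabilities, uniformly in the boundary condition. -/
theorem IsGibbs.tendsto_gibbsProb {B : Finset Site} (h : HasInsulation B) (hB : B.Nonempty)
    {β : ℝ} (hβ : 0 < β) {μ : Measure Config} (hμ : IsGibbs B β μ) {V : Finset Site}
    {E : Set Config} (hE : MeasurableSet E)
    (hV : DependsOn (E.indicator fun _ => (1 : ℝ)) (V : Set Site)) (τ : ℕ → Config) :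
    Tendsto (fun M : ℕ => gibbsProb B β (centredSquare (10 * (40 * M))) (τ M) E) atTop
      (nhds (μ.real E)) := by
  have ht : 0 ≤ Real.tanh (β / 2) := (tanh_half_pos hβ).le
  have hq := tendsto_mixBound B ht (Real.tanh_lt_one _)
  have hr : Tendsto (fun M : ℕ => Real.exp (12 * mixBound B M ((10 * (40 * M) + 1) ^ 2)
      (Real.tanh (β / 2))) - 1) atTop (nhds 0) := by
    have := ((Real.continuous_exp.tendsto _).comp (hq.const_mul 12)).sub_const 1
    simpa using this
  rw [tendsto_iff_dist_tendsto_zero]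
  refine squeeze_zero' (Eventually.of_forall fun M => dist_nonneg) ?_ hr
  obtain ⟨k₀, hk₀⟩ := exists_subset_centredSquare V
  filter_upwards [hq.eventually_le_const (show (0 : ℝ) < 1 / 4 by norm_num),
    eventually_ge_atTop 2, eventually_ge_atTop k₀] with M h1 h2 h3
  rw [Real.dist_eq, abs_sub_comm]
  have hdep : DependsOn (E.indicator fun _ => (1 : ℝ)) (centredSquare (40 * M) : Set Site) :=
    hV.mono (by exact_mod_cast hk₀ (40 * M) (by omega))
  have hdep' : DependsOn (Eᶜ.indicator fun _ => (1 : ℝ)) (centredSquare (40 * M) : Set Site) := by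
    intro σ σ' hσ
    have := hdep hσ
    rw [Set.indicator_compl]
    simp only [Pi.sub_apply, this]
  refine hμ.abs_real_sub_le _ hE (fun τ τ' => ?_) (fun τ τ' => ?_) _ (Real.one_le_exp ?_)
  · exact h.gibbsExp_le hB hβ h2 le_rfl h1 (Set.indicator_nonneg fun _ _ => zero_le_one) hdep τ τ'
  · exact h.gibbsExp_le hB hβ h2 le_rfl h1 (Set.indicator_nonneg fun _ _ => zero_le_one) hdep' τ τ'
  · unfold mixBound; positivity

theorem IsGibbs.unique {B : Finset Site} (h : HasInsulation B) (hB : B.Nonempty)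
    {β : ℝ} (hβ : 0 < β) {μ ν : Measure Config} (hμ : IsGibbs B β μ) (hν : IsGibbs B β ν) :
    ν = μ := by
  have := hμ.1
  have := hν.1
  refine ext_of_generate_finite _ generateFrom_measurableCylinders.symm
    isPiSystem_measurableCylinders (fun E hE => ?_) (by simp)
  have hEm := MeasurableSet.of_mem_measurableCylinders hE
  obtain ⟨V, S, _, rfl⟩ := (mem_measurableCylinders _).1 hE
  have hV := dependsOn_indicator_cylinder V S
  have := tendsto_nhds_unique (hν.tendsto_gibbsProb h hB hβ hEm hV fun _ => 1)
    (hμ.tendsto_gibbsProb h hB hβ hEm hV fun _ => 1)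
  rwa [measureReal_eq_measureReal_iff] at this

/-! ### Multispins in infinite volume -/

/-- The set `A` is the boundary of the set `F` of positions: it consists of the sites that lie in
an odd number of the plaquettes. -/
def IsBoundary (B F A : Finset Site) : Prop := ∀ x, x ∈ A ↔ Odd (incidence B F x)

theorem units_pow_eq_ite (u : ℤˣ) (n : ℕ) : u ^ n = if Odd n then u else 1 := by
  split_ifs with h
  · obtain ⟨k, rfl⟩ := h
    rw [pow_succ, pow_mul, Int.units_sq, one_pow, one_mul]
  · obtain ⟨k, rfl⟩ := Nat.not_odd_iff_even.1 h
    rw [← two_mul, pow_mul, Int.units_sq, one_pow]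

/-- By Fubini, the product of the plaquette variables in `F` is the multispin of the boundary. -/
theorem IsBoundary.plaqProd_eq {B F A : Finset Site} (h : IsBoundary B F A) (σ : Config) :
    plaqProd B F σ = multispin A σ := by
  set U := A ∪ F.biUnion (translate B) with hU
  have h1 : ∏ z ∈ F, ∏ x ∈ translate B z, σ x = ∏ x ∈ A, σ x := by
    have e1 : ∀ z ∈ F, ∏ x ∈ translate B z, σ x =
        ∏ x ∈ U, if x ∈ translate B z then σ x else 1 := by
      intro z hz
      rw [← Finset.prod_filter]
      refine Finset.prod_congr ?_ fun _ _ => rfl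
      ext x
      simp only [Finset.mem_filter, hU, Finset.mem_union, Finset.mem_biUnion]
      exact ⟨fun hx => ⟨Or.inr ⟨z, hz, hx⟩, hx⟩, fun hx => hx.2⟩
    have e2 : ∏ x ∈ A, σ x = ∏ x ∈ U, if x ∈ A then σ x else 1 := by
      rw [← Finset.prod_filter]
      refine Finset.prod_congr ?_ fun _ _ => rfl
      ext x
      simp only [Finset.mem_filter, hU, Finset.mem_union]
      tauto
    rw [Finset.prod_congr rfl e1, e2, Finset.prod_comm]
    refine Finset.prod_congr rfl fun x _ => ?_
    rw [← Finset.prod_filter, Finset.prod_const]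
    have := units_pow_eq_ite (σ x) (incidence B F x)
    rw [incidence] at this
    rw [this]
    simp only [h x, incidence]
  unfold plaqProd multispin
  rw [← h1]
  push_cast
  rfl

theorem isBoundary_of_plaqProd_eq {B F A : Finset Site}
    (h : ∀ σ, plaqProd B F σ = multispin A σ) : IsBoundary B F A := by
  intro x
  have h1 := h (flip 1 x)
  rw [plaqProd_flip, h, multispin_one, mul_one] at h1
  by_cases hx : x ∈ A
  · rw [multispin_flip_of_mem hx, multispin_one, neg_one_pow_eq_neg_one_iff_odd (by norm_num)] at h1
    exact ⟨fun _ => h1, fun _ => hx⟩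
  · rw [multispin_flip_of_notMem hx, multispin_one,
      neg_one_pow_eq_one_iff_even (by norm_num)] at h1
    exact ⟨fun h' => absurd h' hx, fun h' => absurd h1 (Nat.not_even_iff_odd.2 h')⟩

theorem multispin_eq_indicator (A : Finset Site) (σ : Config) :
    multispin A σ = 2 * ({σ | multispin A σ = 1} : Set Config).indicator (fun _ => 1) σ + -1 := by
  rcases multispin_eq_or A σ with h | h
  · rw [Set.indicator_of_mem (by simpa using h), h]; norm_num
  · have hn : σ ∉ {σ | multispin A σ = 1} := by
      intro h'
      have h'' : multispin A σ = 1 := h'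
      linarith
    rw [Set.indicator_of_notMem hn, h, mul_zero, zero_add]

theorem measurableSet_multispin (A : Finset Site) :
    MeasurableSet {σ : Config | multispin A σ = 1} :=
  (continuous_multispin A).measurable (measurableSet_singleton 1)

theorem gibbsExp_multispin (B : Finset Site) (β : ℝ) (Λ A : Finset Site) (τ : Config) :
    gibbsExp B β Λ τ (multispin A) = 2 * gibbsProb B β Λ τ {σ | multispin A σ = 1} - 1 := by
  have : multispin A = fun σ =>
      2 * ({σ | multispin A σ = 1} : Set Config).indicator (fun _ => 1) σ + -1 :=
    funext (multispin_eq_indicator A)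
  conv_lhs => rw [this]
  rw [gibbsExp_add, gibbsExp_const_mul, gibbsExp_const, gibbsProb]
  ring

theorem integral_multispin (A : Finset Site) (μ : Measure Config) [IsProbabilityMeasure μ] :
    ∫ σ, multispin A σ ∂μ = 2 * μ.real {σ | multispin A σ = 1} - 1 := by
  have hm := measurableSet_multispin A
  rw [integral_congr_ae (Eventually.of_forall (multispin_eq_indicator A))]
  rw [integral_add, integral_const_mul, integral_const]
  · have : ∫ σ, ({σ | multispin A σ = 1} : Set Config).indicator (fun _ => (1 : ℝ)) σ ∂μ =
        μ.real {σ | multispin A σ = 1} := integral_indicator_one hm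
    rw [this]
    simp
    ring
  · exact ((integrable_const (1 : ℝ)).indicator hm).const_mul 2
  · exact integrable_const _

/-- If the finite-volume expectations in `Λ` of a multispin are close to `c` for all boundary
conditions, then so is its expectation in infinite volume. -/
theorem IsGibbs.abs_integral_multispin_sub_le {B : Finset Site} {β : ℝ} {μ : Measure Config}
    (hμ : IsGibbs B β μ) (Λ A : Finset Site) {c ε : ℝ}
    (h : ∀ τ, |gibbsExp B β Λ τ (multispin A) - c| ≤ ε) :
    |∫ σ, multispin A σ ∂μ - c| ≤ ε := by
  have := hμ.1
  have hm := measurableSet_multispin A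
  have hint : Integrable (fun τ => gibbsProb B β Λ τ {σ | multispin A σ = 1}) μ := by
    refine Integrable.of_bound (measurable_gibbsProb B β Λ hm).aestronglyMeasurable 1 ?_
    refine Eventually.of_forall fun τ => ?_
    rw [Real.norm_of_nonneg (gibbsProb_nonneg _ _ _ _ _)]
    exact gibbsProb_le_one _ _ _ _ _
  have heq : ∫ σ, multispin A σ ∂μ - c =
      ∫ τ, (2 * gibbsProb B β Λ τ {σ | multispin A σ = 1} - 1 - c) ∂μ := by
    rw [integral_multispin, hμ.2 Λ _ hm, integral_sub, integral_sub, integral_const_mul]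
    · simp
    · exact hint.const_mul 2
    · exact integrable_const _
    · exact (hint.const_mul 2).sub (integrable_const _)
    · exact integrable_const _
  rw [heq, ← Real.norm_eq_abs]
  refine (norm_integral_le_of_norm_le_const (C := ε) (Eventually.of_forall fun τ => ?_)).trans ?_
  · rw [Real.norm_eq_abs, ← gibbsExp_multispin]
    exact h τ
  · simp

/-- There are tight domains of polynomial size around the origin, in which the cycle sum tends to
zero as `M → ∞` at each temperature. -/
def HasTightDomains (B : Finset Site) : Prop :=
  ∀ M : ℕ, ∃ Λ : Finset Site, centredSquare M ⊆ Λ ∧ Tight B Λ M ∧ Λ.card ≤ (10 * M + 1) ^ 2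

theorem hasTightDomains_spm : HasTightDomains spm := by
  intro M
  refine ⟨box (-M) (-M) (2 * M + 1), fun x hx => ?_, tight_box _ _ (by omega), ?_⟩
  · rw [mem_centredSquare] at hx
    rw [mem_box]
    push_cast
    omega
  · rw [box, Finset.card_product, Int.card_Icc, sq]
    exact Nat.mul_le_mul (by omega) (by omega)

theorem hasTightDomains_tpm : HasTightDomains tpm := by
  intro M
  refine ⟨tri (-3 * M) (-M) (4 * M), fun x hx => ?_, ?_, ?_⟩
  · rw [mem_centredSquare] at hx
    rw [mem_tri]
    push_cast
    omega
  · simpa using tight_tri_union (a := -3 * M) (b := -M) (a' := -3 * M) (b' := -M) le_rfl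
      (by omega) le_rfl (by omega) (le_refl (4 * M))
  · refine (Finset.card_filter_le _ _).trans ?_
    rw [Finset.card_product, Int.card_Icc, Int.card_Icc, sq]
    exact Nat.mul_le_mul (by omega) (by omega)

/-- Each multispin that is a product of plaquette variables has the expectation that it would have
if these variables were independent. -/
theorem IsGibbs.integral_multispin_of_isBoundary {B : Finset Site} (hd : HasTightDomains B)
    (hB : B.Nonempty) {β : ℝ} (hβ : 0 < β) {μ : Measure Config} (hμ : IsGibbs B β μ)
    {F A : Finset Site} (h : IsBoundary B F A) :
    ∫ σ, multispin A σ ∂μ = Real.tanh (β / 2) ^ F.card := by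
  set t := Real.tanh (β / 2)
  have ht : 0 < t := tanh_half_pos hβ
  have ht1 : t < 1 := Real.tanh_lt_one _
  choose Λ hΛ hT hcard using hd
  set S : ℕ → ℝ := fun M => cycleSum B (Λ M) t
  have hS0 : ∀ M, 0 ≤ S M := fun M => cycleSum_nonneg B _ ht.le
  have hS : Tendsto S atTop (nhds 0) := by
    have hlim : Tendsto (fun M : ℕ => 2 * ((B.card : ℝ) * 11 ^ 2 * (M ^ 3 * t ^ M))) atTop
        (nhds 0) := by
      have := ((tendsto_pow_const_mul_const_pow_of_abs_lt_one 3 (r := t)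
        (by rwa [abs_of_pos ht])).const_mul ((B.card : ℝ) * 11 ^ 2)).const_mul 2
      simpa using this
    have hlim' : ∀ᶠ M : ℕ in atTop, (B.card : ℝ) * 11 ^ 2 * (M ^ 3 * t ^ M) ≤ 1 := by
      filter_upwards [hlim.eventually_le_const (show (0 : ℝ) < 2 by norm_num)] with M hM
      linarith
    refine squeeze_zero' (Eventually.of_forall hS0) ?_ hlim
    filter_upwards [hlim', eventually_ge_atTop 1] with M h1 h2
    have hM : (1 : ℝ) ≤ M := by exact_mod_cast h2
    have hc : ((Λ M).card : ℝ) ≤ 11 ^ 2 * M ^ 2 := by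
      have : ((Λ M).card : ℝ) ≤ (10 * M + 1) ^ 2 := by exact_mod_cast hcard M
      nlinarith
    have h3 : (M : ℝ) * (B.card * (Λ M).card * t ^ M) ≤
        B.card * 11 ^ 2 * (M ^ 3 * t ^ M) := by
      calc (M : ℝ) * (B.card * (Λ M).card * t ^ M)
          ≤ M * (B.card * (11 ^ 2 * M ^ 2) * t ^ M) := by gcongr
        _ = _ := by ring
    have h4 : 0 ≤ B.card * (Λ M).card * t ^ M := by positivity
    refine (tight_cycleSum_le (by omega) subset_rfl (hT M) ht.le ht1.le ?_).trans ?_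
    · nlinarith
    · linarith
  -- the error of the approximation of the expectation in the domain `Λ M`
  have hbound : ∀ᶠ M in atTop,
      |∫ σ, multispin A σ ∂μ - t ^ F.card| ≤ 2 * ((t ^ F.card)⁻¹ * S M + S M) := by
    obtain ⟨k₀, hk₀⟩ := exists_subset_centredSquare F
    have hFpos : ∀ M ≥ k₀, F ⊆ positions B (Λ M ∪ F.biUnion (translate B)) := by
      intro M _ z hz
      obtain ⟨b, hb⟩ := hB
      exact mem_positions.2 ⟨b + z, Finset.mem_union_right _ (Finset.mem_biUnion.2
        ⟨z, hz, mem_translate.2 (by simpa using hb)⟩), mem_translate.2 (by simpa using hb)⟩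
    obtain ⟨k₁, hk₁⟩ := exists_subset_centredSquare (F.biUnion (translate B))
    filter_upwards [eventually_ge_atTop k₀, eventually_ge_atTop k₁,
      hS.eventually_le_const (show (0 : ℝ) < 1 / 2 by norm_num)] with M h1 h2 h3
    have hFΛ : F ⊆ positions B (Λ M) := by
      have := hFpos M h1
      rwa [Finset.union_eq_left.2 ((hk₁ M h2).trans (hΛ M))] at this
    refine hμ.abs_integral_multispin_sub_le (Λ M) A fun τ => ?_
    have e1 := abs_sum_plaqProd_weight_sub_le hB hβ hFΛ τ
    have e2 := abs_partitionFunction_sub_le hB hβ (Λ M) τ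
    set C := Real.cosh (β / 2) ^ (positions B (Λ M)).card * 2 ^ (Λ M).card
    have hC : 0 < C := mul_pos (pow_pos (Real.cosh_pos _) _) (by positivity)
    have hgE : gibbsExp B β (Λ M) τ (multispin A) =
        ((∑ η : Λ M → ℤˣ, plaqProd B F (glue (Λ M) η τ) * weight B β (Λ M) (glue (Λ M) η τ)) / C) /
          (partitionFunction B β (Λ M) τ / C) := by
      rw [div_div_div_cancel_right₀ hC.ne', gibbsExp]
      simp_rw [h.plaqProd_eq]
    rw [hgE]
    set n := (∑ η : Λ M → ℤˣ, plaqProd B F (glue (Λ M) η τ) *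
      weight B β (Λ M) (glue (Λ M) η τ)) / C
    set Z := partitionFunction B β (Λ M) τ / C
    change |n - t ^ F.card| ≤ (t ^ F.card)⁻¹ * S M at e1
    change |Z - 1| ≤ S M at e2
    have hZ : 1 / 2 ≤ Z := by linarith [(abs_le.1 e2).1]
    have hp0 : 0 < t ^ F.card := pow_pos ht _
    have hp1 : t ^ F.card ≤ 1 := pow_le_one₀ ht.le ht1.le
    have : n / Z - t ^ F.card = ((n - t ^ F.card) - t ^ F.card * (Z - 1)) / Z := by
      field_simp
      ring
    rw [this, abs_div, abs_of_pos (by linarith : 0 < Z), div_le_iff₀ (by linarith)]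
    have e3 : |n - t ^ F.card - t ^ F.card * (Z - 1)| ≤ (t ^ F.card)⁻¹ * S M + S M := by
      refine (abs_sub _ _).trans (add_le_add e1 ?_)
      rw [abs_mul, abs_of_pos hp0]
      exact (mul_le_of_le_one_left (abs_nonneg _) hp1).trans e2
    have e4 : 0 ≤ (t ^ F.card)⁻¹ * S M + S M := by
      have := hS0 M
      positivity
    nlinarith
  have hzero : Tendsto (fun M => 2 * ((t ^ F.card)⁻¹ * S M + S M)) atTop (nhds 0) := by
    have := ((hS.const_mul (t ^ F.card)⁻¹).add hS).const_mul 2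
    simpa using this
  have := ge_of_tendsto hzero hbound
  have h0 := abs_nonneg (∫ σ, multispin A σ ∂μ - t ^ F.card)
  exact sub_eq_zero.1 (abs_eq_zero.1 (le_antisymm this h0))

/-- A multispin is a product of plaquette variables, unless it changes sign under a flip of spins
that preserves all plaquette variables: this is duality of vector spaces over `ZMod 2`. -/
theorem exists_isBoundary_or_flip (B A : Finset Site) :
    (∃ F, IsBoundary B F A) ∨
      ∃ η : Config, (∀ z, multispin (translate B z) η = 1) ∧ multispin A η = -1 := by
  let e : Finset Site → (Site →₀ ZMod 2) := fun P => ∑ x ∈ P, Finsupp.single x 1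
  let W : Submodule (ZMod 2) (Site →₀ ZMod 2) :=
    Submodule.span (ZMod 2) (Set.range fun z => e (translate B z))
  by_cases hA : e A ∈ W
  · left
    -- the product of the spins in the support of a vector
    let χ : Config → (Site →₀ ZMod 2) → ℝ := fun σ v => multispin v.support σ
    have hχ : ∀ σ (P : Finset Site), χ σ (e P) = multispin P σ := by
      intro σ P
      have : (e P).support = P := by
        ext x
        simp only [e, Finsupp.mem_support_iff, Finsupp.finsetSum_apply, Finsupp.single_apply]
        simp
      simp only [χ, this]
    have hadd : ∀ σ v w, χ σ (v + w) = χ σ v * χ σ w := by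
      intro σ v w
      have hs : ∀ u : Site →₀ ZMod 2, ∀ U, u.support ⊆ U →
          multispin u.support σ = ∏ x ∈ U, if u x = 0 then (1 : ℝ) else ((σ x : ℤ) : ℝ) := by
        intro u U hU
        have : u.support = U.filter fun x => ¬ u x = 0 := by
          ext x
          simp only [Finset.mem_filter, Finsupp.mem_support_iff]
          exact ⟨fun h => ⟨hU (Finsupp.mem_support_iff.2 h), h⟩, fun h => h.2⟩
        rw [this]
        unfold multispin
        push_cast
        rw [Finset.prod_filter]
        exact Finset.prod_congr rfl fun x _ => by split_ifs <;> simp_all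
      simp only [χ]
      rw [hs (v + w) _ Finsupp.support_add, hs v _ Finset.subset_union_left,
        hs w _ Finset.subset_union_right, ← Finset.prod_mul_distrib]
      refine Finset.prod_congr rfl fun x _ => ?_
      rw [Finsupp.add_apply]
      have hsq : ((σ x : ℤ) : ℝ) * ((σ x : ℤ) : ℝ) = 1 := by
        rcases Int.units_eq_one_or (σ x) with h | h <;> simp [h]
      have h2 : ∀ a : ZMod 2, a = 0 ∨ a = 1 := by decide
      rcases h2 (v x) with h | h <;> rcases h2 (w x) with h' | h' <;> simp [h, h', hsq]
      have : (1 : ZMod 2) + 1 = 0 := by decide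
      simp [this]
    have hspan : ∀ v ∈ W, ∃ F, ∀ σ, plaqProd B F σ = χ σ v := by
      intro v hv
      induction hv using Submodule.span_induction with
      | mem v hv =>
        obtain ⟨z, rfl⟩ := hv
        exact ⟨{z}, fun σ => by simp only [hχ]; simp [plaqProd]⟩
      | zero => exact ⟨∅, fun σ => by simp [χ, multispin]⟩
      | add v w _ _ hv hw =>
        obtain ⟨F, hF⟩ := hv
        obtain ⟨G, hG⟩ := hw
        exact ⟨symmDiff F G, fun σ => by rw [← plaqProd_mul_plaqProd, hF, hG, hadd]⟩
      | smul a v _ hv =>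
        have h2 : ∀ a : ZMod 2, a = 0 ∨ a = 1 := by decide
        rcases h2 a with rfl | rfl
        · exact ⟨∅, fun σ => by simp [χ, multispin]⟩
        · simpa using hv
    obtain ⟨F, hF⟩ := hspan _ hA
    exact ⟨F, isBoundary_of_plaqProd_eq fun σ => by rw [hF, hχ]⟩
  · right
    obtain ⟨φ, hφA, hφW⟩ := Submodule.exists_le_ker_of_notMem hA
    let η : Config := fun x => if φ (Finsupp.single x 1) = 0 then 1 else -1
    have hη : ∀ P : Finset Site, multispin P η = if φ (e P) = 0 then 1 else -1 := by
      intro P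
      induction P using Finset.induction_on with
      | empty => simp [multispin, e]
      | insert x P hx ih =>
        have h1 : multispin (insert x P) η = ((η x : ℤ) : ℝ) * multispin P η := by
          simp [multispin, Finset.prod_insert hx]
        have h2 : φ (e (insert x P)) = φ (Finsupp.single x 1) + φ (e P) := by
          simp only [e, Finset.sum_insert hx, map_add]
        rw [h1, h2, ih]
        have h2 : ∀ a : ZMod 2, a = 0 ∨ a = 1 := by decide
        have h3 : (1 : ZMod 2) + 1 = 0 := by decide
        rcases h2 (φ (Finsupp.single x 1)) with h | h <;> rcases h2 (φ (e P)) with h' | h' <;>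
          simp [η, h, h', h3]
    refine ⟨η, fun z => ?_, ?_⟩
    · rw [hη, if_pos]
      exact hφW (Submodule.subset_span ⟨z, rfl⟩)
    · rw [hη, if_neg hφA]

/-- Invariance of the finite-volume Gibbs measures under flips that preserve all plaquette
variables. -/
theorem gibbsExp_mul_of_invariant {B : Finset Site} (hB : B.Nonempty) (β : ℝ) (Λ : Finset Site)
    {η : Config} (hη : ∀ z ∈ positions B Λ, multispin (translate B z) η = 1) (τ : Config)
    (f : Config → ℝ) :
    gibbsExp B β Λ (τ * η) f = gibbsExp B β Λ τ fun σ => f (σ * η) := by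
  have key : ∀ g : Config → ℝ,
      gibbsSum B β Λ (τ * η) g = gibbsSum B β Λ τ fun σ => g (σ * η) := by
    intro g
    unfold gibbsSum
    rw [← Equiv.sum_comp (Equiv.mulRight fun x : Λ => η x)]
    refine Finset.sum_congr rfl fun ξ _ => ?_
    have h1 : glue Λ (Equiv.mulRight (fun x : Λ => η x) ξ) (τ * η) = glue Λ ξ τ * η := by
      funext x
      by_cases hx : x ∈ Λ
      · rw [Pi.mul_apply, glue_of_mem hx, glue_of_mem hx]; rfl
      · rw [Pi.mul_apply, glue_of_notMem hx, glue_of_notMem hx]; rfl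
    have h2 : weight B β Λ (glue Λ ξ τ * η) = weight B β Λ (glue Λ ξ τ) := by
      rw [weight_eq_exp hB, weight_eq_exp hB]
      congr 1
      refine Finset.sum_congr rfl fun z hz => ?_
      rw [multispin_mul, hη z hz, mul_one]
    rw [h1, h2]
  rw [gibbsExp_eq, gibbsExp_eq, key, ← gibbsSum_one, ← gibbsSum_one, key]

/-- Flipping a configuration that preserves all plaquette variables only modifies the boundary
condition, which is irrelevant in the limit, but it changes the sign of the multispin. -/
theorem IsGibbs.integral_multispin_eq_zero {B : Finset Site} (h : HasInsulation B)
    (hB : B.Nonempty) {β : ℝ} (hβ : 0 < β) {μ : Measure Config} (hμ : IsGibbs B β μ)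
    {A : Finset Site} (hA : ¬ ∃ F, IsBoundary B F A) : ∫ σ, multispin A σ ∂μ = 0 := by
  have := hμ.1
  obtain ⟨η, hη, hηA⟩ := (exists_isBoundary_or_flip B A).resolve_left hA
  have hdep : DependsOn (({σ | multispin A σ = 1} : Set Config).indicator fun _ => (1 : ℝ))
      (A : Set Site) := by
    intro σ σ' hσ
    have e : multispin A σ = multispin A σ' := multispin_congr hσ
    exact Set.indicator_const_eq_indicator_const (by simp [e])
  have key : ∀ τ : Config, Tendsto (fun M : ℕ => gibbsExp B β (centredSquare (10 * (40 * M))) τ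
      (multispin A)) atTop (nhds (∫ σ, multispin A σ ∂μ)) := by
    intro τ
    rw [integral_multispin]
    simp_rw [gibbsExp_multispin]
    exact ((hμ.tendsto_gibbsProb h hB hβ (measurableSet_multispin A) hdep
      fun _ => τ).const_mul 2).sub_const 1
  have h1 := key (1 * η)
  have h2 : ∀ M : ℕ, gibbsExp B β (centredSquare (10 * (40 * M))) (1 * η) (multispin A) =
      -gibbsExp B β (centredSquare (10 * (40 * M))) 1 (multispin A) := by
    intro M
    rw [gibbsExp_mul_of_invariant hB β _ (fun z _ => hη z), ← neg_one_mul, ← gibbsExp_const_mul]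
    simp_rw [multispin_mul, hηA]
    congr 1
    funext σ
    ring
  simp_rw [h2] at h1
  have := tendsto_nhds_unique h1 (key 1).neg
  linarith

/-! ### Dilated plaquettes and Sierpinski sets -/

/-- The indicator of a finite set of sites, with values in `ZMod 2`. -/
def ind (F : Finset Site) (x : Site) : ZMod 2 := if x ∈ F then 1 else 0

/-- Convolution over `ZMod 2` with the indicator of the dilated plaquette `k • B`. -/
def conv (B : Finset Site) (k : ℕ) (f : Site → ZMod 2) (x : Site) : ZMod 2 :=
  ∑ b ∈ B, f (x - k • b)

theorem incidence_cast_eq_conv (B F : Finset Site) (x : Site) :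
    (incidence B F x : ZMod 2) = conv B 1 (ind F) x := by
  rw [incidence_cast]
  simp [conv, ind]

theorem isBoundary_iff {B F A : Finset Site} : IsBoundary B F A ↔ ind A = conv B 1 (ind F) := by
  constructor
  · intro h
    funext x
    rw [← incidence_cast_eq_conv, ind]
    split_ifs with hx
    · exact ((ZMod.natCast_eq_one_iff_odd).2 ((h x).1 hx)).symm
    · exact ((ZMod.natCast_eq_zero_iff_even).2
        (Nat.not_odd_iff_even.1 fun h' => hx ((h x).2 h'))).symm
  · intro h x
    rw [← ZMod.natCast_eq_one_iff_odd, incidence_cast_eq_conv, ← h, ind]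
    simp

theorem conv_comm (B : Finset Site) (k l : ℕ) (f : Site → ZMod 2) :
    conv B k (conv B l f) = conv B l (conv B k f) := by
  funext x
  unfold conv
  rw [Finset.sum_comm]
  refine Finset.sum_congr rfl fun b _ => Finset.sum_congr rfl fun c _ => ?_
  congr 1
  abel

/-- The Frobenius identity: in characteristic two the square of a dilated plaquette is the
plaquette dilated by twice the factor. -/
theorem conv_conv_self (B : Finset Site) (k : ℕ) (f : Site → ZMod 2) :
    conv B k (conv B k f) = conv B (2 * k) f := by
  funext x
  unfold conv
  rw [← Finset.sum_product', ← Finset.diag_union_offDiag,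
    Finset.sum_union (Finset.disjoint_diag_offDiag B), Finset.sum_diag]
  have h0 : ∑ p ∈ B.offDiag, f (x - k • p.1 - k • p.2) = 0 := by
    refine Finset.sum_involution (fun p _ => p.swap) ?_ ?_ ?_ ?_
    · intro p _
      have : x - k • p.swap.1 - k • p.swap.2 = x - k • p.1 - k • p.2 := by
        simp only [Prod.fst_swap, Prod.snd_swap]
        abel
      rw [this]
      exact CharTwo.add_self_eq_zero _
    · intro p hp _ h
      rw [Finset.mem_offDiag] at hp
      exact hp.2.2 (congrArg Prod.snd h)
    · intro p hp
      rw [Finset.mem_offDiag] at hp ⊢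
      exact ⟨hp.2.1, hp.1, hp.2.2.symm⟩
    · intro p _
      exact Prod.swap_swap p
  rw [h0, add_zero]
  refine Finset.sum_congr rfl fun b _ => ?_
  congr 1
  rw [mul_smul, two_smul]
  abel

/-- The Sierpinski set of order `n`: the sums `∑_{i < n} 2^i b_i` with digits `b_i ∈ B`. -/
def sierpinski (B : Finset Site) : ℕ → Finset Site
  | 0 => {0}
  | n + 1 => (B ×ˢ sierpinski B n).image fun p => 2 ^ n • p.1 + p.2

/-- All points of `B` have coordinates `0` and `1`. -/
def IsUnit01 (B : Finset Site) : Prop := ∀ b ∈ B, (b.1 = 0 ∨ b.1 = 1) ∧ (b.2 = 0 ∨ b.2 = 1)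

theorem isUnit01_spm : IsUnit01 spm := fun _ hb => mem_spm.1 hb

theorem isUnit01_tpm : IsUnit01 tpm := fun b hb => by
  rw [mem_tpm] at hb
  omega

theorem smul_fst_snd (k : ℕ) (b : Site) : (k • b).1 = k * b.1 ∧ (k • b).2 = k * b.2 := by
  simp

theorem mem_sierpinski_bounds {B : Finset Site} (hB : IsUnit01 B) {n : ℕ} {v : Site}
    (hv : v ∈ sierpinski B n) : 0 ≤ v.1 ∧ v.1 < 2 ^ n ∧ 0 ≤ v.2 ∧ v.2 < 2 ^ n := by
  induction n generalizing v with
  | zero => simp_all [sierpinski]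
  | succ n ih =>
    simp only [sierpinski, Finset.mem_image, Finset.mem_product] at hv
    obtain ⟨⟨b, w⟩, ⟨hb, hw⟩, rfl⟩ := hv
    have h1 : 0 ≤ w.1 ∧ w.1 < 2 ^ n ∧ 0 ≤ w.2 ∧ w.2 < 2 ^ n := ih hw
    have h2 := hB b hb
    have h3 := smul_fst_snd (2 ^ n) b
    simp only [Prod.fst_add, Prod.snd_add, h3, pow_succ]
    push_cast
    rcases h2 with ⟨h | h, h' | h'⟩ <;> rw [h, h'] <;> omega

theorem sierpinski_injOn {B : Finset Site} (hB : IsUnit01 B) (n : ℕ) :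
    Set.InjOn (fun p : Site × Site => 2 ^ n • p.1 + p.2) (B ×ˢ sierpinski B n : Finset _) := by
  rintro ⟨b, v⟩ h ⟨b', v'⟩ h' heq
  simp only [Finset.coe_product, Set.mem_prod, Finset.mem_coe] at h h'
  have h1 := mem_sierpinski_bounds hB h.2
  have h1' := mem_sierpinski_bounds hB h'.2
  have h2 := hB b h.1
  have h2' := hB b' h'.1
  have e1 := congrArg Prod.fst heq
  have e2 := congrArg Prod.snd heq
  simp only [Prod.fst_add, Prod.snd_add, smul_fst_snd] at e1 e2
  push_cast at e1 e2
  have f1 : b.1 = b'.1 ∧ v.1 = v'.1 := by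
    rcases h2.1 with h | h <;> rcases h2'.1 with h' | h' <;> rw [h, h'] at e1 <;> omega
  have f2 : b.2 = b'.2 ∧ v.2 = v'.2 := by
    rcases h2.2 with h | h <;> rcases h2'.2 with h' | h' <;> rw [h, h'] at e2 <;> omega
  exact Prod.ext (Prod.ext f1.1 f2.1) (Prod.ext f1.2 f2.2)

theorem card_sierpinski {B : Finset Site} (hB : IsUnit01 B) (n : ℕ) :
    (sierpinski B n).card = B.card ^ n := by
  induction n with
  | zero => rfl
  | succ n ih =>
    rw [sierpinski, Finset.card_image_of_injOn (sierpinski_injOn hB n), Finset.card_product, ih,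
      pow_succ, mul_comm]

theorem sum_sierpinski_succ {B : Finset Site} (hB : IsUnit01 B) (n : ℕ) (f : Site → ZMod 2)
    (x : Site) : ∑ v ∈ sierpinski B (n + 1), f (x - v) =
      conv B (2 ^ n) (fun y => ∑ v ∈ sierpinski B n, f (y - v)) x := by
  rw [sierpinski, Finset.sum_image (sierpinski_injOn hB n), Finset.sum_product]
  refine Finset.sum_congr rfl fun b _ => Finset.sum_congr rfl fun v _ => ?_
  congr 1
  abel

/-- The convolution of the plaquette with the Sierpinski set of order `n` is the plaquette dilated
by `2^n`: over `ZMod 2`, the polynomial of the plaquette satisfies `P · P^{2^n - 1} = P^{2^n}`. -/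
theorem conv_sum_sierpinski {B : Finset Site} (hB : IsUnit01 B) (n : ℕ) (f : Site → ZMod 2) :
    conv B 1 (fun y => ∑ v ∈ sierpinski B n, f (y - v)) = conv B (2 ^ n) f := by
  induction n with
  | zero => simp [sierpinski]
  | succ n ih =>
    have : (fun y => ∑ v ∈ sierpinski B (n + 1), f (y - v)) =
        conv B (2 ^ n) (fun y => ∑ v ∈ sierpinski B n, f (y - v)) :=
      funext (sum_sierpinski_succ hB n f)
    rw [this, conv_comm, ih, conv_conv_self, pow_succ, mul_comm]

theorem isBoundary_sierpinski {B : Finset Site} (hB : IsUnit01 B) (n : ℕ) :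
    IsBoundary B (sierpinski B n) (B.image fun b => 2 ^ n • b) := by
  rw [isBoundary_iff]
  have h1 : ind (sierpinski B n) = fun y => ∑ v ∈ sierpinski B n, ind {0} (y - v) := by
    funext y
    simp [ind, sub_eq_zero, Finset.sum_ite_eq]
  have hinj : Set.InjOn (fun b : Site => 2 ^ n • b) B := by
    intro b _ c _ h
    exact smul_right_injective Site (pow_ne_zero n two_ne_zero) h
  rw [h1, conv_sum_sierpinski hB]
  funext x
  have h2 : conv B (2 ^ n) (ind {0}) x = ∑ c ∈ B.image (fun b => 2 ^ n • b), ind {0} (x - c) := by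
    rw [Finset.sum_image hinj]
    rfl
  rw [h2]
  generalize B.image (fun b => 2 ^ n • b) = A
  simp [ind, sub_eq_zero, Finset.sum_ite_eq]

/-- The boundary of a small set `F` of plaquettes is either empty or not sparse. If `A` is sparse,
then the translates of the Sierpinski set by the points of `A` are disjoint, so their sum contains
each of them; but this sum is the convolution of `F` with a dilated plaquette, and has at most
`|B| |F|` points. -/
theorem card_pow_le_of_separated {B : Finset Site} (hB : IsUnit01 B) {F A : Finset Site}
    (h : IsBoundary B F A) {n : ℕ} (hA : Separated (2 ^ (n + 1)) A) :
    B.card ^ n ≤ B.card * F.card := by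
  obtain ⟨⟨a, ha⟩, hsep⟩ := hA
  -- the convolution of `F` with the dilated plaquette is that of `A` with the Sierpinski set
  have hconv : ∀ x, conv B (2 ^ n) (ind F) x = ∑ v ∈ sierpinski B n, ind A (x - v) := by
    intro x
    rw [← conv_sum_sierpinski hB, isBoundary_iff.1 h]
    unfold conv
    rw [Finset.sum_comm]
    refine Finset.sum_congr rfl fun b _ => Finset.sum_congr rfl fun c _ => ?_
    congr 1
    abel
  have hsub : sierpinski B n ⊆ (F ×ˢ B).image fun p => p.1 + 2 ^ n • p.2 - a := by
    intro v hv
    have h1 : conv B (2 ^ n) (ind F) (a + v) = 1 := by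
      rw [hconv, Finset.sum_eq_single v]
      · simp [ind, ha]
      · intro w hw hwv
        rw [ind, if_neg]
        intro hmem
        have hne : a + v - w ≠ a := by
          intro h'
          apply hwv
          have : v - w = 0 := by
            rw [add_sub_assoc] at h'
            exact add_eq_left.1 h'
          exact (sub_eq_zero.1 this).symm
        have h2 := hsep _ hmem a ha hne
        have b1 := mem_sierpinski_bounds hB hv
        have b2 := mem_sierpinski_bounds hB hw
        unfold dist1 at h2
        simp only [Prod.fst_add, Prod.snd_add, Prod.fst_sub, Prod.snd_sub, pow_succ] at h2
        zify at h2
        rcases abs_cases (a.1 + v.1 - w.1 - a.1) with h3 | h3 <;>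
          rcases abs_cases (a.2 + v.2 - w.2 - a.2) with h4 | h4 <;> omega
      · intro h'
        exact absurd hv h'
    obtain ⟨b, hb, hne⟩ := Finset.exists_ne_zero_of_sum_ne_zero
      (show ∑ b ∈ B, ind F (a + v - 2 ^ n • b) ≠ 0 from by
        rw [show ∑ b ∈ B, ind F (a + v - 2 ^ n • b) = 1 from h1]; exact one_ne_zero)
    refine Finset.mem_image.2 ⟨(a + v - 2 ^ n • b, b), Finset.mem_product.2 ⟨?_, hb⟩, ?_⟩
    · by_contra hmem
      exact hne (if_neg hmem)
    · simp only
      abel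
  calc B.card ^ n = (sierpinski B n).card := (card_sierpinski hB n).symm
    _ ≤ _ := Finset.card_le_card hsub
    _ ≤ (F ×ˢ B).card := Finset.card_image_le
    _ = B.card * F.card := by rw [Finset.card_product, mul_comm]

theorem separated_image_smul {B : Finset Site} (hB : B.Nonempty) (k : ℕ) :
    Separated k (B.image fun b => k • b) := by
  refine ⟨hB.image _, ?_⟩
  intro x hx y hy hxy
  obtain ⟨b, _, rfl⟩ := Finset.mem_image.1 hx
  obtain ⟨c, _, rfl⟩ := Finset.mem_image.1 hy
  have hbc : b ≠ c := fun h => hxy (by rw [h])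
  unfold dist1
  simp only [smul_fst_snd, ← mul_sub, Int.natAbs_mul, Int.natAbs_natCast, ← mul_add]
  refine Nat.le_mul_of_pos_right _ ?_
  by_contra h0
  exact hbc (Prod.ext (by omega) (by omega))

/-! ### The multispin scale -/

theorem tanh_half_eq (β : ℝ) :
    Real.tanh (β / 2) = (1 - Real.exp (-β)) / (1 + Real.exp (-β)) := by
  have h1 : Real.exp (-β) = Real.exp (-(β / 2)) * Real.exp (-(β / 2)) := by
    rw [← Real.exp_add]; congr 1; ring
  have h2 : Real.exp (β / 2) * Real.exp (-(β / 2)) = 1 := by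
    rw [← Real.exp_add]; simp
  have h3 := Real.exp_pos (β / 2)
  have h4 := Real.exp_pos (-(β / 2))
  rw [Real.tanh_eq_sinh_div_cosh, Real.sinh_eq, Real.cosh_eq, h1, div_eq_div_iff (by positivity)
    (by positivity)]
  linear_combination (Real.exp (-(β / 2))) * h2

theorem tanh_half_le (β : ℝ) (hβ : 0 < β) :
    Real.tanh (β / 2) ≤ Real.exp (-Real.exp (-β)) := by
  have h0 := Real.exp_pos (-β)
  have h1 : Real.exp (-β) < 1 := by simpa using hβ
  refine le_trans ?_ (Real.add_one_le_exp _)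
  rw [tanh_half_eq, div_le_iff₀ (by positivity)]
  nlinarith

theorem one_sub_le_tanh_half (β : ℝ) : 1 - 2 * Real.exp (-β) ≤ Real.tanh (β / 2) := by
  have h0 := Real.exp_pos (-β)
  rw [tanh_half_eq, le_div_iff₀ (by positivity)]
  nlinarith

theorem one_sub_le_tanh_half_pow {β : ℝ} (hβ : 0 < β) (k : ℕ) :
    1 - 2 * k * Real.exp (-β) ≤ Real.tanh (β / 2) ^ k := by
  have h0 := one_sub_le_tanh_half β
  have h1 := tanh_half_pos hβ
  have h2 := one_add_mul_le_pow (a := Real.tanh (β / 2) - 1) (by linarith) k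
  have h3 : (0 : ℝ) ≤ k := Nat.cast_nonneg k
  rw [add_sub_cancel] at h2
  nlinarith

/-- A scale at which the multispin criterion holds: a boundary that is sparse at the scale `2^{n+2}`
needs at least `|B|^n` plaquettes. -/
theorem abs_integral_multispin_le_of_separated {B : Finset Site} (hi : HasInsulation B) (hd : HasTightDomains B)
    (hB : B.Nonempty) (h01 : IsUnit01 B) {β : ℝ} (hβ : 0 < β) {μ : Measure Config}
    (hμ : IsGibbs B β μ) {n : ℕ} (hn : Real.tanh (β / 2) ^ B.card ^ n ≤ 1 / 5) (A : Finset Site)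
    (hA : Separated (2 ^ (n + 2)) A) : |∫ σ, multispin A σ ∂μ| ≤ 1 / 5 := by
  have ht := tanh_half_pos hβ
  by_cases h : ∃ F, IsBoundary B F A
  · obtain ⟨F, hF⟩ := h
    rw [hμ.integral_multispin_of_isBoundary hd hB hβ hF, abs_of_pos (pow_pos ht _)]
    refine le_trans (pow_le_pow_of_le_one ht.le (Real.tanh_lt_one _).le ?_) hn
    have := card_pow_le_of_separated h01 hF (n := n + 1) hA
    rw [pow_succ, mul_comm] at this
    exact Nat.le_of_mul_le_mul_left this (Finset.card_pos.2 hB)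
  · rw [hμ.integral_multispin_eq_zero hi hB hβ h]
    norm_num

/-- The upper bound holds since all sparse boundaries need many plaquettes, the lower bound since
the dilated plaquettes are boundaries of Sierpinski sets. -/
theorem multispinScale_isTheta {B : Finset Site} (hi : HasInsulation B) (hd : HasTightDomains B)
    (h01 : IsUnit01 B) (hcard : 2 ≤ B.card) {μ : ℝ → Measure Config}
    (hμ : ∀ β : ℝ, 0 < β → IsGibbs B β (μ β)) :
    (fun β : ℝ => (multispinScale (μ β) : ℝ)) =Θ[atTop]
      fun β : ℝ => Real.exp (Real.log 2 / Real.log B.card * β) := by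
  have hB : B.Nonempty := Finset.card_pos.1 (by omega)
  have hb : (2 : ℝ) ≤ B.card := by exact_mod_cast hcard
  set b : ℝ := (B.card : ℝ) with hb_def
  have hlog : 0 < Real.log b := Real.log_pos (by linarith)
  have hlog2 : 0 < Real.log 2 := Real.log_pos one_lt_two
  have hbpow : ∀ n : ℕ, b ^ n = Real.exp (n * Real.log b) := fun n => by
    rw [Real.exp_nat_mul, Real.exp_log (by linarith)]
  have h2pow : ∀ n : ℕ, (2 : ℝ) ^ n = Real.exp (n * Real.log 2) := fun n => by
    rw [Real.exp_nat_mul, Real.exp_log (by norm_num)]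
  -- the order at which the Sierpinski set has about `2 e^β` plaquettes
  let n : ℝ → ℕ := fun β => ⌈(β + Real.log 2) / Real.log b⌉₊
  have hn : ∀ β > 0, Real.tanh (β / 2) ^ B.card ^ n β ≤ 1 / 5 := by
    intro β hβ
    have h1 : 2 * Real.exp β ≤ b ^ n β := by
      rw [hbpow, ← Real.exp_log (show (0 : ℝ) < 2 by norm_num), ← Real.exp_add]
      refine Real.exp_le_exp.2 ?_
      have := Nat.le_ceil ((β + Real.log 2) / Real.log b)
      rw [div_le_iff₀ hlog] at this
      change _ ≤ (n β : ℝ) * Real.log b at this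
      linarith
    calc Real.tanh (β / 2) ^ B.card ^ n β
        ≤ Real.exp (-Real.exp (-β)) ^ B.card ^ n β :=
          pow_le_pow_left₀ (tanh_half_pos hβ).le (tanh_half_le β hβ) _
      _ = Real.exp (-(b ^ n β * Real.exp (-β))) := by
          rw [← Real.exp_nat_mul]
          congr 1
          push_cast
          ring
      _ ≤ Real.exp (-2) := by
          refine Real.exp_le_exp.2 (neg_le_neg ?_)
          calc (2 : ℝ) = 2 * Real.exp β * Real.exp (-β) := by
                rw [mul_assoc, ← Real.exp_add]; simp
            _ ≤ _ := by gcongr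
      _ ≤ 1 / 5 := by
          have := Real.exp_one_gt_d9
          have h2 : Real.exp 2 = Real.exp 1 * Real.exp 1 := by rw [← Real.exp_add]; norm_num
          rw [Real.exp_neg, inv_le_comm₀ (Real.exp_pos _) (by norm_num), h2]
          nlinarith
  have hmem : ∀ β > 0, 2 ^ (n β + 2) ∈ {ℓ : ℕ | 1 ≤ ℓ ∧ ∀ A : Finset Site, Separated ℓ A →
      |∫ σ, multispin A σ ∂μ β| ≤ 1 / 5} := fun β hβ =>
    ⟨Nat.one_le_two_pow, fun A hA => abs_integral_multispin_le_of_separated hi hd hB h01 hβ (hμ β hβ) (hn β hβ) A hA⟩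
  constructor
  · refine Asymptotics.IsBigO.of_bound
      (Real.exp (Real.log 2 * (Real.log 2 / Real.log b + 3))) ?_
    filter_upwards [eventually_gt_atTop 0] with β hβ
    rw [Real.norm_of_nonneg (Nat.cast_nonneg _), Real.norm_of_nonneg (Real.exp_pos _).le,
      ← Real.exp_add]
    have h1 : (multispinScale (μ β) : ℝ) ≤ 2 ^ (n β + 2) := by
      exact_mod_cast Nat.sInf_le (hmem β hβ)
    refine h1.trans ?_
    rw [h2pow]
    refine Real.exp_le_exp.2 ?_
    have h2 : (n β : ℝ) < (β + Real.log 2) / Real.log b + 1 :=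
      Nat.ceil_lt_add_one (by positivity)
    push_cast
    calc ((n β : ℝ) + 2) * Real.log 2 ≤ ((β + Real.log 2) / Real.log b + 1 + 2) * Real.log 2 := by
          gcongr
      _ = _ := by ring
  · refine Asymptotics.IsBigO.of_bound
      (2 * Real.exp (-(Real.log 2 / Real.log b * Real.log (2 / 5)))) ?_
    filter_upwards [eventually_gt_atTop 0] with β hβ
    rw [Real.norm_of_nonneg (Nat.cast_nonneg _), Real.norm_of_nonneg (Real.exp_pos _).le]
    obtain ⟨hL1, hL2⟩ := Nat.sInf_mem ⟨_, hmem β hβ⟩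
    change 1 ≤ multispinScale (μ β) at hL1
    set L := multispinScale (μ β) with hL
    change ∀ A : Finset Site, Separated L A → |∫ σ, multispin A σ ∂μ β| ≤ 1 / 5 at hL2
    -- the least order for which the dilated plaquette is `L`-separated
    set m := Nat.clog 2 L with hm
    have hm1 : L ≤ 2 ^ m := Nat.le_pow_clog one_lt_two L
    have hm2 : 2 ^ m ≤ 2 * L := by
      rcases Nat.eq_zero_or_pos m with h0 | h0
      · rw [h0]; omega
      · have h3 : 2 ^ (m - 1) < L := by
          refine Nat.pow_pred_clog_lt_self one_lt_two ?_
          by_contra hcon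
          have : L = 1 := by omega
          rw [hm, this] at h0
          simp at h0
        have h4 : 2 ^ m = 2 * 2 ^ (m - 1) := by
          rw [← pow_succ', Nat.sub_add_cancel h0]
        omega
    have hsep : Separated L (B.image fun c => 2 ^ m • c) := by
      obtain ⟨h1, h2⟩ := separated_image_smul hB (2 ^ m)
      exact ⟨h1, fun x hx y hy hxy => hm1.trans (h2 x hx y hy hxy)⟩
    have h1 := hL2 _ hsep
    rw [(hμ β hβ).integral_multispin_of_isBoundary hd hB hβ (isBoundary_sierpinski h01 m),
      card_sierpinski h01, abs_of_pos (pow_pos (tanh_half_pos hβ) _)] at h1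
    have h2 := (one_sub_le_tanh_half_pow hβ (B.card ^ m)).trans h1
    push_cast at h2
    rw [← hb_def] at h2
    have h3 : 2 / 5 * Real.exp β ≤ b ^ m := by
      have h4 : 2 / 5 ≤ b ^ m * Real.exp (-β) := by linarith
      rw [Real.exp_neg, ← div_eq_mul_inv, le_div_iff₀ (Real.exp_pos _)] at h4
      exact h4
    have h4 : Real.log (2 / 5) + β ≤ m * Real.log b := by
      rw [← Real.exp_le_exp, Real.exp_add, Real.exp_log (by norm_num), ← hbpow]
      exact h3
    have h5 : Real.log 2 / Real.log b * β + Real.log 2 / Real.log b * Real.log (2 / 5) ≤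
        m * Real.log 2 := by
      rw [← mul_add, div_mul_eq_mul_div, div_le_iff₀ hlog]
      nlinarith
    have h6 : Real.exp (Real.log 2 / Real.log b * β + Real.log 2 / Real.log b * Real.log (2 / 5)) ≤
        2 * L := by
      refine (Real.exp_le_exp.2 h5).trans ?_
      rw [← h2pow]
      exact_mod_cast hm2
    rw [Real.exp_add] at h6
    rw [Real.exp_neg, mul_right_comm, ← div_eq_mul_inv, le_div_iff₀ (Real.exp_pos _)]
    exact h6

/-! ### Griffiths inequalities on finite groups -/

/-- A sign as a real number. -/
def sgn (u : ℤˣ) : ℝ := ((u : ℤ) : ℝ)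

@[simp] theorem sgn_one : sgn 1 = 1 := by simp [sgn]

@[simp] theorem sgn_neg_one : sgn (-1) = -1 := by simp [sgn]

theorem sgn_mul (u v : ℤˣ) : sgn (u * v) = sgn u * sgn v := by simp [sgn]

theorem sgn_eq_or (u : ℤˣ) : sgn u = 1 ∨ sgn u = -1 := by
  rcases Int.units_eq_one_or u with rfl | rfl <;> simp

theorem sgn_mul_self (u : ℤˣ) : sgn u * sgn u = 1 := by
  rcases sgn_eq_or u with h | h <;> simp [h]

section Griffiths

variable {G ι : Type*} [CommGroup G]

/-- The functions on a group that are linear combinations with nonnegative coefficients of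
characters with values `±1`. -/
inductive PosType : (G → ℝ) → Prop
  | character (χ : G →* ℤˣ) : PosType fun g => sgn (χ g)
  | add {f f' : G → ℝ} : PosType f → PosType f' → PosType fun g => f g + f' g
  | const_mul {c : ℝ} {f : G → ℝ} : 0 ≤ c → PosType f → PosType fun g => c * f g

namespace PosType

theorem const {c : ℝ} (hc : 0 ≤ c) : PosType fun _ : G => c := by
  simpa using const_mul hc (character (1 : G →* ℤˣ))

theorem character_mul (χ : G →* ℤˣ) {f : G → ℝ} (hf : PosType f) :
    PosType fun g => sgn (χ g) * f g := by
  induction hf with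
  | character χ' => simpa [sgn_mul] using character (χ * χ')
  | add _ _ ih ih' => simpa [mul_add] using add ih ih'
  | const_mul hc _ ih => simpa [mul_left_comm] using const_mul hc ih

theorem mul {f f' : G → ℝ} (hf : PosType f) (hf' : PosType f') :
    PosType fun g => f g * f' g := by
  induction hf with
  | character χ => exact character_mul χ hf'
  | add _ _ ih ih' => simpa [add_mul] using add ih ih'
  | const_mul hc _ ih => simpa [mul_assoc] using const_mul hc ih

theorem prod (S : Finset ι) {f : ι → G → ℝ} (hf : ∀ z ∈ S, PosType (f z)) :
    PosType fun g => ∏ z ∈ S, f z g := by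
  classical
  induction S using Finset.induction_on with
  | empty => simpa using const (G := G) zero_le_one
  | insert z S hz ih =>
    simp_rw [Finset.prod_insert hz]
    exact mul (hf z (Finset.mem_insert_self _ _))
      (ih fun w hw => hf w (Finset.mem_insert_of_mem hw))

theorem prod_sub_prod (S : Finset ι) {f f' : ι → G → ℝ} (hf : ∀ z ∈ S, PosType (f z))
    (hff' : ∀ z ∈ S, PosType fun g => f' z g - f z g) :
    PosType fun g => ∏ z ∈ S, f' z g - ∏ z ∈ S, f z g := by
  classical
  induction S using Finset.induction_on with
  | empty => simpa using const (G := G) le_rfl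
  | insert z S hz ih =>
    have hf' : ∀ w ∈ insert z S, PosType (f' w) := fun w hw => by
      simpa using add (hff' w hw) (hf w hw)
    have h1 := mul (hff' z (Finset.mem_insert_self _ _))
      (prod S fun w hw => hf' w (Finset.mem_insert_of_mem hw))
    have h2 := mul (hf z (Finset.mem_insert_self _ _))
      (ih (fun w hw => hf w (Finset.mem_insert_of_mem hw))
        fun w hw => hff' w (Finset.mem_insert_of_mem hw))
    convert add h1 h2 using 2 with g
    rw [Finset.prod_insert hz, Finset.prod_insert hz]
    ring

theorem exp_character {K : ℝ} (hK : 0 ≤ K) (χ : G →* ℤˣ) :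
    PosType fun g => Real.exp (K * sgn (χ g)) := by
  have h1 := add (const (G := G) (Real.cosh_pos K).le)
    (const_mul (Real.sinh_nonneg_iff.2 hK) (character χ))
  convert h1 using 2 with g
  rw [exp_mul_sign K (sgn_eq_or _), Real.tanh_eq_sinh_div_cosh]
  field_simp [(Real.cosh_pos K).ne']

theorem exp_sum (S : Finset ι) {K : ι → ℝ} (hK : ∀ z ∈ S, 0 ≤ K z) (φ : ι → G →* ℤˣ) :
    PosType fun g => Real.exp (∑ z ∈ S, K z * sgn (φ z g)) := by
  simp_rw [Real.exp_sum]
  exact prod S fun z hz => exp_character (hK z hz) (φ z)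

theorem sum_nonneg [Fintype G] {f : G → ℝ} (hf : PosType f) : 0 ≤ ∑ g, f g := by
  induction hf with
  | character χ =>
    by_cases h : ∃ g₀, χ g₀ = -1
    · obtain ⟨g₀, hg₀⟩ := h
      have := Equiv.sum_comp (Equiv.mulLeft g₀) fun g => sgn (χ g)
      have h1 : ∀ g, sgn (χ (g₀ * g)) = -sgn (χ g) := fun g => by
        rw [map_mul, hg₀, sgn_mul, sgn_neg_one, neg_one_mul]
      simp only [Equiv.coe_mulLeft, h1, Finset.sum_neg_distrib] at this
      change 0 ≤ ∑ g, sgn (χ g)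
      linarith
    · push Not at h
      refine Finset.sum_nonneg fun g _ => ?_
      rw [(Int.units_eq_one_or (χ g)).resolve_right (h g), sgn_one]
      exact zero_le_one
  | add _ _ ih ih' => rw [Finset.sum_add_distrib]; exact add_nonneg ih ih'
  | const_mul hc _ ih => rw [← Finset.mul_sum]; exact mul_nonneg hc ih

end PosType

/-- Comparison with independent signs: if `(f z - c z) exp (K z φ_z)` has nonnegative Fourier
coefficients for `z ∈ F`, then the correlation of the `f z`, `z ∈ F`, is at least `∏ c z`. -/
theorem prod_mul_sum_exp_le [Fintype G] {F S : Finset ι} (hF : F ⊆ S) {K : ι → ℝ}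
    (hK : ∀ z ∈ S, 0 ≤ K z) (φ : ι → G →* ℤˣ) {c : ι → ℝ} (hc : ∀ z ∈ F, 0 ≤ c z)
    {f : ι → G → ℝ}
    (hf : ∀ z ∈ F, PosType fun g => (f z g - c z) * Real.exp (K z * sgn (φ z g))) :
    (∏ z ∈ F, c z) * ∑ g, Real.exp (∑ z ∈ S, K z * sgn (φ z g)) ≤
      ∑ g, (∏ z ∈ F, f z g) * Real.exp (∑ z ∈ S, K z * sgn (φ z g)) := by
  classical
  have h1 := PosType.prod_sub_prod F
    (f := fun z g => c z * Real.exp (K z * sgn (φ z g)))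
    (f' := fun z g => f z g * Real.exp (K z * sgn (φ z g)))
    (fun z hz => PosType.const_mul (hc z hz) (PosType.exp_character (hK z (hF hz)) _))
    (fun z hz => by simpa [sub_mul] using hf z hz)
  have h2 := (h1.mul (PosType.exp_sum (S \ F)
    (fun z hz => hK z (Finset.sdiff_subset hz)) φ)).sum_nonneg
  rw [Finset.mul_sum, ← sub_nonneg, ← Finset.sum_sub_distrib]
  convert h2 using 2 with g
  have h3 : Real.exp (∑ z ∈ S, K z * sgn (φ z g)) =
      (∏ z ∈ F, Real.exp (K z * sgn (φ z g))) *
        Real.exp (∑ z ∈ S \ F, K z * sgn (φ z g)) := by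
    rw [← Real.exp_sum, ← Real.exp_add, add_comm, Finset.sum_sdiff hF]
  rw [h3, Finset.prod_mul_distrib, Finset.prod_mul_distrib]
  ring

/-- Signs with ferromagnetic couplings are at least as correlated as independent ones. -/
theorem prod_tanh_mul_sum_exp_le [Fintype G] {F S : Finset ι} (hF : F ⊆ S) {K : ι → ℝ}
    (hK : ∀ z ∈ S, 0 ≤ K z) (φ : ι → G →* ℤˣ) :
    (∏ z ∈ F, Real.tanh (K z)) * ∑ g, Real.exp (∑ z ∈ S, K z * sgn (φ z g)) ≤
      ∑ g, (∏ z ∈ F, sgn (φ z g)) * Real.exp (∑ z ∈ S, K z * sgn (φ z g)) := by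
  have ht : ∀ z ∈ F, 0 ≤ Real.tanh (K z) := fun z hz => by
    rw [Real.tanh_eq_sinh_div_cosh]
    exact div_nonneg (Real.sinh_nonneg_iff.2 (hK z (hF hz))) (Real.cosh_pos _).le
  refine prod_mul_sum_exp_le hF hK φ ht fun z hz => ?_
  have h1 : 0 ≤ Real.cosh (K z) * (1 - Real.tanh (K z) ^ 2) :=
    mul_nonneg (Real.cosh_pos _).le (by nlinarith [ht z hz, Real.tanh_lt_one (K z)])
  convert PosType.const_mul h1 (PosType.character (φ z)) using 2 with g
  rw [exp_mul_sign _ (sgn_eq_or _)]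
  linear_combination (Real.cosh (K z) * Real.tanh (K z)) * sgn_mul_self (φ z g)

/-- The probability that all signs in `F` are positive is at least that for independent signs. -/
theorem prod_half_mul_sum_exp_le [Fintype G] {F S : Finset ι} (hF : F ⊆ S) {J : ℝ}
    (hJ : 0 ≤ J) (φ : ι → G →* ℤˣ) :
    ((1 + Real.tanh J) / 2) ^ F.card * ∑ g, Real.exp (∑ z ∈ S, J * sgn (φ z g)) ≤
      ∑ g, (∏ z ∈ F, (1 + sgn (φ z g)) / 2) * Real.exp (∑ z ∈ S, J * sgn (φ z g)) := by
  have ht : 0 ≤ Real.tanh J := by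
    rw [Real.tanh_eq_sinh_div_cosh]
    exact div_nonneg (Real.sinh_nonneg_iff.2 hJ) (Real.cosh_pos _).le
  rw [← Finset.prod_const]
  refine prod_mul_sum_exp_le hF (K := fun _ => J) (fun _ _ => hJ) φ (fun _ _ => by positivity)
    fun z hz => ?_
  have h1 : 0 ≤ Real.cosh J * (1 - Real.tanh J ^ 2) / 2 :=
    div_nonneg (mul_nonneg (Real.cosh_pos _).le (by nlinarith [Real.tanh_lt_one J])) (by norm_num)
  convert PosType.const_mul h1 (PosType.character (φ z)) using 2 with g
  rw [exp_mul_sign _ (sgn_eq_or _)]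
  linear_combination (Real.cosh J * Real.tanh J / 2) * sgn_mul_self (φ z g)

/-- A quantitative second Griffiths inequality: a lower bound on the covariance of two signs `φ_p`
and `φ_q` whose product is the product of the signs in `F'`, by means of an element `s` that
reverses `φ_q`, no sign in `F'`, and few other signs. -/
theorem le_covariance [Fintype G] [DecidableEq ι] {S F' D : Finset ι} {p q : ι} {J : ℝ} (hJ : 0 ≤ J)
    (φ : ι → G →* ℤˣ) (hpq : p ≠ q) (hp : p ∉ F') (hq : q ∉ F')
    (hF : insert p (insert q F') ⊆ S)
    (hcycle : ∀ g, φ p g * φ q g = ∏ z ∈ F', φ z g) {s : G}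
    (hsq : φ q s = -1) (hsF : ∀ z ∈ F', φ z s = 1) (hD : ∀ z ∈ S, z ∉ D → φ z s = 1)
    (w : G → ℝ) (hw : ∀ g, w g = Real.exp (∑ z ∈ S, J * sgn (φ z g))) :
    2 * Real.tanh (2 * J) ^ F'.card * Real.exp (-(2 * J * D.card)) *
        (((1 + Real.tanh J) / 2) ^ (F'.card + 2) * ∑ g, w g) ^ 2 ≤
      (∑ g, sgn (φ p g) * sgn (φ q g) * w g) * ∑ g, w g -
        (∑ g, sgn (φ p g) * w g) * ∑ g, sgn (φ q g) * w g := by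
  classical
  set F := insert p (insert q F') with hF_def
  have hF' : F' ⊆ S := fun z hz => hF (Finset.mem_insert_of_mem (Finset.mem_insert_of_mem hz))
  have hFcard : F.card = F'.card + 2 := by
    rw [Finset.card_insert_of_notMem, Finset.card_insert_of_notMem hq]
    simp [hpq, hp]
  -- the covariance, as a sum over pairs `(g, h * g)`
  have hcov : (∑ g, sgn (φ p g) * sgn (φ q g) * w g) * ∑ g, w g -
      (∑ g, sgn (φ p g) * w g) * ∑ g, sgn (φ q g) * w g =
      ∑ h, (1 - sgn (φ q h)) * ∑ g, sgn (φ p g) * sgn (φ q g) * (w g * w (h * g)) := by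
    rw [Finset.sum_mul_sum, Finset.sum_mul_sum, ← Finset.sum_sub_distrib]
    simp_rw [← Finset.sum_sub_distrib, Finset.mul_sum]
    rw [Finset.sum_comm (s := (Finset.univ : Finset G)) (f := fun h g => (1 - sgn (φ q h)) *
      (sgn (φ p g) * sgn (φ q g) * (w g * w (h * g))))]
    refine Finset.sum_congr rfl fun g _ => ?_
    rw [← Equiv.sum_comp (Equiv.mulRight g)]
    refine Finset.sum_congr rfl fun h _ => ?_
    simp only [Equiv.coe_mulRight, map_mul, sgn_mul]
    ring
  have hww : ∀ g h, w g * w (h * g) =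
      Real.exp (∑ z ∈ S, J * (1 + sgn (φ z h)) * sgn (φ z g)) := by
    intro g h
    rw [hw, hw, ← Real.exp_add, ← Finset.sum_add_distrib]
    congr 1
    refine Finset.sum_congr rfl fun z _ => ?_
    rw [map_mul, sgn_mul]
    ring
  have hone : ∀ z h, 0 ≤ 1 + sgn (φ z h) := fun z h => by
    rcases sgn_eq_or (φ z h) with h | h <;> rw [h] <;> norm_num
  have hK : ∀ h, ∀ z ∈ S, 0 ≤ J * (1 + sgn (φ z h)) := fun h z _ => mul_nonneg hJ (hone z h)
  have hcyc : ∀ g, sgn (φ p g) * sgn (φ q g) = ∏ z ∈ F', sgn (φ z g) := by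
    intro g
    rw [← sgn_mul, hcycle]
    unfold sgn
    push_cast
    rfl
  -- the inner sums are nonnegative, and large for `h` with `φ_p h = φ_q h = -1` and `φ_z h = 1`
  -- for the other `z`
  set T : Finset G := Finset.univ.filter fun h => φ q h = -1 ∧ ∀ z ∈ F', φ z h = 1 with hT_def
  have hinner : ∀ h, 0 ≤ ∑ g, sgn (φ p g) * sgn (φ q g) * (w g * w (h * g)) := by
    intro h
    simp_rw [hww]
    exact ((PosType.character (φ p)).mul (PosType.character (φ q))).mul
      (PosType.exp_sum S (hK h) φ) |>.sum_nonneg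
  have hT : ∀ h ∈ T, Real.tanh (2 * J) ^ F'.card * ∑ g, w g * w (h * g) ≤
      ∑ g, sgn (φ p g) * sgn (φ q g) * (w g * w (h * g)) := by
    intro h hh
    have h1 := prod_tanh_mul_sum_exp_le hF' (hK h) φ
    simp_rw [← hww, ← hcyc] at h1
    convert h1 using 2
    rw [← Finset.prod_const]
    refine Finset.prod_congr rfl fun z hz => ?_
    rw [(Finset.mem_filter.1 hh).2.2 z hz, sgn_one]
    congr 1
    ring
  have ht2 : 0 ≤ Real.tanh (2 * J) := by
    rw [Real.tanh_eq_sinh_div_cosh]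
    exact div_nonneg (Real.sinh_nonneg_iff.2 (by linarith)) (Real.cosh_pos _).le
  have hwpos : ∀ g, 0 < w g := fun g => by rw [hw]; exact Real.exp_pos _
  have hstep1 : ∑ h ∈ T, 2 * (Real.tanh (2 * J) ^ F'.card * ∑ g, w g * w (h * g)) ≤
      ∑ h, (1 - sgn (φ q h)) * ∑ g, sgn (φ p g) * sgn (φ q g) * (w g * w (h * g)) := by
    refine (Finset.sum_le_sum fun h hh => ?_).trans
      (Finset.sum_le_sum_of_subset_of_nonneg (Finset.subset_univ T) fun h _ _ => ?_)
    · rw [(Finset.mem_filter.1 hh).2.1, sgn_neg_one, sub_neg_eq_add, one_add_one_eq_two]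
      exact mul_le_mul_of_nonneg_left (hT h hh) (by norm_num)
    · refine mul_nonneg ?_ (hinner h)
      rcases sgn_eq_or (φ q h) with h | h <;> rw [h] <;> norm_num
  -- the configurations without negative signs in `F`
  set P : Finset G := Finset.univ.filter fun g => ∀ z ∈ F, φ z g = 1 with hP_def
  have hprodP : ∀ g, (∏ z ∈ F, (1 + sgn (φ z g)) / 2) = if g ∈ P then 1 else 0 := by
    intro g
    split_ifs with hg
    · refine Finset.prod_eq_one fun z hz => ?_
      rw [(Finset.mem_filter.1 hg).2 z hz, sgn_one]
      norm_num
    · have : ∃ z ∈ F, φ z g ≠ 1 := by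
        by_contra hcon
        push Not at hcon
        exact hg (Finset.mem_filter.2 ⟨Finset.mem_univ _, hcon⟩)
      obtain ⟨z, hz, hzg⟩ := this
      refine Finset.prod_eq_zero hz ?_
      rw [(Int.units_eq_one_or (φ z g)).resolve_left hzg, sgn_neg_one]
      norm_num
  have hPsum : ((1 + Real.tanh J) / 2) ^ (F'.card + 2) * ∑ g, w g ≤ ∑ g ∈ P, w g := by
    have h1 := prod_half_mul_sum_exp_le hF hJ φ
    simp_rw [← hw, hprodP, ite_mul, one_mul, zero_mul] at h1
    rwa [hFcard, Finset.sum_ite_mem, Finset.univ_inter] at h1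
  have hws : ∀ g, Real.exp (-(2 * J * D.card)) * w g ≤ w (s * g) := by
    intro g
    rw [hw, hw, ← Real.exp_add]
    refine Real.exp_le_exp.2 ?_
    have h1 : ∀ z ∈ S, J * sgn (φ z g) - J * sgn (φ z (s * g)) ≤ if z ∈ D then 2 * J else 0 := by
      intro z hz
      rw [map_mul, sgn_mul]
      split_ifs with hzD
      · rcases sgn_eq_or (φ z g) with h | h <;> rcases sgn_eq_or (φ z s) with h' | h' <;>
          rw [h, h'] <;> linarith
      · rw [hD z hz hzD, sgn_one]
        linarith
    have h2 := Finset.sum_le_sum h1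
    rw [Finset.sum_sub_distrib, Finset.sum_ite_mem, Finset.sum_const, nsmul_eq_mul] at h2
    have h3 : ((S ∩ D).card : ℝ) ≤ D.card := by
      exact_mod_cast Finset.card_le_card Finset.inter_subset_right
    nlinarith
  have hstep2 : Real.exp (-(2 * J * D.card)) * (∑ g ∈ P, w g) ^ 2 ≤
      ∑ h ∈ T, ∑ g, w g * w (h * g) := by
    have e1 : ∑ h ∈ T, ∑ g, w g * w (h * g) =
        ∑ g, ∑ h, if h * g⁻¹ ∈ T then w g * w h else 0 := by
      rw [Finset.sum_comm]
      refine Finset.sum_congr rfl fun g _ => ?_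
      rw [← Equiv.sum_comp (Equiv.mulRight g)]
      simp only [Equiv.coe_mulRight, mul_inv_cancel_right]
      rw [Finset.sum_ite_mem, Finset.univ_inter]
    rw [e1, ← Equiv.sum_comp (Equiv.mulLeft s)]
    simp only [Equiv.coe_mulLeft]
    calc Real.exp (-(2 * J * D.card)) * (∑ g ∈ P, w g) ^ 2
        = ∑ g ∈ P, ∑ h ∈ P, Real.exp (-(2 * J * D.card)) * w g * w h := by
          rw [sq, Finset.sum_mul_sum, Finset.mul_sum]
          refine Finset.sum_congr rfl fun g _ => ?_
          rw [Finset.mul_sum]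
          exact Finset.sum_congr rfl fun h _ => by ring
      _ ≤ ∑ g ∈ P, ∑ h ∈ P, if h * (s * g)⁻¹ ∈ T then w (s * g) * w h else 0 := by
          refine Finset.sum_le_sum fun g hg => Finset.sum_le_sum fun h hh => ?_
          rw [if_pos]
          · exact mul_le_mul_of_nonneg_right (hws g) (hwpos h).le
          · have hg' := (Finset.mem_filter.1 hg).2
            have hh' := (Finset.mem_filter.1 hh).2
            have hqF : q ∈ F := by simp [hF_def]
            refine Finset.mem_filter.2 ⟨Finset.mem_univ _, ?_, fun z hz => ?_⟩
            · simp [hg' q hqF, hh' q hqF, hsq]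
            · have hzF : z ∈ F := by simp [hF_def, hz]
              simp [hg' z hzF, hh' z hzF, hsF z hz]
      _ ≤ ∑ g, ∑ h, if h * (s * g)⁻¹ ∈ T then w (s * g) * w h else 0 := by
          have hnn : ∀ g h, 0 ≤ if h * (s * g)⁻¹ ∈ T then w (s * g) * w h else 0 := by
            intro g h
            split_ifs
            · exact mul_nonneg (hwpos _).le (hwpos _).le
            · exact le_rfl
          refine (Finset.sum_le_sum fun g _ => Finset.sum_le_sum_of_subset_of_nonneg
            (Finset.subset_univ P) fun h _ _ => hnn g h).trans ?_
          exact Finset.sum_le_sum_of_subset_of_nonneg (Finset.subset_univ P)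
            fun g _ _ => Finset.sum_nonneg fun h _ => hnn g h
  have hpos : 0 ≤ ((1 + Real.tanh J) / 2) ^ (F'.card + 2) * ∑ g, w g := by
    have : -1 < Real.tanh J := Real.neg_one_lt_tanh J
    exact mul_nonneg (pow_nonneg (by linarith) _) (Finset.sum_nonneg fun g _ => (hwpos g).le)
  rw [hcov]
  refine le_trans ?_ hstep1
  rw [← Finset.mul_sum, ← Finset.mul_sum, mul_assoc, mul_assoc]
  refine mul_le_mul_of_nonneg_left (mul_le_mul_of_nonneg_left ?_ (pow_nonneg ht2 _)) (by norm_num)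
  refine le_trans ?_ hstep2
  exact mul_le_mul_of_nonneg_left (pow_le_pow_left₀ hpos hPsum 2) (Real.exp_pos _).le

end Griffiths

/-! ### Plus boundary conditions and the lower bound on the cavity scale -/

theorem multispin_eq_sgn (A : Finset Site) (σ : Config) : multispin A σ = sgn (∏ x ∈ A, σ x) := rfl

theorem glue_mul (Λ : Finset Site) (η η' : Λ → ℤˣ) :
    glue Λ (η * η') 1 = glue Λ η 1 * glue Λ η' 1 := by
  funext x
  by_cases hx : x ∈ Λ
  · rw [Pi.mul_apply, glue_of_mem hx, glue_of_mem hx, glue_of_mem hx, Pi.mul_apply]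
  · rw [Pi.mul_apply, glue_of_notMem hx, glue_of_notMem hx, glue_of_notMem hx]
    rfl

/-- With plus boundary conditions a multispin is a character of the group of spin configurations. -/
def spinHom (Λ A : Finset Site) : (Λ → ℤˣ) →* ℤˣ where
  toFun η := ∏ x ∈ A, glue Λ η 1 x
  map_one' := Finset.prod_eq_one fun x _ => by
    by_cases hx : x ∈ Λ
    · rw [glue_of_mem hx]; rfl
    · rw [glue_of_notMem hx]; rfl
  map_mul' η η' := by
    simp only [glue_mul, Pi.mul_apply, Finset.prod_mul_distrib]

theorem multispin_glue_one_inter (Λ A : Finset Site) (η : Λ → ℤˣ) :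
    multispin A (glue Λ η 1) = multispin (A ∩ Λ) (glue Λ η 1) := by
  rw [multispin_eq_sgn, multispin_eq_sgn]
  congr 1
  refine (Finset.prod_subset Finset.inter_subset_left fun x hx hx' => ?_).symm
  rw [glue_of_notMem fun h => hx' (Finset.mem_inter.2 ⟨hx, h⟩)]
  rfl

theorem weight_glue_one {B : Finset Site} (hB : B.Nonempty) (β : ℝ) (Λ : Finset Site)
    (η : Λ → ℤˣ) : weight B β Λ (glue Λ η 1) =
      Real.exp (∑ z ∈ positions B Λ, β / 2 * sgn (spinHom Λ (translate B z) η)) :=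
  weight_eq_exp hB β Λ _

/-- With plus boundary conditions, the expectation of a product of plaquette variables is at least
that for independent variables. -/
theorem tanh_pow_le_gibbsExp {B : Finset Site} (hB : B.Nonempty) {β : ℝ} (hβ : 0 < β)
    {Λ F A : Finset Site} (h : IsBoundary B F A) :
    Real.tanh (β / 2) ^ F.card ≤ gibbsExp B β Λ 1 (multispin (A ∩ Λ)) := by
  set F' := F ∩ positions B Λ
  have hprod : ∀ η : Λ → ℤˣ, multispin (A ∩ Λ) (glue Λ η 1) =
      ∏ z ∈ F', sgn (spinHom Λ (translate B z) η) := by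
    intro η
    rw [← multispin_glue_one_inter, ← h.plaqProd_eq, plaqProd]
    refine (Finset.prod_subset Finset.inter_subset_left fun z hz hz' => ?_).symm
    rw [multispin_glue_one_inter]
    have : translate B z ∩ Λ = ∅ := by
      refine Finset.eq_empty_of_forall_notMem fun x hx => ?_
      rw [Finset.mem_inter] at hx
      exact hz' (Finset.mem_inter.2 ⟨hz, mem_positions.2 ⟨x, hx.2, hx.1⟩⟩)
    rw [this]
    simp [multispin]
  have ht := tanh_half_pos hβ
  have h1 := prod_tanh_mul_sum_exp_le (Finset.inter_subset_right : F' ⊆ positions B Λ)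
    (K := fun _ => β / 2) (fun _ _ => by positivity) fun z => spinHom Λ (translate B z)
  rw [Finset.prod_const] at h1
  refine (pow_le_pow_of_le_one ht.le (Real.tanh_lt_one _).le
    (Finset.card_le_card (show F' ⊆ F from Finset.inter_subset_left))).trans ?_
  rw [gibbsExp, le_div_iff₀ (partitionFunction_pos _ _ _ _), partitionFunction]
  simp_rw [hprod, weight_glue_one hB]
  exact h1

theorem tvMarginal_le_one (B : Finset Site) (β : ℝ) (V Λ : Finset Site) (τ τ' : Config) :
    tvMarginal B β V Λ τ τ' ≤ 1 := by
  refine ciSup_le fun S => ?_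
  rw [abs_le]
  have h1 := gibbsProb_nonneg B β Λ τ {σ | (fun x : V => σ x) ∈ S}
  have h2 := gibbsProb_le_one B β Λ τ {σ | (fun x : V => σ x) ∈ S}
  have h3 := gibbsProb_nonneg B β Λ τ' {σ | (fun x : V => σ x) ∈ S}
  have h4 := gibbsProb_le_one B β Λ τ' {σ | (fun x : V => σ x) ∈ S}
  constructor <;> linarith

theorem le_tvMarginal (B : Finset Site) (β : ℝ) {V Λ : Finset Site} (τ τ' : Config)
    (S : Set (V → ℤˣ)) :
    |gibbsProb B β Λ τ {σ | (fun x : V => σ x) ∈ S} -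
      gibbsProb B β Λ τ' {σ | (fun x : V => σ x) ∈ S}| ≤ tvMarginal B β V Λ τ τ' := by
  refine le_ciSup (f := fun S : Set (V → ℤˣ) =>
    |gibbsProb B β Λ τ {σ | (fun x : V => σ x) ∈ S} -
      gibbsProb B β Λ τ' {σ | (fun x : V => σ x) ∈ S}|) ⟨1, ?_⟩ S
  rintro _ ⟨S, rfl⟩
  rw [abs_le]
  have h1 := gibbsProb_nonneg B β Λ τ {σ | (fun x : V => σ x) ∈ S}
  have h2 := gibbsProb_le_one B β Λ τ {σ | (fun x : V => σ x) ∈ S}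
  have h3 := gibbsProb_nonneg B β Λ τ' {σ | (fun x : V => σ x) ∈ S}
  have h4 := gibbsProb_le_one B β Λ τ' {σ | (fun x : V => σ x) ∈ S}
  constructor <;> linarith

theorem tvMarginal_le_psi (B : Finset Site) (β : ℝ) (ℓ : ℕ) (τ τ' : Config) :
    tvMarginal B β (centredSquare ℓ) (centredSquare (10 * ℓ)) τ τ' ≤ psi B β ℓ :=
  le_ciSup (f := fun p : Config × Config =>
    tvMarginal B β (centredSquare ℓ) (centredSquare (10 * ℓ)) p.1 p.2)
    ⟨1, by rintro _ ⟨p, rfl⟩; exact tvMarginal_le_one _ _ _ _ _ _⟩ (τ, τ')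

/-- Flipping the spins along a configuration `ζ` without negative plaquettes changes the sign of
the expectation of a multispin, which therefore is a lower bound for the influence of the boundary
condition. -/
theorem tanh_pow_le_psi {B : Finset Site} (hB : B.Nonempty) {β : ℝ} (hβ : 0 < β) {ℓ : ℕ}
    {F A A' : Finset Site} (h : IsBoundary B F A') (hA' : A' ∩ centredSquare (10 * ℓ) = A)
    (hA : A ⊆ centredSquare ℓ) {ζ : Config} (hζ : ∀ z, multispin (translate B z) ζ = 1)
    (hζA : multispin A ζ = -1) : Real.tanh (β / 2) ^ F.card ≤ psi B β ℓ := by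
  set V := centredSquare ℓ
  set Λ := centredSquare (10 * ℓ)
  let S : Set (V → ℤˣ) := {ξ | multispin A (glue V ξ 1) = 1}
  have hS : {σ : Config | (fun x : V => σ x) ∈ S} = {σ | multispin A σ = 1} := by
    ext σ
    change multispin A (glue V (fun x : V => σ x) 1) = 1 ↔ multispin A σ = 1
    rw [multispin_congr fun x hx => glue_of_mem (hA hx) (fun x : V => σ x) 1]
  have h1 := tanh_pow_le_gibbsExp hB hβ (Λ := Λ) h
  rw [hA'] at h1
  have h2 : gibbsExp B β Λ (1 * ζ) (multispin A) = -gibbsExp B β Λ 1 (multispin A) := by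
    rw [gibbsExp_mul_of_invariant hB β _ (fun z _ => hζ z), ← neg_one_mul, ← gibbsExp_const_mul]
    simp_rw [multispin_mul, hζA]
    congr 1
    funext σ
    ring
  have h3 := le_tvMarginal B β (Λ := Λ) 1 (1 * ζ) S
  rw [hS] at h3
  rw [gibbsExp_multispin, gibbsExp_multispin] at h2
  rw [gibbsExp_multispin] at h1
  refine le_trans ?_ (h3.trans (tvMarginal_le_psi B β ℓ 1 (1 * ζ)))
  refine le_trans ?_ (le_abs_self _)
  linarith

theorem lt_cavityScale {B : Finset Site} {β : ℝ}
    (hne : {ℓ : ℕ | 1 ≤ ℓ ∧ ∀ ℓ' : ℕ, ℓ ≤ ℓ' → psi B β ℓ' ≤ 1 / 10}.Nonempty) {ℓ : ℕ}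
    (h : 1 / 10 < psi B β ℓ) : ℓ < cavityScale B β := by
  by_contra hcon
  exact absurd ((Nat.sInf_mem hne).2 ℓ (not_lt.1 hcon)) (not_le.2 h)

theorem multispin_translate (B : Finset Site) (z : Site) (σ : Config) :
    multispin (translate B z) σ = sgn (∏ b ∈ B, σ (b + z)) := by
  rw [multispin_eq_sgn, translate, Finset.prod_image fun a _ b _ h => add_left_injective z h]

theorem tanh_pow_le_psi_spm {β : ℝ} (hβ : 0 < β) {ℓ : ℕ} (hℓ : 2 ≤ ℓ) :
    Real.tanh (β / 2) ^ (5 * ℓ + 1) ≤ psi spm β ℓ := by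
  -- a half column of plaquettes, whose boundary in the large square consists of two sites
  let F : Finset Site := {0} ×ˢ Finset.Icc 0 (5 * ℓ : ℤ)
  have hF : F.card = 5 * ℓ + 1 := by
    rw [Finset.card_product, Finset.card_singleton, one_mul, Int.card_Icc]
    omega
  have hmem : ∀ x : Site, x ∈ F ↔ x.1 = 0 ∧ 0 ≤ x.2 ∧ x.2 ≤ 5 * ℓ := fun x => by
    rw [Finset.mem_product, Finset.mem_singleton, Finset.mem_Icc]
  rw [← hF]
  refine tanh_pow_le_psi (A' := {(0, 0), (1, 0), (0, 5 * (ℓ : ℤ) + 1), (1, 5 * (ℓ : ℤ) + 1)})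
    (A := {(0, 0), (1, 0)}) (ζ := fun x => if x.1 ≤ 0 then -1 else 1) spm_nonempty hβ ?_ ?_ ?_ ?_ ?_
  · rw [isBoundary_iff]
    funext x
    simp only [conv, sum_spm, ind, hmem, Prod.ext_iff, Finset.mem_insert, Finset.mem_singleton,
      Prod.fst_sub, Prod.snd_sub, smul_fst_snd]
    obtain ⟨x, y⟩ := x
    simp only [Nat.cast_one, mul_zero, mul_one, sub_zero]
    split_ifs <;> first | omega | decide
  · ext x
    simp only [Finset.mem_inter, Finset.mem_insert, Finset.mem_singleton, mem_centredSquare,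
      Prod.ext_iff]
    omega
  · intro x hx
    simp only [Finset.mem_insert, Finset.mem_singleton, Prod.ext_iff] at hx
    rw [mem_centredSquare]
    omega
  · intro z
    have : ∏ b ∈ spm, (if (b + z).1 ≤ 0 then -1 else 1 : ℤˣ) = 1 := by
      simp only [spm]
      rw [Finset.prod_insert (by decide), Finset.prod_insert (by decide),
        Finset.prod_insert (by decide), Finset.prod_singleton]
      simp only [Prod.fst_add, zero_add]
      split_ifs <;> simp
    rw [multispin_translate, this, sgn_one]
  · simp [multispin]

/-- The boundary of the Sierpinski set of order `n` is a dilated plaquette, of which only the corner at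
the origin lies in the large square if `5 ℓ < 2^n`. -/
theorem tanh_pow_le_psi_tpm {β : ℝ} (hβ : 0 < β) {ℓ n : ℕ} (hn : 5 * ℓ < 2 ^ n) :
    Real.tanh (β / 2) ^ 3 ^ n ≤ psi tpm β ℓ := by
  rw [← card_tpm, ← card_sierpinski isUnit01_tpm]
  refine tanh_pow_le_psi (A := {(0, 0)})
    (ζ := fun x => if (x.1 + x.2) % 3 = 1 then 1 else -1) tpm_nonempty hβ
    (isBoundary_sierpinski isUnit01_tpm n) ?_ ?_ ?_ ?_
  · ext x
    have hn' : (5 * ℓ : ℤ) < 2 ^ n := by exact_mod_cast hn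
    simp only [tpm, Finset.image_insert, Finset.image_singleton, Finset.mem_inter,
      Finset.mem_insert, Finset.mem_singleton, mem_centredSquare, Prod.ext_iff, smul_fst_snd]
    push_cast
    simp only [mul_zero, mul_one]
    omega
  · intro x hx
    rw [Finset.mem_singleton.1 hx, mem_centredSquare]
    dsimp only
    omega
  · intro z
    have : ∏ b ∈ tpm, (if ((b + z).1 + (b + z).2) % 3 = 1 then 1 else -1 : ℤˣ) = 1 := by
      simp only [tpm]
      rw [Finset.prod_insert (by decide), Finset.prod_insert (by decide), Finset.prod_singleton]
      simp only [Prod.fst_add, Prod.snd_add, zero_add]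
      split_ifs <;> first | omega | simp
    rw [multispin_translate, this, sgn_one]
  · simp [multispin]

theorem exp_isBigO_cavityScale_spm
    (hne : ∀ᶠ β in atTop, {ℓ : ℕ | 1 ≤ ℓ ∧ ∀ ℓ' : ℕ, ℓ ≤ ℓ' → psi spm β ℓ' ≤ 1 / 10}.Nonempty) :
    (fun β : ℝ => Real.exp β) =O[atTop] fun β : ℝ => (cavityScale spm β : ℝ) := by
  refine Asymptotics.IsBigO.of_bound 20 ?_
  filter_upwards [hne, eventually_gt_atTop 0,
    Real.tendsto_exp_atTop.eventually_ge_atTop 40] with β hβ hβ0 hβ1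
  rw [Real.norm_of_nonneg (Nat.cast_nonneg _), Real.norm_of_nonneg (Real.exp_pos _).le]
  -- the half column has `5 ℓ + 1 ≤ 2 e^β / 5` plaquettes, so that `t^{5 ℓ + 1} ≥ 1 / 5 > 1 / 10`
  set ℓ := ⌊Real.exp β / 20⌋₊
  have h1 : (ℓ : ℝ) ≤ Real.exp β / 20 := Nat.floor_le (by positivity)
  have h2 : Real.exp β / 20 < ℓ + 1 := Nat.lt_floor_add_one _
  have h3 : 2 ≤ ℓ := Nat.le_floor (by push_cast; linarith)
  have h4 : ℓ < cavityScale spm β := by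
    refine lt_cavityScale hβ (lt_of_lt_of_le ?_ (tanh_pow_le_psi_spm hβ0 h3))
    refine lt_of_lt_of_le ?_ (one_sub_le_tanh_half_pow hβ0 _)
    push_cast
    have h5 : (5 * (ℓ : ℝ) + 1) ≤ 2 / 5 * Real.exp β := by linarith
    have h6 : Real.exp β * Real.exp (-β) = 1 := by rw [← Real.exp_add]; simp
    have h7 := Real.exp_pos (-β)
    nlinarith
  have h5 : (ℓ : ℝ) + 1 ≤ cavityScale spm β := by exact_mod_cast h4
  linarith

theorem exp_isBigO_cavityScale_tpm
    (hne : ∀ᶠ β in atTop, {ℓ : ℕ | 1 ≤ ℓ ∧ ∀ ℓ' : ℕ, ℓ ≤ ℓ' → psi tpm β ℓ' ≤ 1 / 10}.Nonempty) :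
    (fun β : ℝ => Real.exp (Real.log 2 / Real.log 3 * β)) =O[atTop]
      fun β : ℝ => (cavityScale tpm β : ℝ) := by
  have hl2 : 0 < Real.log 2 := Real.log_pos one_lt_two
  have hl3 : 0 < Real.log 3 := Real.log_pos (by norm_num)
  refine Asymptotics.IsBigO.of_bound
    (5 * Real.exp (Real.log 2 * (1 - Real.log (2 / 5) / Real.log 3))) ?_
  filter_upwards [hne, eventually_gt_atTop 0,
    eventually_ge_atTop (-Real.log (2 / 5))] with β hβ hβ0 hβ1
  rw [Real.norm_of_nonneg (Nat.cast_nonneg _), Real.norm_of_nonneg (Real.exp_pos _).le]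
  -- the order at which the Sierpinski set has about `2 e^β / 5` plaquettes
  set n := ⌊(β + Real.log (2 / 5)) / Real.log 3⌋₊
  have h1 : (n : ℝ) ≤ (β + Real.log (2 / 5)) / Real.log 3 :=
    Nat.floor_le (div_nonneg (by linarith) hl3.le)
  have h2 : (β + Real.log (2 / 5)) / Real.log 3 < n + 1 := Nat.lt_floor_add_one _
  have h3 : (3 : ℝ) ^ n ≤ 2 / 5 * Real.exp β := by
    rw [le_div_iff₀ hl3] at h1
    calc (3 : ℝ) ^ n = Real.exp (n * Real.log 3) := by
          rw [Real.exp_nat_mul, Real.exp_log (by norm_num)]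
      _ ≤ Real.exp (β + Real.log (2 / 5)) := Real.exp_le_exp.2 h1
      _ = _ := by rw [Real.exp_add, Real.exp_log (by norm_num), mul_comm]
  have hpos : 0 < 2 ^ n := by positivity
  have h4 : (2 ^ n - 1) / 5 < cavityScale tpm β := by
    refine lt_cavityScale hβ (lt_of_lt_of_le ?_ (tanh_pow_le_psi_tpm hβ0 (n := n) (by omega)))
    refine lt_of_lt_of_le ?_ (one_sub_le_tanh_half_pow hβ0 _)
    push_cast
    have h6 : Real.exp β * Real.exp (-β) = 1 := by rw [← Real.exp_add]; simp
    have h7 := Real.exp_pos (-β)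
    nlinarith
  have h5 : 2 ^ n ≤ 5 * cavityScale tpm β := by omega
  have h6 : (2 : ℝ) ^ n ≤ 5 * cavityScale tpm β := by exact_mod_cast h5
  have h7 : Real.exp (Real.log 2 / Real.log 3 * β) ≤
      Real.exp (Real.log 2 * (1 - Real.log (2 / 5) / Real.log 3)) * 2 ^ n := by
    have : (2 : ℝ) ^ n = Real.exp (n * Real.log 2) := by
      rw [Real.exp_nat_mul, Real.exp_log (by norm_num)]
    rw [this, ← Real.exp_add]
    refine Real.exp_le_exp.2 ?_
    have h8 : Real.log 2 / Real.log 3 * β = Real.log 2 * ((β + Real.log (2 / 5)) / Real.log 3) -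
        Real.log 2 * (Real.log (2 / 5) / Real.log 3) := by
      field_simp
      ring
    rw [h8]
    nlinarith
  have h8 := Real.exp_pos (Real.log 2 * (1 - Real.log (2 / 5) / Real.log 3))
  nlinarith

/-! ### The upper bound on the cavity scale -/

/-- The mixing bound at scale `ℓ` in terms of `β`: with `w = ℓ e^{-β} / 80`, its exponential factor
is at most a constant times `e^{-2w}`, and `ℓ⁵ e^{-w}` is at most a constant times `e^{5β}`. -/
theorem mixBound_le (B : Finset Site) {β : ℝ} (hβ : 0 < β) {ℓ : ℕ} (hℓ : 1 ≤ ℓ) :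
    mixBound B (ℓ / 40) ((10 * ℓ + 1) ^ 2) (Real.tanh (β / 2)) ≤
      (B.card : ℝ) ^ 3 * 11 ^ 4 * Real.exp 1 * 80 ^ 5 * 120 *
        Real.exp (5 * β - ℓ * Real.exp (-β) / 80) := by
  set u := Real.exp (-β) with hu
  have hu0 : 0 < u := Real.exp_pos _
  have hu1 : u < 1 := by rw [hu]; simpa using hβ
  have hℓ' : (1 : ℝ) ≤ ℓ := by exact_mod_cast hℓ
  set w := ℓ * u / 80 with hw
  have hw0 : 0 ≤ w := by positivity
  have hM1 : ((ℓ / 40 : ℕ) : ℝ) ≤ ℓ := by exact_mod_cast Nat.div_le_self _ _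
  have hM2 : (ℓ : ℝ) / 40 - 1 ≤ (ℓ / 40 : ℕ) := by
    have : ℓ ≤ 40 * (ℓ / 40) + 40 := by omega
    have : (ℓ : ℝ) ≤ 40 * (ℓ / 40 : ℕ) + 40 := by exact_mod_cast this
    linarith
  have ht : Real.tanh (β / 2) ^ (ℓ / 40) ≤ Real.exp 1 * (Real.exp (-w) * Real.exp (-w)) := by
    refine (pow_le_pow_left₀ (tanh_half_pos hβ).le (tanh_half_le β hβ) _).trans ?_
    rw [← Real.exp_nat_mul, ← Real.exp_add, ← Real.exp_add]
    refine Real.exp_le_exp.2 ?_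
    rw [← hu, hw]
    nlinarith
  have hN : ((((10 * ℓ + 1) ^ 2 : ℕ) : ℝ)) ^ 2 ≤ 11 ^ 4 * (ℓ : ℝ) ^ 4 := by
    push_cast
    rw [← pow_mul, ← mul_pow]
    exact pow_le_pow_left₀ (by positivity) (by linarith) 4
  have hw5 : w ^ 5 * Real.exp (-w) ≤ 120 := by
    have h1 := Real.pow_div_factorial_le_exp w hw0 5
    have h2 : ((Nat.factorial 5 : ℕ) : ℝ) = 120 := by norm_num [Nat.factorial]
    rw [h2, div_le_iff₀ (by norm_num)] at h1
    calc w ^ 5 * Real.exp (-w) ≤ Real.exp w * 120 * Real.exp (-w) := by gcongr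
      _ = 120 * (Real.exp w * Real.exp (-w)) := by ring
      _ = 120 := by rw [← Real.exp_add, add_neg_cancel, Real.exp_zero, mul_one]
  have ht0 := tanh_half_pos hβ
  set e := Real.exp (-w)
  have he : 0 < e := Real.exp_pos _
  have hC : 0 ≤ (B.card : ℝ) ^ 3 := by positivity
  unfold mixBound
  calc (B.card : ℝ) ^ 3 * (((10 * ℓ + 1) ^ 2 : ℕ) : ℝ) ^ 2 * ((ℓ / 40 : ℕ) : ℝ) *
        Real.tanh (β / 2) ^ (ℓ / 40)
      ≤ (B.card : ℝ) ^ 3 * (11 ^ 4 * (ℓ : ℝ) ^ 4) * ℓ *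
          (Real.exp 1 * (e * e)) := by
        refine mul_le_mul (mul_le_mul (mul_le_mul_of_nonneg_left hN hC) hM1 (Nat.cast_nonneg _)
          (by positivity)) ht (by positivity) (by positivity)
    _ = (B.card : ℝ) ^ 3 * 11 ^ 4 * Real.exp 1 * 80 ^ 5 * (w ^ 5 * e) *
          (Real.exp β ^ 5 * e) := by
        have hℓw : (ℓ : ℝ) = 80 * w * Real.exp β := by
          have : u * Real.exp β = 1 := by rw [hu, ← Real.exp_add]; simp
          rw [hw]
          linear_combination (-(ℓ : ℝ)) * this
        rw [hℓw]
        ring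
    _ ≤ (B.card : ℝ) ^ 3 * 11 ^ 4 * Real.exp 1 * 80 ^ 5 * 120 *
          (Real.exp β ^ 5 * e) :=
        mul_le_mul_of_nonneg_right (mul_le_mul_of_nonneg_left hw5 (by positivity)) (by positivity)
    _ = _ := by
        rw [← Real.exp_nat_mul, ← Real.exp_add]
        norm_num [sub_eq_add_neg]

/-- At scales `ℓ ≥ 480 β e^β` the factor `e^{-ℓ e^{-β} / 80} ≤ e^{-6β}` beats the factor `e^{5β}` in
the mixing bound. -/
theorem HasInsulation.psi_le {B : Finset Site} (h : HasInsulation B) (hB : B.Nonempty) :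
    ∀ᶠ β : ℝ in atTop, ∀ ℓ : ℕ, 480 * β * Real.exp β ≤ ℓ → psi B β ℓ ≤ 1 / 10 := by
  set K := (B.card : ℝ) ^ 3 * 11 ^ 4 * Real.exp 1 * 80 ^ 5 * 120
  have hK : 0 ≤ K := by positivity
  have hlim : Tendsto (fun β : ℝ => K * Real.exp (-β)) atTop (nhds 0) := by
    simpa using (Real.tendsto_exp_neg_atTop_nhds_zero).const_mul K
  filter_upwards [hlim.eventually_le_const (show (0 : ℝ) < 1 / 150 by norm_num),
    eventually_ge_atTop 1] with β hβ hβ1 ℓ hℓ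
  have hβ0 : 0 < β := by linarith
  have hE : 1 ≤ Real.exp β := Real.one_le_exp hβ0.le
  have hℓ80 : 80 ≤ ℓ := by
    have : (80 : ℝ) ≤ ℓ := by nlinarith
    exact_mod_cast this
  set q := mixBound B (ℓ / 40) ((10 * ℓ + 1) ^ 2) (Real.tanh (β / 2)) with hq
  have hq1 : q ≤ 1 / 150 := by
    refine (mixBound_le B hβ0 (by omega)).trans (le_trans ?_ hβ)
    refine mul_le_mul_of_nonneg_left (Real.exp_le_exp.2 ?_) hK
    have h1 : 480 * β ≤ ℓ * Real.exp (-β) := by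
      rw [Real.exp_neg, ← div_eq_mul_inv, le_div_iff₀ (Real.exp_pos _)]
      exact hℓ
    linarith
  have hexp : Real.exp (12 * q) ≤ 11 / 10 := by
    have h1 : Real.exp (12 * q) ≤ Real.exp (2 / 25) := Real.exp_le_exp.2 (by linarith)
    have h2 := Real.add_one_le_exp (-(2 / 25 : ℝ))
    have h3 : Real.exp (2 / 25) * Real.exp (-(2 / 25)) = 1 := by rw [← Real.exp_add]; simp
    nlinarith [Real.exp_pos (2 / 25)]
  refine ciSup_le fun p => ciSup_le fun S => ?_
  have key : ∀ τ τ', gibbsProb B β (centredSquare (10 * ℓ)) τ'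
        {σ | (fun x : centredSquare ℓ => σ x) ∈ S} ≤
      gibbsProb B β (centredSquare (10 * ℓ)) τ {σ | (fun x : centredSquare ℓ => σ x) ∈ S} +
        1 / 10 := by
    intro τ τ'
    have h1 := h.gibbsExp_le hB hβ0 (ℓ := ℓ) (M := ℓ / 40) (by omega) (by omega)
      (by rw [← hq]; linarith) (fun σ => Set.indicator_nonneg (fun _ _ => zero_le_one) σ)
      (dependsOn_indicator_cylinder (centredSquare ℓ) S) τ τ'
    have h2 := gibbsProb_nonneg B β (centredSquare (10 * ℓ)) τ
      {σ | (fun x : centredSquare ℓ => σ x) ∈ S}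
    have h3 := gibbsProb_le_one B β (centredSquare (10 * ℓ)) τ
      {σ | (fun x : centredSquare ℓ => σ x) ∈ S}
    rw [← hq] at h1
    change gibbsProb B β (centredSquare (10 * ℓ)) τ'
        {σ | (fun x : centredSquare ℓ => σ x) ∈ S} ≤ _ *
      gibbsProb B β (centredSquare (10 * ℓ)) τ {σ | (fun x : centredSquare ℓ => σ x) ∈ S} at h1
    nlinarith
  rw [abs_le]
  constructor <;> linarith [key p.1 p.2, key p.2 p.1]

/-- The first assertion says that the infimum that defines the cavity scale is attained. -/
theorem HasInsulation.cavityScale_isBigO {B : Finset Site} (h : HasInsulation B)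
    (hB : B.Nonempty) :
    (∀ᶠ β in atTop, {ℓ : ℕ | 1 ≤ ℓ ∧ ∀ ℓ' : ℕ, ℓ ≤ ℓ' → psi B β ℓ' ≤ 1 / 10}.Nonempty) ∧
      (fun β : ℝ => (cavityScale B β : ℝ)) =O[atTop] fun β : ℝ => β * Real.exp β := by
  have key : ∀ᶠ β : ℝ in atTop, 1 ≤ β ∧ ⌈480 * β * Real.exp β⌉₊ ∈
      {ℓ : ℕ | 1 ≤ ℓ ∧ ∀ ℓ' : ℕ, ℓ ≤ ℓ' → psi B β ℓ' ≤ 1 / 10} := by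
    filter_upwards [h.psi_le hB, eventually_ge_atTop 1] with β hβ hβ1
    refine ⟨hβ1, Nat.one_le_iff_ne_zero.2 (Nat.ceil_pos.2 ?_).ne', fun ℓ' hℓ' =>
      hβ ℓ' ((Nat.le_ceil _).trans (by exact_mod_cast hℓ'))⟩
    have := Real.exp_pos β
    positivity
  constructor
  · filter_upwards [key] with β hβ
    exact ⟨_, hβ.2⟩
  · refine Asymptotics.IsBigO.of_bound 481 ?_
    filter_upwards [key] with β hβ
    have h1 : (cavityScale B β : ℝ) ≤ ⌈480 * β * Real.exp β⌉₊ := by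
      exact_mod_cast Nat.sInf_le hβ.2
    have h2 : 1 ≤ Real.exp β := Real.one_le_exp (by linarith [hβ.1])
    have h3 : 1 ≤ β * Real.exp β := by nlinarith [hβ.1]
    have h4 := Nat.ceil_lt_add_one (show 0 ≤ 480 * β * Real.exp β by linarith)
    rw [Real.norm_of_nonneg (Nat.cast_nonneg _), Real.norm_of_nonneg (by linarith)]
    linarith

/-! ### Covariances of flip ratios -/

theorem flipRatio_eq {B : Finset Site} (hB : B.Nonempty) (β : ℝ) (x : Site) (σ : Config) :
    flipRatio B β x σ =
      Real.exp (-β * ∑ z ∈ positions B {x}, multispin (translate B z) σ) := by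
  rw [flipRatio, sum_plaquettes hB {x} fun P => multispin P (flip σ x) - multispin P σ]
  congr 1
  rw [Finset.mul_sum, Finset.mul_sum]
  refine Finset.sum_congr rfl fun z hz => ?_
  obtain ⟨y, hy, hyz⟩ := mem_positions.1 hz
  rw [Finset.mem_singleton] at hy
  rw [multispin_flip_of_mem (hy ▸ hyz)]
  ring

theorem flipRatio_pos (B : Finset Site) (β : ℝ) (x : Site) (σ : Config) :
    0 < flipRatio B β x σ := Real.exp_pos _

theorem abs_sum_multispin_le (B S : Finset Site) (σ : Config) :
    |∑ z ∈ S, multispin (translate B z) σ| ≤ S.card := by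
  refine (Finset.abs_sum_le_sum_abs _ _).trans ?_
  simp [abs_multispin]

theorem flipRatio_le {B : Finset Site} (hB : B.Nonempty) {β : ℝ} (hβ : 0 < β) (x : Site)
    (σ : Config) : flipRatio B β x σ ≤ Real.exp (β * B.card) := by
  rw [flipRatio_eq hB]
  refine Real.exp_le_exp.2 ?_
  have h1 := (abs_le.1 (abs_sum_multispin_le B (positions B {x}) σ)).1
  have h2 : ((positions B {x}).card : ℝ) ≤ B.card := by
    exact_mod_cast (card_positions_le B {x}).trans (by simp)
  nlinarith

theorem gibbsExp_nonneg (B : Finset Site) (β : ℝ) (Λ : Finset Site) (τ : Config)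
    {f : Config → ℝ} (hf : ∀ σ, 0 ≤ f σ) : 0 ≤ gibbsExp B β Λ τ f := by
  rw [← gibbsExp_const B β Λ τ 0]
  exact gibbsExp_mono B β Λ τ hf

theorem gibbsExp_flipRatio_le {B : Finset Site} (hB : B.Nonempty) {β : ℝ} (hβ : 0 < β)
    (Λ : Finset Site) (τ : Config) (x : Site) :
    gibbsExp B β Λ τ (flipRatio B β x) ≤ Real.exp (β * B.card) := by
  rw [← gibbsExp_const B β Λ τ (Real.exp (β * B.card))]
  exact gibbsExp_mono B β Λ τ fun σ => flipRatio_le hB hβ x σ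

theorem abs_gibbsCov_flipRatio_le {B : Finset Site} (hB : B.Nonempty) {β : ℝ} (hβ : 0 < β)
    (Λ : Finset Site) (τ : Config) (x y : Site) :
    |gibbsCov B β Λ τ (flipRatio B β x) (flipRatio B β y)| ≤ Real.exp (β * B.card) ^ 2 := by
  set H := Real.exp (β * B.card)
  have hH : 0 < H := Real.exp_pos _
  have h0 : ∀ x σ, 0 ≤ flipRatio B β x σ := fun x σ => (flipRatio_pos B β x σ).le
  have h1 := gibbsExp_nonneg B β Λ τ fun σ => mul_nonneg (h0 x σ) (h0 y σ)
  have h2 : gibbsExp B β Λ τ (fun σ => flipRatio B β x σ * flipRatio B β y σ) ≤ H ^ 2 := by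
    rw [← gibbsExp_const B β Λ τ (H ^ 2), sq]
    exact gibbsExp_mono B β Λ τ fun σ =>
      mul_le_mul (flipRatio_le hB hβ x σ) (flipRatio_le hB hβ y σ) (h0 y σ) hH.le
  have h3 := gibbsExp_nonneg B β Λ τ (h0 x)
  have h4 := gibbsExp_nonneg B β Λ τ (h0 y)
  have h5 : gibbsExp B β Λ τ (flipRatio B β x) * gibbsExp B β Λ τ (flipRatio B β y) ≤ H ^ 2 := by
    rw [sq]
    exact mul_le_mul (gibbsExp_flipRatio_le hB hβ Λ τ x) (gibbsExp_flipRatio_le hB hβ Λ τ y) h4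
      hH.le
  rw [gibbsCov, abs_le]
  constructor <;> nlinarith

theorem abs_gibbsCov_le_phi {B : Finset Site} (hB : B.Nonempty) {β : ℝ} (hβ : 0 < β) {ℓ : ℕ}
    {x y : Site} (hx : x ∉ square ℓ) (hy : y ∉ square ℓ) (hxy : ℓ ≤ 4 * dist1 x y) (τ : Config) :
    |gibbsCov B β (square ℓ) τ (flipRatio B β x) (flipRatio B β y)| ≤ phi B β ℓ := by
  refine le_csSup ⟨Real.exp (β * B.card) ^ 2, ?_⟩ ⟨x, y, τ, hx, hy, ?_, rfl⟩
  · rintro _ ⟨x, y, τ, -, -, -, rfl⟩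
    exact abs_gibbsCov_flipRatio_le hB hβ _ _ _ _
  · have : (ℓ : ℝ) ≤ 4 * dist1 x y := by exact_mod_cast hxy
    linarith

theorem gibbsCov_affine (B : Finset Site) (β : ℝ) (Λ : Finset Site) (τ : Config)
    (f g : Config → ℝ) (a b c d : ℝ) :
    gibbsCov B β Λ τ (fun σ => a * f σ + b) (fun σ => c * g σ + d) =
      a * c * gibbsCov B β Λ τ f g := by
  have h1 : (fun σ => (a * f σ + b) * (c * g σ + d)) =
      fun σ => (a * c) * (f σ * g σ) + ((a * d) * f σ + ((b * c) * g σ + b * d)) := by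
    funext σ
    ring
  unfold gibbsCov
  rw [h1]
  simp only [gibbsExp_add, gibbsExp_const_mul, gibbsExp_const]
  ring

theorem gibbsExp_eq_of_forall_glue {B : Finset Site} (hB : B.Nonempty) (β : ℝ) {Λ : Finset Site}
    {τ : Config} (hτ : ∀ z ∈ positions B Λ, ∀ x ∈ translate B z, τ x = 1) {f f' : Config → ℝ}
    (hf : ∀ η : Λ → ℤˣ, f (glue Λ η τ) = f' (glue Λ η 1)) :
    gibbsExp B β Λ τ f = gibbsExp B β Λ 1 f' := by
  have hw : ∀ η : Λ → ℤˣ, weight B β Λ (glue Λ η τ) = weight B β Λ (glue Λ η 1) := by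
    intro η
    rw [weight_eq_exp hB, weight_eq_exp hB]
    congr 1
    refine Finset.sum_congr rfl fun z hz => ?_
    rw [multispin_congr fun x hx => ?_]
    by_cases hxΛ : x ∈ Λ
    · rw [glue_of_mem hxΛ, glue_of_mem hxΛ]
    · rw [glue_of_notMem hxΛ, glue_of_notMem hxΛ, hτ z hz x hx]
      rfl
  unfold gibbsExp partitionFunction
  simp_rw [hw, hf]

/-- If only one of the plaquettes containing `x` meets `Λ`, then `h_x` is an affine function of the
corresponding plaquette variable. -/
theorem flipRatio_glue {B : Finset Site} (hB : B.Nonempty) (β : ℝ) {Λ : Finset Site}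
    {τ : Config} (hτ : ∀ z ∈ positions B Λ, ∀ x ∈ translate B z, τ x = 1) {x p : Site}
    (hp : p ∈ positions B {x}) (hpΛ : p ∈ positions B Λ)
    (hp' : ∀ z ∈ positions B {x}, z ≠ p → z ∉ positions B Λ) (η : Λ → ℤˣ) :
    flipRatio B β x (glue Λ η τ) =
      -(Real.exp (-β * ∑ z ∈ (positions B {x}).erase p, multispin (translate B z) τ) *
          Real.sinh β) * multispin (translate B p) (glue Λ η 1) +
        Real.exp (-β * ∑ z ∈ (positions B {x}).erase p, multispin (translate B z) τ) *
          Real.cosh β := by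
  have h1 : ∀ z ∈ (positions B {x}).erase p,
      multispin (translate B z) (glue Λ η τ) = multispin (translate B z) τ := by
    intro z hz
    rw [Finset.mem_erase] at hz
    refine multispin_congr fun y hy => glue_of_notMem (fun hyΛ => ?_) η τ
    exact hp' z hz.2 hz.1 (mem_positions.2 ⟨y, hyΛ, hy⟩)
  have h2 : multispin (translate B p) (glue Λ η τ) = multispin (translate B p) (glue Λ η 1) := by
    refine multispin_congr fun y hy => ?_
    by_cases hyΛ : y ∈ Λ
    · rw [glue_of_mem hyΛ, glue_of_mem hyΛ]
    · rw [glue_of_notMem hyΛ, glue_of_notMem hyΛ, hτ p hpΛ y hy]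
      rfl
  rw [flipRatio_eq hB, ← Finset.add_sum_erase _ _ hp, Finset.sum_congr rfl h1, h2, mul_add,
    Real.exp_add, exp_mul_sign (-β) (multispin_eq_or _ _), Real.cosh_neg, Real.tanh_neg,
    Real.tanh_eq_sinh_div_cosh]
  field_simp [(Real.cosh_pos β).ne']
  ring

/-- The covariance of `h_x` and `h_y` in terms of that of two plaquette variables under plus boundary
conditions. The boundary condition `τ` is also plus on all plaquettes that meet `Λ`, and its values
elsewhere enter through explicit factors only. -/
theorem gibbsCov_flipRatio_eq {B : Finset Site} (hB : B.Nonempty) (β : ℝ) {Λ : Finset Site}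
    {τ : Config} (hτ : ∀ z ∈ positions B Λ, ∀ x ∈ translate B z, τ x = 1) {x p : Site}
    (hp : p ∈ positions B {x}) (hpΛ : p ∈ positions B Λ)
    (hp' : ∀ z ∈ positions B {x}, z ≠ p → z ∉ positions B Λ) {y q : Site}
    (hq : q ∈ positions B {y}) (hqΛ : q ∈ positions B Λ)
    (hq' : ∀ z ∈ positions B {y}, z ≠ q → z ∉ positions B Λ) :
    gibbsCov B β Λ τ (flipRatio B β x) (flipRatio B β y) =
      Real.exp (-β * ∑ z ∈ (positions B {x}).erase p, multispin (translate B z) τ) *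
        Real.exp (-β * ∑ z ∈ (positions B {y}).erase q, multispin (translate B z) τ) *
        Real.sinh β ^ 2 *
        gibbsCov B β Λ 1 (multispin (translate B p)) (multispin (translate B q)) := by
  have e1 := flipRatio_glue hB β hτ hp hpΛ hp'
  have e2 := flipRatio_glue hB β hτ hq hqΛ hq'
  set a := Real.exp (-β * ∑ z ∈ (positions B {x}).erase p, multispin (translate B z) τ)
  set c := Real.exp (-β * ∑ z ∈ (positions B {y}).erase q, multispin (translate B z) τ)
  have h : gibbsCov B β Λ τ (flipRatio B β x) (flipRatio B β y) =
      gibbsCov B β Λ 1 (fun σ => -(a * Real.sinh β) * multispin (translate B p) σ +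
        a * Real.cosh β) (fun σ => -(c * Real.sinh β) * multispin (translate B q) σ +
        c * Real.cosh β) := by
    unfold gibbsCov
    refine congrArg₂ _ (gibbsExp_eq_of_forall_glue hB β hτ fun η => ?_) (congrArg₂ _
      (gibbsExp_eq_of_forall_glue hB β hτ e1) (gibbsExp_eq_of_forall_glue hB β hτ e2))
    rw [e1, e2]
  rw [h, gibbsCov_affine]
  ring

/-- Lower bound on the covariance of two plaquette variables under plus boundary conditions, by
means of a cycle `F` that contains `p` and `q` and a configuration `ζ` of minus spins whose
defects in `F` are `p` and `q`. -/
theorem le_gibbsCov_one {B : Finset Site} (hB : B.Nonempty) {β : ℝ} (hβ : 0 < β)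
    {Λ F A D : Finset Site} (hF : F ⊆ positions B Λ) (hFA : IsBoundary B F A) (hA : A ∩ Λ = ∅)
    {p q : Site} (hpq : p ≠ q) (hp : p ∈ F) (hq : q ∈ F) {ζ : Config} (hζ : ∀ x ∉ Λ, ζ x = 1)
    (hζq : ∏ b ∈ B, ζ (b + q) = -1)
    (hζF : ∀ z ∈ F, z ≠ p → z ≠ q → ∏ b ∈ B, ζ (b + z) = 1)
    (hD : ∀ z ∉ D, ∏ b ∈ B, ζ (b + z) = 1) :
    2 * Real.tanh β ^ (F.card - 2) * Real.exp (-(β * D.card)) *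
        (((1 + Real.tanh (β / 2)) / 2) ^ F.card) ^ 2 ≤
      gibbsCov B β Λ 1 (multispin (translate B p)) (multispin (translate B q)) := by
  set F' := (F.erase q).erase p
  have hq' : q ∉ F' := fun h => by simp [F'] at h
  have hp' : p ∉ F' := fun h => by simp [F'] at h
  have hFF' : insert p (insert q F') = F := by
    rw [Finset.insert_comm, Finset.insert_erase (Finset.mem_erase.2 ⟨hpq, hp⟩),
      Finset.insert_erase hq]
  have hcard : F'.card + 2 = F.card := by
    rw [← hFF', Finset.card_insert_of_notMem, Finset.card_insert_of_notMem hq']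
    simp [hpq, hp']
  set s : Λ → ℤˣ := fun x => ζ x
  have hs : glue Λ s 1 = ζ := by
    funext x
    by_cases hx : x ∈ Λ
    · rw [glue_of_mem hx]
    · rw [glue_of_notMem hx, hζ x hx]
      rfl
  have hφs : ∀ z, spinHom Λ (translate B z) s = ∏ b ∈ B, ζ (b + z) := by
    intro z
    change ∏ x ∈ translate B z, glue Λ s 1 x = _
    rw [hs, translate, Finset.prod_image fun a _ b _ h => add_left_injective z h]
  have hcyc : ∀ g : Λ → ℤˣ, spinHom Λ (translate B p) g * spinHom Λ (translate B q) g =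
      ∏ z ∈ F', spinHom Λ (translate B z) g := by
    intro g
    have h1 : plaqProd B F (glue Λ g 1) = 1 := by
      rw [hFA.plaqProd_eq, multispin_glue_one_inter, hA]
      simp [multispin]
    have h2 : plaqProd B F (glue Λ g 1) = sgn (∏ z ∈ F, spinHom Λ (translate B z) g) := by
      unfold plaqProd sgn
      push_cast
      rfl
    rw [h2] at h1
    have h3 : ∏ z ∈ F, spinHom Λ (translate B z) g = 1 := by
      rcases Int.units_eq_one_or (∏ z ∈ F, spinHom Λ (translate B z) g) with h | h
      · exact h
      · rw [h, sgn_neg_one] at h1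
        norm_num at h1
    rw [← hFF', Finset.prod_insert, Finset.prod_insert hq', ← mul_assoc] at h3
    · rw [← mul_right_inj (∏ z ∈ F', spinHom Λ (translate B z) g), ← sq, Int.units_sq, mul_comm, h3]
    · simp [hpq, hp']
  have key := le_covariance (ι := Site) (S := positions B Λ) (F' := F') (D := D) (p := p) (q := q)
    (J := β / 2) (by positivity) (fun z => spinHom Λ (translate B z)) hpq hp' hq'
    (hFF'.symm ▸ hF) hcyc (s := s) ((hφs q).trans hζq)
    (fun z hz => (hφs z).trans (by
      rw [Finset.mem_erase, Finset.mem_erase] at hz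
      exact hζF z hz.2.2 hz.1 hz.2.1))
    (fun z _ hz => (hφs z).trans (hD z hz)) (fun g => weight B β Λ (glue Λ g 1))
    (fun g => weight_glue_one hB β Λ g)
  have hZ := partitionFunction_pos B β Λ 1
  rw [hcard, mul_div_cancel₀ β two_ne_zero, mul_pow] at key
  have hcard' : F'.card = F.card - 2 := by omega
  rw [hcard'] at key
  change _ * (_ * partitionFunction B β Λ 1 ^ 2) ≤
    gibbsSum B β Λ 1 (fun σ => multispin (translate B p) σ * multispin (translate B q) σ) *
      partitionFunction B β Λ 1 - gibbsSum B β Λ 1 (multispin (translate B p)) *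
      gibbsSum B β Λ 1 (multispin (translate B q)) at key
  rw [gibbsCov, gibbsExp_eq, gibbsExp_eq, gibbsExp_eq, div_mul_div_comm, div_sub_div _ _ hZ.ne'
    (by positivity), le_div_iff₀ (by positivity)]
  calc _ = partitionFunction B β Λ 1 * (2 * Real.tanh β ^ (F.card - 2) *
        Real.exp (-(β * D.card)) * ((((1 + Real.tanh (β / 2)) / 2) ^ F.card) ^ 2 *
          partitionFunction B β Λ 1 ^ 2)) := by ring
    _ ≤ _ := mul_le_mul_of_nonneg_left key hZ.le
    _ = _ := by ring

/-! ### The lower bound on the mixing scale -/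

/-- The row of positions just below the square `Q_ℓ`. -/
def bottomRow (ℓ : ℕ) : Finset Site := Finset.Icc 0 (ℓ : ℤ) ×ˢ {0}

theorem mem_bottomRow {ℓ : ℕ} {z : Site} : z ∈ bottomRow ℓ ↔ (0 ≤ z.1 ∧ z.1 ≤ ℓ) ∧ z.2 = 0 := by
  rw [bottomRow, Finset.mem_product, Finset.mem_Icc, Finset.mem_singleton]

theorem card_bottomRow (ℓ : ℕ) : (bottomRow ℓ).card = ℓ + 1 := by
  rw [bottomRow, Finset.card_product, Finset.card_singleton, Int.card_Icc]
  omega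

/-- In each square `Q_ℓ` there are droplets of minus spins that touch the bottom of the square:
configurations `ζ` with at most `|B|` negative plaquettes, two of which are in the bottom row, at
the position `0` and at a distant position `q`. Moreover the plaquette at `q` contains a site `y` of
which all other plaquettes are outside the square, and the bottom row is a cycle. -/
def HasDroplets (B : Finset Site) : Prop :=
  ∀ ℓ : ℕ, 1 ≤ ℓ → ∃ (q y : Site) (ζ : Config) (A D : Finset Site),
    y ∉ square ℓ ∧ ℓ ≤ 4 * dist1 (0, 0) y ∧ q ∈ bottomRow ℓ ∧ (0, 0) ≠ q ∧
    q ∈ positions B {y} ∧ (∀ z ∈ positions B {y}, z ≠ q → z ∉ positions B (square ℓ)) ∧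
    (∀ x ∉ square ℓ, ζ x = 1) ∧ ∏ b ∈ B, ζ (b + q) = -1 ∧
    (∀ z ∈ bottomRow ℓ, z ≠ (0, 0) → z ≠ q → ∏ b ∈ B, ζ (b + z) = 1) ∧
    (∀ z ∉ D, ∏ b ∈ B, ζ (b + z) = 1) ∧ D.card ≤ B.card ∧
    IsBoundary B (bottomRow ℓ) A ∧ A ∩ square ℓ = ∅

theorem mem_positions_singleton {B : Finset Site} {y z : Site} :
    z ∈ positions B {y} ↔ y - z ∈ B := by
  rw [mem_positions]
  simp [mem_translate]

/-- The droplet is the lowest row of the square. -/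
theorem hasDroplets_spm : HasDroplets spm := by
  intro ℓ hℓ
  have hprod : ∀ z : Site, ∏ b ∈ spm, (if (b + z).2 = 1 ∧ 1 ≤ (b + z).1 ∧ (b + z).1 ≤ ℓ
      then -1 else 1 : ℤˣ) =
      if (z.1 = 0 ∨ z.1 = ℓ) ∧ (z.2 = 0 ∨ z.2 = 1) then -1 else 1 := by
    intro z
    simp only [spm]
    rw [Finset.prod_insert (by decide), Finset.prod_insert (by decide),
      Finset.prod_insert (by decide), Finset.prod_singleton]
    simp only [Prod.fst_add, Prod.snd_add, zero_add]
    split_ifs <;> first | omega | simp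
  refine ⟨(ℓ, 0), (ℓ + 1, 0), fun x => if x.2 = 1 ∧ 1 ≤ x.1 ∧ x.1 ≤ ℓ then -1 else 1,
    {(0, 0), ((ℓ : ℤ) + 1, 0), (0, 1), ((ℓ : ℤ) + 1, 1)},
    {(0, 0), ((ℓ : ℤ), 0), (0, 1), ((ℓ : ℤ), 1)}, ?_, ?_, ?_, ?_, ?_, ?_, ?_, ?_, ?_, ?_, ?_, ?_, ?_⟩
  · rw [mem_square]
    dsimp only
    omega
  · unfold dist1
    dsimp only
    omega
  · rw [mem_bottomRow]
    dsimp only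
    omega
  · intro h
    have := congrArg Prod.fst h
    dsimp only at this
    omega
  · rw [mem_positions_singleton, mem_spm]
    simp
  · intro z hz hzq hz'
    obtain ⟨x, hx, hxz⟩ := mem_positions.1 hz'
    rw [mem_positions_singleton, mem_spm] at hz
    rw [mem_square] at hx
    rw [mem_translate, mem_spm] at hxz
    simp only [Prod.fst_sub, Prod.snd_sub] at hz hxz
    exact hzq (Prod.ext (by dsimp only; omega) (by dsimp only; omega))
  · intro x hx
    rw [mem_square] at hx
    exact if_neg (by omega)
  · rw [hprod]
    simp
  · intro z hz hz0 hzq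
    rw [mem_bottomRow] at hz
    rw [hprod, if_neg]
    rintro ⟨h1 | h1, -⟩
    · exact hz0 (Prod.ext h1 hz.2)
    · exact hzq (Prod.ext h1 hz.2)
  · intro z hz
    rw [hprod, if_neg]
    intro h
    apply hz
    simp only [Finset.mem_insert, Finset.mem_singleton, Prod.ext_iff]
    omega
  · exact Finset.card_le_four
  · rw [isBoundary_iff]
    funext x
    simp only [conv, sum_spm, ind, mem_bottomRow, Prod.ext_iff, Finset.mem_insert,
      Finset.mem_singleton, Prod.fst_sub, Prod.snd_sub, smul_fst_snd]
    simp only [Nat.cast_one, mul_zero, mul_one, sub_zero]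
    split_ifs <;> first | omega | decide
  · ext x
    simp only [Finset.mem_inter, Finset.mem_insert, Finset.mem_singleton, Prod.ext_iff, mem_square,
      Finset.notMem_empty, iff_false]
    omega

theorem prod_ite_neg_one (B : Finset Site) (f : Site → ZMod 2) :
    ∏ b ∈ B, (if f b = 1 then -1 else 1 : ℤˣ) = if ∑ b ∈ B, f b = 1 then -1 else 1 := by
  induction B using Finset.induction_on with
  | empty => simp
  | insert b B hb ih =>
    rw [Finset.prod_insert hb, Finset.sum_insert hb, ih]
    generalize ∑ b ∈ B, f b = u
    generalize f b = v
    revert u v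
    decide

/-- The reflection of a Sierpinski set is a configuration whose negative plaquettes form the
reflected dilated plaquette. -/
theorem prod_sierpinski {B : Finset Site} (h01 : IsUnit01 B) (n : ℕ) (w z : Site) :
    ∏ b ∈ B, (if w - (b + z) ∈ sierpinski B n then -1 else 1 : ℤˣ) =
      if w - z ∈ B.image (fun b => 2 ^ n • b) then -1 else 1 := by
  have h1 := congrFun (isBoundary_iff.1 (isBoundary_sierpinski h01 n)) (w - z)
  have h2 := prod_ite_neg_one B fun b => ind (sierpinski B n) (w - z - 1 • b)
  have h3 : ∀ (S : Finset Site) (x : Site), ind S x = 1 ↔ x ∈ S := fun S x => by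
    unfold ind
    split_ifs with h <;> simp [h]
  simp only [h3] at h2
  rw [show ∑ b ∈ B, ind (sierpinski B n) (w - z - 1 • b) =
    ind (B.image fun b => 2 ^ n • b) (w - z) from h1.symm] at h2
  simp only [h3] at h2
  rw [← h2]
  refine Finset.prod_congr rfl fun b _ => ?_
  rw [one_smul, show w - z - b = w - (b + z) by abel]

/-- The droplet is a reflected Sierpinski set, of the largest order that fits in the square; its
negative plaquettes are the points of a reflected dilated plaquette. -/
theorem hasDroplets_tpm : HasDroplets tpm := by
  intro ℓ hℓ
  set n := Nat.log 2 ℓ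
  have hn1 : 2 ^ n ≤ ℓ := Nat.pow_log_le_self 2 (by omega)
  have hn2 : ℓ < 2 ^ (n + 1) := Nat.lt_pow_succ_log_self one_lt_two ℓ
  rw [pow_succ] at hn2
  have hn0 : 0 < 2 ^ n := by positivity
  have hprod : ∀ z : Site, ∏ b ∈ tpm,
      (if ((2 ^ n : ℤ), (2 ^ n : ℤ)) - (b + z) ∈ sierpinski tpm n then -1 else 1 : ℤˣ) =
      if (z.1 = 2 ^ n ∧ z.2 = 2 ^ n) ∨ (z.1 = 2 ^ n ∧ z.2 = 0) ∨ (z.1 = 0 ∧ z.2 = 0)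
        then -1 else 1 := by
    intro z
    rw [prod_sierpinski isUnit01_tpm]
    refine if_congr ?_ rfl rfl
    simp only [tpm, Finset.image_insert, Finset.image_singleton, Finset.mem_insert,
      Finset.mem_singleton, Prod.ext_iff, smul_fst_snd, Prod.fst_sub, Prod.snd_sub]
    push_cast
    simp only [mul_zero, mul_one]
    omega
  have hN1 : (2 ^ n : ℤ) ≤ ℓ := by exact_mod_cast hn1
  have hN0 : (0 : ℤ) < 2 ^ n := by positivity
  refine ⟨(2 ^ n, 0), (2 ^ n, 0),
    fun x => if ((2 ^ n : ℤ), (2 ^ n : ℤ)) - x ∈ sierpinski tpm n then -1 else 1,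
    insert (0, 1) (insert ((ℓ : ℤ) + 1, 1) (bottomRow ℓ)),
    {((2 ^ n : ℤ), (2 ^ n : ℤ)), ((2 ^ n : ℤ), 0), (0, 0)},
    ?_, ?_, ?_, ?_, ?_, ?_, ?_, ?_, ?_, ?_, ?_, ?_, ?_⟩
  · rw [mem_square]
    dsimp only
    omega
  · have : ((2 : ℤ) ^ n).natAbs = 2 ^ n := by rw [Int.natAbs_pow]; rfl
    simp only [dist1, zero_sub, Int.natAbs_neg, this]
    omega
  · rw [mem_bottomRow]
    dsimp only
    omega
  · intro h
    have := congrArg Prod.fst h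
    dsimp only at this
    omega
  · rw [mem_positions_singleton, mem_tpm]
    simp
  · intro z hz hzq hz'
    obtain ⟨x, hx, hxz⟩ := mem_positions.1 hz'
    rw [mem_positions_singleton, mem_tpm] at hz
    rw [mem_square] at hx
    rw [mem_translate, mem_tpm] at hxz
    simp only [Prod.fst_sub, Prod.snd_sub] at hz hxz
    exact hzq (Prod.ext (by dsimp only; omega) (by dsimp only; omega))
  · intro x hx
    rw [mem_square] at hx
    refine if_neg fun h => hx ?_
    have := mem_sierpinski_bounds isUnit01_tpm h
    simp only [Prod.fst_sub, Prod.snd_sub] at this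
    omega
  · rw [hprod]
    simp
  · intro z hz hz0 hzq
    rw [mem_bottomRow] at hz
    rw [hprod, if_neg]
    rintro (h1 | h1 | h1)
    · omega
    · exact hzq (Prod.ext h1.1 h1.2)
    · exact hz0 (Prod.ext h1.1 h1.2)
  · intro z hz
    rw [hprod, if_neg]
    intro h
    apply hz
    simp only [Finset.mem_insert, Finset.mem_singleton, Prod.ext_iff]
    omega
  · exact Finset.card_le_three
  · rw [isBoundary_iff]
    funext x
    simp only [conv, sum_tpm, ind, mem_bottomRow, Prod.ext_iff, Finset.mem_insert,
      Prod.fst_sub, Prod.snd_sub, smul_fst_snd]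
    simp only [Nat.cast_one, mul_zero, mul_one, sub_zero]
    split_ifs <;> first | omega | decide
  · ext x
    simp only [Finset.mem_inter, Finset.mem_insert, mem_bottomRow, Prod.ext_iff, mem_square,
      Finset.notMem_empty, iff_false]
    omega

theorem sum_multispin_flip_le (B S : Finset Site) (x : Site) {z : Site} (hz : z ∈ S)
    (hx : x ∈ translate B z) :
    ∑ w ∈ S, multispin (translate B w) (flip 1 x) ≤ (S.card : ℝ) - 2 := by
  rw [← Finset.add_sum_erase _ _ hz, multispin_flip_of_mem hx, multispin_one]
  have h1 := (abs_le.1 (abs_sum_multispin_le B (S.erase z) (flip 1 x))).2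
  rw [Finset.card_erase_of_mem hz, Nat.cast_sub (Finset.card_pos.2 ⟨z, hz⟩)] at h1
  push_cast at h1
  linarith

theorem card_positions_singleton (B : Finset Site) (x : Site) : (positions B {x}).card = B.card := by
  rw [positions, Finset.singleton_biUnion]
  exact Finset.card_image_of_injective _ sub_right_injective

/-- A droplet at the bottom of the square produces a covariance between `h_x`, for the corner
`x = 0`, and `h_y`. A minus spin of the boundary condition at `(-1, -1)` makes `h_x` larger. -/
theorem HasDroplets.le_phi {B : Finset Site} (h : HasDroplets B) (h01 : IsUnit01 B)
    (hB0 : ((0, 0) : Site) ∈ B) (hB1 : ((0, 1) : Site) ∈ B) (hB2 : ((1, 1) : Site) ∈ B)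
    {β : ℝ} (hβ : 0 < β) {ℓ : ℕ} (hℓ : 1 ≤ ℓ) :
    Real.exp (-β * (B.card - 3)) * Real.exp (-β * (B.card - 1)) * Real.sinh β ^ 2 *
      (2 * Real.tanh β ^ (ℓ - 1) * Real.exp (-(β * B.card)) *
        (((1 + Real.tanh (β / 2)) / 2) ^ (ℓ + 1)) ^ 2) ≤ phi B β ℓ := by
  obtain ⟨q, y, ζ, A, D, hy, hxy, hq, h0q, hqy, hq', hζ, hζq, hζF, hD, hDcard, hFA, hA⟩ := h ℓ hℓ
  have hB : B.Nonempty := ⟨_, hB0⟩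
  have hrow : bottomRow ℓ ⊆ positions B (square ℓ) := by
    intro z hz
    rw [mem_bottomRow] at hz
    by_cases hzl : z.1 = ℓ
    · refine mem_positions.2 ⟨(0, 1) + z, mem_square.2 ?_, mem_translate.2 (by simpa using hB1)⟩
      simp only [Prod.fst_add, Prod.snd_add]
      omega
    · refine mem_positions.2 ⟨(1, 1) + z, mem_square.2 ?_, mem_translate.2 (by simpa using hB2)⟩
      simp only [Prod.fst_add, Prod.snd_add]
      omega
  have h0 : ((0, 0) : Site) ∈ bottomRow ℓ := mem_bottomRow.2 (by simp)
  set τ : Config := flip 1 (-1, -1) with hτ_def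
  have hτ : ∀ z ∈ positions B (square ℓ), ∀ x ∈ translate B z, τ x = 1 := by
    intro z hz x hx
    refine flip_apply_of_ne ?_
    rintro rfl
    obtain ⟨w, hw, hwz⟩ := mem_positions.1 hz
    rw [mem_square] at hw
    have h1 := h01 _ (mem_translate.1 hx)
    have h2 := h01 _ (mem_translate.1 hwz)
    simp only [Prod.fst_sub, Prod.snd_sub] at h1 h2
    omega
  have hx : ((0, 0) : Site) ∉ square ℓ := by
    rw [mem_square]
    dsimp only
    omega
  have hp : ((0, 0) : Site) ∈ positions B {(0, 0)} := by
    rw [mem_positions_singleton, sub_self]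
    exact hB0
  have hp' : ∀ z ∈ positions B {((0, 0) : Site)}, z ≠ (0, 0) → z ∉ positions B (square ℓ) := by
    intro z hz hz0 hz'
    obtain ⟨w, hw, hwz⟩ := mem_positions.1 hz'
    rw [mem_square] at hw
    have h1 := h01 _ (mem_positions_singleton.1 hz)
    have h2 := h01 _ (mem_translate.1 hwz)
    simp only [Prod.fst_sub, Prod.snd_sub] at h1 h2
    exact hz0 (Prod.ext (by dsimp only; omega) (by dsimp only; omega))
  refine le_trans ?_ (abs_gibbsCov_le_phi hB hβ hx hy hxy τ)
  refine le_trans ?_ (le_abs_self _)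
  rw [gibbsCov_flipRatio_eq hB β hτ hp (hrow h0) hp' hqy (hrow hq) hq']
  have hcov := le_gibbsCov_one hB hβ hrow hFA hA h0q h0 hq hζ hζq hζF hD
  rw [card_bottomRow, show ℓ + 1 - 2 = ℓ - 1 by omega] at hcov
  have hb1 : 1 ≤ B.card := Finset.card_pos.2 hB
  have e1 : ∑ z ∈ (positions B {((0, 0) : Site)}).erase (0, 0), multispin (translate B z) τ ≤
      (B.card : ℝ) - 3 := by
    have hm : ((-1, -1) : Site) ∈ (positions B {((0, 0) : Site)}).erase (0, 0) :=
      Finset.mem_erase.2 ⟨by simp, mem_positions_singleton.2 (by simpa using hB2)⟩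
    have := sum_multispin_flip_le B _ (-1, -1) hm (mem_translate.2 (by rwa [sub_self]))
    rw [Finset.card_erase_of_mem hp, card_positions_singleton, Nat.cast_sub hb1] at this
    push_cast at this
    linarith
  have e2 : ∑ z ∈ (positions B {y}).erase q, multispin (translate B z) τ ≤ (B.card : ℝ) - 1 := by
    have := (abs_le.1 (abs_sum_multispin_le B ((positions B {y}).erase q) τ)).2
    rw [Finset.card_erase_of_mem hqy, card_positions_singleton, Nat.cast_sub hb1] at this
    exact_mod_cast this
  have ht : 0 ≤ Real.tanh β := by
    rw [Real.tanh_eq_sinh_div_cosh]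
    exact div_nonneg (Real.sinh_nonneg_iff.2 hβ.le) (Real.cosh_pos _).le
  have ht2 := tanh_half_pos hβ
  have e3 : 2 * Real.tanh β ^ (ℓ - 1) * Real.exp (-(β * B.card)) *
      (((1 + Real.tanh (β / 2)) / 2) ^ (ℓ + 1)) ^ 2 ≤
      2 * Real.tanh β ^ (ℓ - 1) * Real.exp (-(β * D.card)) *
        (((1 + Real.tanh (β / 2)) / 2) ^ (ℓ + 1)) ^ 2 := by
    have h1 : (D.card : ℝ) ≤ B.card := by exact_mod_cast hDcard
    exact mul_le_mul_of_nonneg_right (mul_le_mul_of_nonneg_left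
      (Real.exp_le_exp.2 (neg_le_neg (mul_le_mul_of_nonneg_left h1 hβ.le)))
      (mul_nonneg zero_le_two (pow_nonneg ht _))) (sq_nonneg _)
  have n1 : 0 ≤ 2 * Real.tanh β ^ (ℓ - 1) * Real.exp (-(β * B.card)) *
      (((1 + Real.tanh (β / 2)) / 2) ^ (ℓ + 1)) ^ 2 :=
    mul_nonneg (mul_nonneg (mul_nonneg zero_le_two (pow_nonneg ht _)) (Real.exp_pos _).le)
      (sq_nonneg _)
  have f1 := Real.exp_le_exp.2 (mul_le_mul_of_nonpos_left e1 (show -β ≤ 0 by linarith))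
  have f2 := Real.exp_le_exp.2 (mul_le_mul_of_nonpos_left e2 (show -β ≤ 0 by linarith))
  have f3 := mul_le_mul f1 f2 (Real.exp_pos _).le (Real.exp_pos _).le
  have n2 := mul_nonneg (mul_nonneg (Real.exp_pos (-β * ∑ z ∈ (positions B {((0, 0) : Site)}).erase
    (0, 0), multispin (translate B z) τ)).le (Real.exp_pos (-β * ∑ z ∈ (positions B {y}).erase q,
      multispin (translate B z) τ)).le) (sq_nonneg (Real.sinh β))
  exact mul_le_mul (mul_le_mul_of_nonneg_right f3 (sq_nonneg _)) (e3.trans hcov) n1 n2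

/-- For `ℓ ≤ e^β` the powers with exponents of order `ℓ` in the lower bound on `φ(ℓ)` are bounded
below. With `b = |B|`, what remains is a constant times `e^{cβ}` for
`c = 2 b - (b - 3) - (b - 1) + 2 - b = 6 - b ≥ 1`: the contributions of `e^{4β‖H‖}`, of the plaquettes
at `x` and `y` outside the square, of `sinh² β`, and of the energy of the droplet. -/
theorem HasDroplets.lt_mul_phi {B : Finset Site} (h : HasDroplets B) (h01 : IsUnit01 B)
    (hB0 : ((0, 0) : Site) ∈ B) (hB1 : ((0, 1) : Site) ∈ B) (hB2 : ((1, 1) : Site) ∈ B)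
    (hcard : B.card ≤ 5) (ε₀ : ℝ) :
    ∀ᶠ β : ℝ in atTop, ∀ ℓ : ℕ, 1 ≤ ℓ → (ℓ : ℝ) ≤ Real.exp β →
      ε₀ < Real.exp (4 * β * hNorm B) * ℓ * phi B β ℓ := by
  have hlim : Tendsto (fun β : ℝ => Real.exp (-4) / 16 * Real.exp β) atTop atTop :=
    Real.tendsto_exp_atTop.const_mul_atTop (by positivity)
  filter_upwards [hlim.eventually_gt_atTop ε₀, Real.tendsto_exp_atTop.eventually_ge_atTop 4,
    eventually_gt_atTop 0] with β hβ hβ4 hβ0 ℓ hℓ hℓβ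
  refine hβ.trans_le ?_
  set b : ℝ := (B.card : ℝ) with hb
  have hb5 : b ≤ 5 := by rw [hb]; exact_mod_cast hcard
  have hexp : Real.exp β * Real.exp (-β) = 1 := by rw [← Real.exp_add]; simp
  have hρ := Real.exp_pos (-β)
  have hρ1 : Real.exp (-β) ≤ 1 / 4 := by nlinarith
  have hℓ1 : (1 : ℝ) ≤ ℓ := by exact_mod_cast hℓ
  have e1 : Real.exp β ^ 2 / 16 ≤ Real.sinh β ^ 2 := by
    have : Real.exp β / 4 ≤ Real.sinh β := by
      rw [Real.sinh_eq]
      linarith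
    calc Real.exp β ^ 2 / 16 = (Real.exp β / 4) ^ 2 := by ring
      _ ≤ _ := pow_le_pow_left₀ (by positivity) this 2
  have e2 : 1 / 2 ≤ Real.tanh β ^ (ℓ - 1) := by
    have h1 := one_sub_le_tanh_half_pow (β := 2 * β) (by linarith) (ℓ - 1)
    rw [mul_div_cancel_left₀ β two_ne_zero] at h1
    refine le_trans ?_ h1
    have h2 : ((ℓ - 1 : ℕ) : ℝ) ≤ Real.exp β := by
      refine le_trans ?_ hℓβ
      exact_mod_cast Nat.sub_le ℓ 1
    have h3 : Real.exp (-(2 * β)) = Real.exp (-β) * Real.exp (-β) := by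
      rw [← Real.exp_add]; congr 1; ring
    rw [h3]
    have h4 : ((ℓ - 1 : ℕ) : ℝ) * Real.exp (-β) ≤ 1 := by nlinarith
    nlinarith
  have e3 : Real.exp (-4) ≤ (((1 + Real.tanh (β / 2)) / 2) ^ (ℓ + 1)) ^ 2 := by
    have h1 : Real.exp (-Real.exp (-β)) ≤ (1 + Real.tanh (β / 2)) / 2 := by
      have h2 := Real.add_one_le_exp (Real.exp (-β))
      rw [tanh_half_eq, Real.exp_neg (Real.exp (-β)), inv_le_comm₀ (Real.exp_pos _)
        (by rw [← tanh_half_eq]; linarith [tanh_half_pos hβ0])]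
      refine le_trans (le_of_eq ?_) h2
      field_simp
      ring
    refine le_trans ?_ (pow_le_pow_left₀ (by positivity)
      (pow_le_pow_left₀ (Real.exp_pos _).le h1 (ℓ + 1)) 2)
    rw [← Real.exp_nat_mul, ← Real.exp_nat_mul]
    refine Real.exp_le_exp.2 ?_
    push_cast
    nlinarith
  have hpos := Real.exp_pos β
  have hφ := h.le_phi h01 hB0 hB1 hB2 hβ0 hℓ
  have hφ' : Real.exp (-β * (b - 3)) * Real.exp (-β * (b - 1)) * (Real.exp β ^ 2 / 16) *
      (2 * (1 / 2) * Real.exp (-(β * b)) * Real.exp (-4)) ≤ phi B β ℓ := by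
    refine le_trans ?_ hφ
    gcongr
  have hφ0 : 0 ≤ phi B β ℓ := le_trans (by positivity) hφ'
  calc Real.exp (-4) / 16 * Real.exp β
      ≤ Real.exp (-4) / 16 * Real.exp ((6 - b) * β) := by
        refine mul_le_mul_of_nonneg_left (Real.exp_le_exp.2 ?_) (by positivity)
        nlinarith
    _ = Real.exp (4 * β * (b / 2)) * 1 * (Real.exp (-β * (b - 3)) * Real.exp (-β * (b - 1)) *
          (Real.exp β ^ 2 / 16) * (2 * (1 / 2) * Real.exp (-(β * b)) * Real.exp (-4))) := by
        have : (6 - b) * β = 4 * β * (b / 2) + (-β * (b - 3)) + (-β * (b - 1)) + (β + β) +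
            (-(β * b)) := by ring
        rw [this, Real.exp_add, Real.exp_add, Real.exp_add, Real.exp_add, Real.exp_add]
        ring
    _ ≤ Real.exp (4 * β * hNorm B) * ℓ * phi B β ℓ := by
        rw [hNorm, ← hb]
        refine mul_le_mul (mul_le_mul_of_nonneg_left hℓ1 (Real.exp_pos _).le) hφ' (by positivity)
          (by positivity)

/-! ### Finiteness of the mixing scale -/

theorem gibbsSum_eq_gibbsExp_mul (B : Finset Site) (β : ℝ) (Λ : Finset Site) (τ : Config)
    (f : Config → ℝ) : gibbsSum B β Λ τ f = gibbsExp B β Λ τ f * partitionFunction B β Λ τ := by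
  rw [gibbsExp_eq, div_mul_cancel₀ _ (partitionFunction_pos B β Λ τ).ne']

theorem gibbsCov_comm (B : Finset Site) (β : ℝ) (Λ : Finset Site) (τ : Config)
    (f g : Config → ℝ) : gibbsCov B β Λ τ f g = gibbsCov B β Λ τ g f := by
  unfold gibbsCov
  rw [mul_comm (gibbsExp B β Λ τ f)]
  simp_rw [mul_comm (f _)]

/-- Multiplication by `h_y` amounts to flipping the boundary spin at `y`, up to a constant that
depends on the boundary condition only. -/
theorem exists_gibbsSum_mul_flipRatio {B : Finset Site} (hB : B.Nonempty) (β : ℝ) {Λ : Finset Site}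
    {y : Site} (hy : y ∉ Λ) (τ : Config) :
    ∃ c : ℝ, 0 < c ∧ ∀ f : Config → ℝ, (∀ σ, f (flip σ y) = f σ) →
      gibbsSum B β Λ τ (fun σ => f σ * flipRatio B β y σ) = c * gibbsSum B β Λ (flip τ y) f := by
  refine ⟨Real.exp (-β * ∑ z ∈ positions B {y} \ positions B Λ, multispin (translate B z) τ),
    Real.exp_pos _, fun f hf => ?_⟩
  unfold gibbsSum
  rw [Finset.mul_sum]
  refine Finset.sum_congr rfl fun η _ => ?_
  beta_reduce
  rw [glue_flip hy, hf]
  set σ := glue Λ η τ with hσ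
  have h1 : ∑ z ∈ positions B {y} \ positions B Λ, multispin (translate B z) τ =
      ∑ z ∈ positions B {y} \ positions B Λ, multispin (translate B z) σ := by
    refine Finset.sum_congr rfl fun z hz => ?_
    refine multispin_congr fun x hx => (glue_of_notMem (fun hxΛ => ?_) η τ).symm
    exact (Finset.mem_sdiff.1 hz).2 (mem_positions.2 ⟨x, hxΛ, hx⟩)
  have hmem : ∀ z, z ∈ positions B {y} ↔ y ∈ translate B z := fun z => by
    rw [mem_positions_singleton, mem_translate]
  have h2 : weight B β Λ (flip σ y) = weight B β Λ σ *
      Real.exp (-β * ∑ z ∈ positions B {y} ∩ positions B Λ, multispin (translate B z) σ) := by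
    rw [weight_eq_exp hB, weight_eq_exp hB, ← Real.exp_add]
    congr 1
    rw [Finset.inter_comm, ← Finset.filter_mem_eq_inter, Finset.sum_filter, Finset.mul_sum,
      ← Finset.sum_add_distrib]
    refine Finset.sum_congr rfl fun z _ => ?_
    split_ifs with hz
    · rw [multispin_flip_of_mem ((hmem z).1 hz)]
      ring
    · rw [multispin_flip_of_notMem fun h => hz ((hmem z).2 h)]
      ring
  rw [h1, h2, flipRatio_eq hB, ← Finset.sum_inter_add_sum_sdiff (positions B {y}) (positions B Λ),
    mul_add, Real.exp_add]
  ring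

/-- Inserting `h_y` into the Gibbs sums of `h_x` and of `1` multiplies them by nearly the same number:
it amounts to flipping a spin that is separated from `x` by the region `R`. -/
theorem abs_gibbsCov_flipRatio_le_of_collar {B : Finset Site} (hB : B.Nonempty) {β : ℝ}
    (hβ : 0 < β) {Λ R : Finset Site} (hR : R ⊆ Λ) {x y : Site} (hy : y ∉ Λ)
    (hsep : ∀ z, y ∈ translate B z → ∀ v ∈ Λ, v ∈ translate B z → v ∈ R)
    {δ : ℝ} (hδ : cycleSum B R (Real.tanh (β / 2)) ≤ δ) (hδ' : δ ≤ 1 / 2) {V : Set Site}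
    (hV : DependsOn (flipRatio B β x) V) (hVR : ∀ v ∈ V, v ∉ R) (hyV : y ∉ V) (τ : Config) :
    |gibbsCov B β Λ τ (flipRatio B β x) (flipRatio B β y)| ≤
      Real.exp (β * B.card) ^ 2 * (Real.exp (6 * δ) - 1) := by
  set f := flipRatio B β x
  have hf0 : ∀ σ, 0 ≤ f σ := fun σ => (flipRatio_pos B β x σ).le
  have hfy : ∀ σ, f (flip σ y) = f σ := fun σ =>
    hV fun v hv => flip_apply_of_ne (by rintro rfl; exact hyV hv)
  obtain ⟨c, hc, hcf⟩ := exists_gibbsSum_mul_flipRatio hB β hy τ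
  set r := Real.exp (3 * δ) with hr
  have hr0 : 0 < r := Real.exp_pos _
  have hr2 : Real.exp (6 * δ) = r * r := by
    rw [hr, ← Real.exp_add]; congr 1; ring
  have hone : DependsOn (fun _ : Config => (1 : ℝ)) V := fun _ _ _ => rfl
  -- flipping the boundary spin at `y` hardly changes the sum of `f` and the partition function
  have n1 := gibbsSum_flip_le hB hβ hR hy hsep hδ hδ' hf0 hV hVR hyV τ
  have n2 := gibbsSum_flip_le hB hβ hR hy hsep hδ hδ' hf0 hV hVR hyV (flip τ y)
  have z1 := gibbsSum_flip_le hB hβ hR hy hsep hδ hδ' (fun _ => zero_le_one) hone hVR hyV τ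
  have z2 := gibbsSum_flip_le hB hβ hR hy hsep hδ hδ' (fun _ => zero_le_one) hone hVR hyV (flip τ y)
  have g1 := hcf f hfy
  have g2 := hcf (fun _ => 1) fun _ => rfl
  simp only [one_mul] at g2
  rw [flip_flip] at n2 z2
  rw [← hr] at n1 n2 z1 z2
  rw [gibbsSum_one, gibbsSum_one] at z1 z2
  rw [gibbsSum_one] at g2
  have hZ := partitionFunction_pos B β Λ τ
  have hEf0 := gibbsExp_nonneg B β Λ τ hf0
  have hEf := gibbsExp_flipRatio_le hB hβ Λ τ x
  have hEg := gibbsExp_flipRatio_le hB hβ Λ τ y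
  have hEg0 := gibbsExp_nonneg B β Λ τ fun σ => (flipRatio_pos B β y σ).le
  set H := Real.exp (β * B.card)
  set Z := partitionFunction B β Λ τ
  set Z' := partitionFunction B β Λ (flip τ y)
  set N' := gibbsSum B β Λ (flip τ y) f
  have hN : gibbsSum B β Λ τ f = gibbsExp B β Λ τ f * Z := gibbsSum_eq_gibbsExp_mul B β Λ τ f
  have hG : c * Z' = gibbsExp B β Λ τ (flipRatio B β y) * Z := by
    rw [← gibbsSum_eq_gibbsExp_mul, ← g2]
  set Ef := gibbsExp B β Λ τ f
  set Eg := gibbsExp B β Λ τ (flipRatio B β y)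
  rw [hN] at n1 n2
  have hfg : gibbsExp B β Λ τ (fun σ => f σ * flipRatio B β y σ) * Z = c * N' := by
    rw [← gibbsSum_eq_gibbsExp_mul, g1]
  set Efg := gibbsExp B β Λ τ (fun σ => f σ * flipRatio B β y σ)
  have hEfEg : Ef * Eg ≤ H ^ 2 := by
    rw [sq]
    exact mul_le_mul hEf hEg hEg0 (Real.exp_pos _).le
  have hrr : 1 ≤ r * r := by
    rw [← hr2]
    exact Real.one_le_exp (by linarith [(cycleSum_nonneg B R (tanh_half_pos hβ).le).trans hδ])
  -- `Efg ≤ r² Ef Eg` and `Ef Eg ≤ r² Efg`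
  have u1 : Efg ≤ r * r * (Ef * Eg) := by
    refine le_of_mul_le_mul_right ?_ hZ
    calc Efg * Z = c * N' := hfg
      _ ≤ c * (r * (Ef * Z)) := mul_le_mul_of_nonneg_left n1 hc.le
      _ = r * Ef * c * Z := by ring
      _ ≤ r * Ef * c * (r * Z') :=
        mul_le_mul_of_nonneg_left z2 (mul_nonneg (mul_nonneg hr0.le hEf0) hc.le)
      _ = r * r * Ef * (c * Z') := by ring
      _ = _ := by rw [hG]; ring
  have u2 : Ef * Eg ≤ r * r * Efg := by
    refine le_of_mul_le_mul_right ?_ hZ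
    calc Ef * Eg * Z = Ef * (c * Z') := by rw [hG]; ring
      _ ≤ Ef * (c * (r * Z)) :=
        mul_le_mul_of_nonneg_left (mul_le_mul_of_nonneg_left z1 hc.le) hEf0
      _ = c * r * (Ef * Z) := by ring
      _ ≤ c * r * (r * N') := mul_le_mul_of_nonneg_left n2 (mul_nonneg hc.le hr0.le)
      _ = r * r * (c * N') := by ring
      _ = _ := by rw [← hfg]; ring
  have hE0 : 0 ≤ Ef * Eg := mul_nonneg hEf0 hEg0
  rw [hr2]
  change |Efg - Ef * Eg| ≤ _
  rw [abs_le]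
  constructor
  · have : Ef * Eg - Efg ≤ (r * r - 1) * (Ef * Eg) := by
      have h1 : Efg ≥ Ef * Eg / (r * r) := (div_le_iff₀ (by positivity)).2 (by linarith)
      have h2 : Ef * Eg - Ef * Eg / (r * r) = (r * r - 1) * (Ef * Eg) / (r * r) := by
        field_simp
      have h3 : (r * r - 1) * (Ef * Eg) / (r * r) ≤ (r * r - 1) * (Ef * Eg) :=
        div_le_self (mul_nonneg (by linarith) hE0) hrr
      linarith
    nlinarith [mul_le_mul_of_nonneg_left hEfEg (show 0 ≤ r * r - 1 by linarith)]
  · nlinarith [mul_le_mul_of_nonneg_left hEfEg (show 0 ≤ r * r - 1 by linarith)]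

theorem dependsOn_flipRatio {B : Finset Site} (hB : B.Nonempty) (h01 : IsUnit01 B) (β : ℝ)
    (x : Site) : DependsOn (flipRatio B β x) {v | dist1 v x ≤ 2} := by
  intro σ σ' h
  rw [flipRatio_eq hB, flipRatio_eq hB]
  congr 2
  refine Finset.sum_congr rfl fun z hz => multispin_congr fun v hv => h v ?_
  have h1 := h01 _ (mem_positions_singleton.1 hz)
  have h2 := h01 _ (mem_translate.1 hv)
  change dist1 v x ≤ 2
  unfold dist1
  simp only [Prod.fst_sub, Prod.snd_sub] at h1 h2
  omega

theorem card_square (ℓ : ℕ) : (square ℓ).card = ℓ ^ 2 := by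
  rw [square, Finset.card_product, Int.card_Icc, sq]
  congr 1 <;> omega

/-- Mixing at scale `100 M`, by means of the collar of one of the two sites. -/
theorem HasCollars.phi_le {B : Finset Site} (h : HasCollars B) (hB : B.Nonempty)
    (h01 : IsUnit01 B) {β : ℝ} (hβ : 0 < β) {M : ℕ} (hM : 2 ≤ M) {δ : ℝ}
    (hδ : 2 * (M * (B.card * ((100 * M) ^ 2) * Real.tanh (β / 2) ^ M)) ≤ δ) (hδ' : δ ≤ 1 / 2) :
    phi B β (100 * M) ≤ Real.exp (β * B.card) ^ 2 * (Real.exp (6 * δ) - 1) := by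
  have ht := tanh_half_pos hβ
  have hM' : (2 : ℝ) ≤ M := by exact_mod_cast hM
  set u := (B.card : ℝ) * ((100 * M) ^ 2) * Real.tanh (β / 2) ^ M with hu
  have hu0 : 0 ≤ u := by positivity
  have hδ0 : 0 ≤ δ := le_trans (by positivity) hδ
  have hcollar : ∀ x y τ, y ∉ square (100 * M) → 100 * M ≤ 4 * dist1 x y →
      HasCollar B (100 * M) M y →
      |gibbsCov B β (square (100 * M)) τ (flipRatio B β x) (flipRatio B β y)| ≤
        Real.exp (β * B.card) ^ 2 * (Real.exp (6 * δ) - 1) := by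
    rintro x y τ hy hxy ⟨R, hR, hT, hsep, hdist⟩
    have hcyc : cycleSum B R (Real.tanh (β / 2)) ≤ δ := by
      refine (tight_cycleSum_le (by omega) hR hT ht.le (Real.tanh_lt_one _).le ?_).trans ?_
      · rw [card_square]
        push_cast
        rw [← hu]
        nlinarith
      · rw [card_square]
        push_cast
        exact hδ
    refine abs_gibbsCov_flipRatio_le_of_collar hB hβ hR hy hsep hcyc hδ'
      (dependsOn_flipRatio hB h01 β x) ?_ ?_ τ
    · intro v hv hvR
      have h1 := hdist v hvR
      change dist1 v x ≤ 2 at hv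
      unfold dist1 at h1 hv hxy
      omega
    · intro hv
      change dist1 y x ≤ 2 at hv
      unfold dist1 at hv hxy
      omega
  refine Real.sSup_le ?_ (mul_nonneg (by positivity)
    (sub_nonneg.2 (Real.one_le_exp (by positivity))))
  rintro _ ⟨x, y, τ, hx, hy, hxy, rfl⟩
  have hxy' : 100 * M ≤ 4 * dist1 x y := by
    have : ((100 * M : ℕ) : ℝ) ≤ 4 * dist1 x y := by linarith
    exact_mod_cast this
  rcases h (100 * M) M hM le_rfl x y hx hy hxy' with hc | hc
  · rw [gibbsCov_comm]
    refine hcollar y x τ hx ?_ hc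
    unfold dist1 at hxy' ⊢
    omega
  · exact hcollar x y τ hy hxy' hc

/-- At each inverse temperature the mixing criterion is met at large scales. -/
theorem HasCollars.exists_mul_phi_le {B : Finset Site} (h : HasCollars B) (hB : B.Nonempty)
    (h01 : IsUnit01 B) {ε₀ : ℝ} (hε₀ : 0 < ε₀) {β : ℝ} (hβ : 0 < β) :
    {ℓ : ℕ | 1 ≤ ℓ ∧ Real.exp (4 * β * hNorm B) * ℓ * phi B β ℓ ≤ ε₀}.Nonempty := by
  set t := Real.tanh (β / 2)
  have ht : 0 < t := tanh_half_pos hβ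
  have ht1 : t < 1 := Real.tanh_lt_one _
  let δ : ℕ → ℝ := fun M => 2 * (M * (B.card * ((100 * M) ^ 2) * t ^ M))
  have hlim : Tendsto (fun M : ℕ => (M : ℝ) * δ M) atTop (nhds 0) := by
    have := (tendsto_pow_const_mul_const_pow_of_abs_lt_one 4 (r := t)
      (by rwa [abs_of_pos ht])).const_mul (2 * (B.card : ℝ) * 100 ^ 2)
    rw [mul_zero] at this
    refine this.congr fun M => ?_
    simp only [δ]
    ring
  set K := Real.exp (4 * β * hNorm B) * 100 * (Real.exp (β * B.card) ^ 2 * 12) with hK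
  have hlim2 : Tendsto (fun M : ℕ => K * ((M : ℝ) * δ M)) atTop (nhds 0) := by
    simpa using hlim.const_mul K
  obtain ⟨M, h1, h2, hM⟩ := ((hlim2.eventually_le_const hε₀).and
    ((hlim.eventually_le_const (show (0 : ℝ) < 1 / 12 by norm_num)).and
      (eventually_ge_atTop 2))).exists
  have hM' : (2 : ℝ) ≤ M := by exact_mod_cast hM
  have hδ0 : 0 ≤ δ M := by positivity
  have hδ1 : δ M ≤ 1 / 12 := by nlinarith
  have hexp : Real.exp (6 * δ M) - 1 ≤ 12 * δ M := by
    have e1 := Real.add_one_le_exp (-(6 * δ M))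
    have e2 : Real.exp (6 * δ M) * Real.exp (-(6 * δ M)) = 1 := by rw [← Real.exp_add]; simp
    have e3 := Real.exp_pos (6 * δ M)
    have e4 : Real.exp (6 * δ M) * (1 - 6 * δ M) ≤ 1 := by nlinarith
    nlinarith
  have hφ := h.phi_le hB h01 hβ hM (δ := δ M) le_rfl (by linarith)
  refine ⟨100 * M, by omega, ?_⟩
  have hφ' : phi B β (100 * M) ≤ Real.exp (β * B.card) ^ 2 * (12 * δ M) :=
    hφ.trans (mul_le_mul_of_nonneg_left hexp (sq_nonneg _))
  push_cast
  calc Real.exp (4 * β * hNorm B) * (100 * M) * phi B β (100 * M)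
      ≤ Real.exp (4 * β * hNorm B) * (100 * M) * (Real.exp (β * B.card) ^ 2 * (12 * δ M)) :=
        mul_le_mul_of_nonneg_left hφ' (by positivity)
    _ = K * (M * δ M) := by rw [hK]; ring
    _ ≤ ε₀ := h1

/-- The mixing scale is at least `e^β`. -/
theorem eventually_exp_le_mixScale {B : Finset Site} (hc : HasCollars B) (hd : HasDroplets B)
    (h01 : IsUnit01 B) (hB0 : ((0, 0) : Site) ∈ B) (hB1 : ((0, 1) : Site) ∈ B)
    (hB2 : ((1, 1) : Site) ∈ B) (hcard : B.card ≤ 5) {ε₀ : ℝ} (hε₀ : 0 < ε₀) :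
    ∀ᶠ β : ℝ in atTop, Real.exp β ≤ mixScale B ε₀ β := by
  filter_upwards [hd.lt_mul_phi h01 hB0 hB1 hB2 hcard ε₀, eventually_gt_atTop 0] with β hβ hβ0
  obtain ⟨h1, h2⟩ := Nat.sInf_mem (hc.exists_mul_phi_le ⟨_, hB0⟩ h01 hε₀ hβ0)
  by_contra hcon
  exact absurd h2 (not_le.2 (hβ _ h1 (not_le.1 hcon).le))

/-- Both scales are compared with `e^β`. -/
theorem cavityScale_isBigO_mixScale {B : Finset Site} (hi : HasInsulation B) (hc : HasCollars B)
    (hd : HasDroplets B) (h01 : IsUnit01 B) (hB0 : ((0, 0) : Site) ∈ B)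
    (hB1 : ((0, 1) : Site) ∈ B) (hB2 : ((1, 1) : Site) ∈ B) (hcard : B.card ≤ 5) {ε₀ : ℝ}
    (hε₀ : 0 < ε₀) :
    (fun β : ℝ => (cavityScale B β : ℝ)) =O[atTop] fun β : ℝ => β * (mixScale B ε₀ β : ℝ) := by
  refine (hi.cavityScale_isBigO ⟨_, hB0⟩).2.trans (Asymptotics.IsBigO.of_bound 1 ?_)
  filter_upwards [eventually_exp_le_mixScale hc hd h01 hB0 hB1 hB2 hcard hε₀,
    eventually_gt_atTop 0] with β hβ hβ0
  rw [one_mul, Real.norm_of_nonneg (mul_nonneg hβ0.le (Real.exp_pos _).le),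
    Real.norm_of_nonneg (mul_nonneg hβ0.le (Nat.cast_nonneg _))]
  exact mul_le_mul_of_nonneg_left hβ hβ0.le

theorem exists_gibbs_multispinScale {B : Finset Site} (hi : HasInsulation B)
    (ht : HasTightDomains B) (h01 : IsUnit01 B) (hcard : 2 ≤ B.card) :
    ∃ μ : ℝ → Measure Config,
      (∀ β : ℝ, 0 < β → IsGibbs B β (μ β) ∧ ∀ ν : Measure Config, IsGibbs B β ν → ν = μ β) ∧
        (fun β : ℝ => (multispinScale (μ β) : ℝ)) =Θ[atTop]
          fun β : ℝ => Real.exp (Real.log 2 / Real.log B.card * β) := by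
  have hB : B.Nonempty := Finset.card_pos.1 (by omega)
  choose μ hμ using fun β : ℝ => exists_isGibbs hB β
  exact ⟨μ, fun β hβ => ⟨hμ β, fun ν hν => IsGibbs.unique hi hB hβ (hμ β) hν⟩,
    multispinScale_isTheta hi ht h01 hcard fun β _ => hμ β⟩

end Plaquette

end

theorem theorem2 (ε₀ : ℝ) (hε₀ : 0 < ε₀) :
    -- square plaquette model
    ((fun β : ℝ => (Plaquette.cavityScale Plaquette.spm β : ℝ)) =O[atTop]
        (fun β : ℝ => β * (Plaquette.mixScale Plaquette.spm ε₀ β : ℝ)) ∧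
      (fun β : ℝ => Real.exp β) =O[atTop]
        (fun β : ℝ => (Plaquette.cavityScale Plaquette.spm β : ℝ)) ∧
      ∃ μ : ℝ → Measure Plaquette.Config,
        (∀ β : ℝ, 0 < β → Plaquette.IsGibbs Plaquette.spm β (μ β) ∧
          ∀ ν : Measure Plaquette.Config, Plaquette.IsGibbs Plaquette.spm β ν → ν = μ β) ∧
        (fun β : ℝ => (Plaquette.multispinScale (μ β) : ℝ)) =Θ[atTop]
          (fun β : ℝ => Real.exp (β / 2))) ∧
    -- triangular plaquette model
    ((fun β : ℝ => (Plaquette.cavityScale Plaquette.tpm β : ℝ)) =O[atTop]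
        (fun β : ℝ => β * (Plaquette.mixScale Plaquette.tpm ε₀ β : ℝ)) ∧
      (fun β : ℝ => Real.exp (Real.log 2 / Real.log 3 * β)) =O[atTop]
        (fun β : ℝ => (Plaquette.cavityScale Plaquette.tpm β : ℝ)) ∧
      ∃ μ : ℝ → Measure Plaquette.Config,
        (∀ β : ℝ, 0 < β → Plaquette.IsGibbs Plaquette.tpm β (μ β) ∧
          ∀ ν : Measure Plaquette.Config, Plaquette.IsGibbs Plaquette.tpm β ν → ν = μ β) ∧
        (fun β : ℝ => (Plaquette.multispinScale (μ β) : ℝ)) =Θ[atTop]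
          (fun β : ℝ => Real.exp (Real.log 2 / Real.log 3 * β))) ∧
    -- both models
    (fun β : ℝ => (Plaquette.cavityScale Plaquette.spm β : ℝ)) =O[atTop]
      (fun β : ℝ => β * Real.exp β) ∧
    (fun β : ℝ => (Plaquette.cavityScale Plaquette.tpm β : ℝ)) =O[atTop]
      (fun β : ℝ => β * Real.exp β) := by
  have h4 : Real.log 2 / Real.log (Plaquette.spm.card : ℝ) = 1 / 2 := by
    have h1 : Real.log 2 ≠ 0 := (Real.log_pos one_lt_two).ne'
    rw [Plaquette.card_spm, show ((4 : ℕ) : ℝ) = 2 ^ 2 by norm_num, Real.log_pow]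
    push_cast
    field_simp
  have hs := Plaquette.hasInsulation_spm.cavityScale_isBigO Plaquette.spm_nonempty
  have ht := Plaquette.hasInsulation_tpm.cavityScale_isBigO Plaquette.tpm_nonempty
  refine ⟨⟨?_, Plaquette.exp_isBigO_cavityScale_spm hs.1, ?_⟩,
    ⟨?_, Plaquette.exp_isBigO_cavityScale_tpm ht.1, ?_⟩, hs.2, ht.2⟩
  · exact Plaquette.cavityScale_isBigO_mixScale Plaquette.hasInsulation_spm
      Plaquette.hasCollars_spm Plaquette.hasDroplets_spm Plaquette.isUnit01_spm
      (by decide) (by decide) (by decide) (by decide) hε₀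
  · obtain ⟨μ, hμ, hΘ⟩ := Plaquette.exists_gibbs_multispinScale Plaquette.hasInsulation_spm
      Plaquette.hasTightDomains_spm Plaquette.isUnit01_spm (by decide)
    refine ⟨μ, hμ, ?_⟩
    rw [h4] at hΘ
    simpa only [one_div, inv_mul_eq_div] using hΘ
  · exact Plaquette.cavityScale_isBigO_mixScale Plaquette.hasInsulation_tpm
      Plaquette.hasCollars_tpm Plaquette.hasDroplets_tpm Plaquette.isUnit01_tpm
      (by decide) (by decide) (by decide) (by decide) hε₀
  · obtain ⟨μ, hμ, hΘ⟩ := Plaquette.exists_gibbs_multispinScale Plaquette.hasInsulation_tpm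
      Plaquette.hasTightDomains_tpm Plaquette.isUnit01_tpm (by decide)
    refine ⟨μ, hμ, ?_⟩
    rw [Plaquette.card_tpm] at hΘ
    exact_mod_cast hΘ
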